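/- Let $0<\varepsilon<\tfrac12$ and $0<\beta<1$. For a graph $G$ and a non-empty set $S$ of its vertices, the density of $S$ is the average degree of the subgraph of $G$ induced on $S$. Then for every $c>0$ there are a randomized algorithm and constants $A,B\in\mathbb R$ such that the following holds for every $n\ge 2$, every integer $k$ with $|k-n^{\beta}|<1$ (that is, $k=n^{\beta}$ up to rounding), and every simple graph $G$ on $n$ vertices. On input $(G,k)$ the algorithm always halts, for every outcome of its random bits, within $$2^{A(\log n)^{B}\,n^{2\beta\varepsilon/(2\beta\varepsilon+(1-\beta))}}=2^{\tilde O\left(n^{2\beta\varepsilon/(2\beta\varepsilon+(1-\beta))}\right)}$$ steps, and with probability at least $1-n^{-c}$ it outputs a set $S$ of exactly $k$ vertices such that every set $T$ of $k$ vertices satisfies $$\mathrm{density}(T)\le A(\log n)^{B}\,n^{\beta(1-\beta)(1-\varepsilon)}\cdot\mathrm{density}(S),$$ i.e. $S$ is within a factor $\tilde O\left(n^{\beta(1-\beta)(1-\varepsilon)}\right)$ of the optimum density. Here an algorithm is one fixed finite program (depending on $\varepsilon,\beta,c$ only) of a unit-cost random access machine on natural numbers with addition, truncated subtraction, zero tests,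 indirect addressing and independent fair coin flips, which receives $n$, $k$ and the adjacency matrix of $G$. -/

import Mathlib

open MeasureTheory

/-! ### Randomized random access machines

Structured programs for the unit-cost RAM with unbounded natural numbers whose arithmetic is addition
and truncated subtraction only (so that step counts are polynomially related to Turing machine time),
with indirect addressing and fair coin flips. -/

/-- Programs. A program mentions finitely many registers and finitely many arrays. -/
inductive RAMProg : Type
  /-- `reg i := c` -/
  | const (i c : ℕ)
  /-- `reg i := reg j + reg l` -/
  | add (i j l : ℕ)
  /-- `reg i := reg j - reg l` (truncated at `0`) -/
  | sub (i j l : ℕ)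
  /-- `reg i := arr a [reg j]` -/
  | load (i a j : ℕ)
  /-- `arr a [reg j] := reg i` -/
  | store (a j i : ℕ)
  /-- `reg i := ` a fresh fair random bit -/
  | flip (i : ℕ)
  /-- first `p`, then `q` -/
  | seq (p q : RAMProg)
  /-- if `reg i ≠ 0` then `p` else `q` -/
  | ite (i : ℕ) (p q : RAMProg)
  /-- while `reg i ≠ 0` do `p` -/
  | loop (i : ℕ) (p : RAMProg)

/-- Memory contents together with the number of random bits used so far. -/
structure RAMState : Type where
  reg : ℕ → ℕ
  arr : ℕ → ℕ → ℕ
  coins : ℕ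

namespace RAMState

/-- Assign `x` to register `i`. -/
def setReg (s : RAMState) (i x : ℕ) : RAMState :=
  { s with reg := Function.update s.reg i x }

/-- Assign `x` to cell `m` of array `a`. -/
def setArr (s : RAMState) (a m x : ℕ) : RAMState :=
  { s with arr := Function.update s.arr a (Function.update (s.arr a) m x) }

end RAMState

/-- `RAMExec ω p s s' t`: if the successive random bits are `ω 0, ω 1, ω 2, …`, then the program `p`
started in the state `s` halts in the state `s'` after exactly `t` steps. Every instruction and every
evaluation of the test of a conditional or of a loop is one step. -/
inductive RAMExec (ω : ℕ → Bool) : RAMProg → RAMState → RAMState → ℕ → Prop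
  | const (i c : ℕ) (s : RAMState) :
      RAMExec ω (.const i c) s (s.setReg i c) 1
  | add (i j l : ℕ) (s : RAMState) :
      RAMExec ω (.add i j l) s (s.setReg i (s.reg j + s.reg l)) 1
  | sub (i j l : ℕ) (s : RAMState) :
      RAMExec ω (.sub i j l) s (s.setReg i (s.reg j - s.reg l)) 1
  | load (i a j : ℕ) (s : RAMState) :
      RAMExec ω (.load i a j) s (s.setReg i (s.arr a (s.reg j))) 1
  | store (a j i : ℕ) (s : RAMState) :
      RAMExec ω (.store a j i) s (s.setArr a (s.reg j) (s.reg i)) 1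
  | flip (i : ℕ) (s : RAMState) :
      RAMExec ω (.flip i) s
        { s.setReg i (if ω s.coins = true then 1 else 0) with coins := s.coins + 1 } 1
  | seq {p q : RAMProg} {s s' s'' : RAMState} {t t' : ℕ}
      (hp : RAMExec ω p s s' t) (hq : RAMExec ω q s' s'' t') :
      RAMExec ω (.seq p q) s s'' (t + t')
  | ite_ne {i : ℕ} {p q : RAMProg} {s s' : RAMState} {t : ℕ}
      (hi : s.reg i ≠ 0) (hp : RAMExec ω p s s' t) :
      RAMExec ω (.ite i p q) s s' (t + 1)
  | ite_eq {i : ℕ} {p q : RAMProg} {s s' : RAMState} {t : ℕ}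
      (hi : s.reg i = 0) (hq : RAMExec ω q s s' t) :
      RAMExec ω (.ite i p q) s s' (t + 1)
  | loop_ne {i : ℕ} {p : RAMProg} {s s' s'' : RAMState} {t t' : ℕ}
      (hi : s.reg i ≠ 0) (hp : RAMExec ω p s s' t) (hl : RAMExec ω (.loop i p) s' s'' t') :
      RAMExec ω (.loop i p) s s'' (t + t' + 1)
  | loop_eq {i : ℕ} {p : RAMProg} {s : RAMState} (hi : s.reg i = 0) :
      RAMExec ω (.loop i p) s s 1

/-- The law of an infinite sequence of independent fair coin flips. -/
noncomputable def fairCoins : Measure (ℕ → Bool) :=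
  Measure.infinitePi fun _ => (PMF.uniformOfFintype Bool).toMeasure

/-! ### Dense `k`-subgraph -/

open Classical in
/-- The average degree of the subgraph of `G` induced on `S` (`0` if `S` is empty). -/
noncomputable def avgDegree {n : ℕ} (G : SimpleGraph (Fin n)) (S : Finset (Fin n)) : ℝ :=
  (∑ v ∈ S, ((S.filter fun w => G.Adj v w).card : ℝ)) / (S.card : ℝ)

open Classical in
/-- The initial state for the instance `(G, k)`: `reg 0 = n`, `reg 1 = k`, the array `0` holds the
adjacency matrix of `G` row by row, and everything else is `0`. -/
noncomputable def dksInput {n : ℕ} (G : SimpleGraph (Fin n)) (k : ℕ) : RAMState where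
  reg i := if i = 0 then n else if i = 1 then k else 0
  arr a m := if a = 0 ∧ ∃ u v : Fin n, m = (u : ℕ) * n + (v : ℕ) ∧ G.Adj u v then 1 else 0
  coins := 0

/-- The output vertex set of a halted program: the vertices `v` with `arr 1 [v] ≠ 0`. -/
def dksOutput (n : ℕ) (s : RAMState) : Finset (Fin n) :=
  Finset.univ.filter fun v => s.arr 1 (v : ℕ) ≠ 0

/-- `S` is a set of `k` vertices whose induced subgraph has average degree within the factor `ρ` of the
maximum over all sets of `k` vertices. -/
def IsDkSApprox {n : ℕ} (G : SimpleGraph (Fin n)) (k : ℕ) (ρ : ℝ) (S : Finset (Fin n)) : Prop :=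
  S.card = k ∧ ∀ T : Finset (Fin n), T.card = k → avgDegree G T ≤ ρ * avgDegree G S

/-!
The algorithm is deterministic: it flips no coins, so that the success probability is `1`, and it works
with a rational exponent `μ` strictly between `β ε / (1 - β + β ε)` and the exponent of the time bound.
There is room between the two, so powers of `n` absorb all logarithmic factors.

**The algorithm.** A *set program* is a sequence of about `n ^ μ` operations on sets of vertices
(`opSet`), each given by six numbers: keep the vertices of `P` with at least `θ` neighbours in `Q` (cut
down to the first few if desired), add `R` or a single vertex, and stay outside a given set `F`. There are
`2 ^ Õ(n ^ μ)` set programs, and all of them are tried. For every guess of a target degree `g`, the set `F`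
starts as a small set of vertices of large degree and is replaced by `F ∪ A` whenever some set program
produces a set `A` for which `F ∪ A` has at most `k` vertices and average degree about `g`. The final `F`
is stable. It is extended to `k` vertices in all ways of a simple form (`Cmd.extend`), and the best set that
is ever seen is returned. `Cmd.exists_search_program` is the statement about the machine.

**The approximation ratio.** Let `T` be an optimal set, of average degree `D`, and `g = D / n ^ δ`. If `F`
has at least `k / 2` vertices, or starts with `k / 4` vertices of large degree, or meets half of the edges of
`T`, then some extension of `F` has average degree of order `g` or of order `D / log n`
(`Cmd.SearchOptimal.dense`). Otherwise `T \ F` contains a set `T'` of minimum degree `d` of order `D`,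
and the vertices outside `F` have degree at most about `Θ = g n / k`. Then a short set program finds a
small set of average degree at least `g` outside `F`, which contradicts stability
(`exists_isGood_of_min_degree`). For this, consider a set `S` produced by a set program and `R = S ∩ T'`.
The edges from `R` into `T'` lead to a set `W ⊆ T'` on which the degrees into `S` are of one order `b`.
Either many vertices outside `F` have so many neighbours in `S` that a dense small subgraph can be read off
(`exists_isGood`), or `b` is small, and one can continue in one of two ways (`IsStage.exists_next`):
if `W` is larger than `S`, replace `S` by the set of all vertices with many neighbours in `S`; if it is
smaller, guess up to `n ^ μ` vertices of `W` that cover much of `R`, and replace `S` by the set of their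
neighbours in `S`. In both cases the potential `log |R| - r log |S|` grows by a fixed multiple of `log n`
(`IsStage.exists_potential_le`), where `r` is slightly less than `β (1 - ε)`; as it is at most `log n` in
absolute value, the number of steps is bounded.
-/

/-! ### Counting loops on the random access machine -/

namespace RAMState

@[simp] theorem setReg_reg (s : RAMState) (i x j : ℕ) :
    (s.setReg i x).reg j = if j = i then x else s.reg j := by
  simp [setReg, Function.update_apply]

@[simp] theorem setReg_arr (s : RAMState) (i x : ℕ) : (s.setReg i x).arr = s.arr := rfl

@[simp] theorem setArr_reg (s : RAMState) (a m x : ℕ) : (s.setArr a m x).reg = s.reg := rfl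

theorem setArr_arr (s : RAMState) (a m x b j : ℕ) :
    (s.setArr a m x).arr b j = if b = a ∧ j = m then x else s.arr b j := by
  simp only [setArr, Function.update_apply]
  by_cases h : b = a
  · subst h; simp [Function.update_apply]
  · simp [h]

theorem setArr_arr_of_ne (s : RAMState) {a b : ℕ} (m x : ℕ) (h : b ≠ a) :
    (s.setArr a m x).arr b = s.arr b := by
  simp [setArr, h]

end RAMState

/-- Deterministic programs whose only loops are counting loops. `forTo i c b q` runs `q` once for each
value `0, 1, …, reg b - 1` of the register `i`; the register `c` counts down. -/
inductive Cmd : Type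
  | const (i c : ℕ)
  | add (i j l : ℕ)
  | sub (i j l : ℕ)
  | load (i a j : ℕ)
  | store (a j i : ℕ)
  | seq (p q : Cmd)
  | ite (i : ℕ) (p q : Cmd)
  | forTo (i c b : ℕ) (q : Cmd)

namespace Cmd

infixr:60 ";;" => Cmd.seq

/-- The machine program of a command. Register `2` is expected to hold `1`. -/
def toProg : Cmd → RAMProg
  | const i c => .const i c
  | add i j l => .add i j l
  | sub i j l => .sub i j l
  | load i a j => .load i a j
  | store a j i => .store a j i
  | seq p q => .seq p.toProg q.toProg
  | ite i p q => .ite i p.toProg q.toProg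
  | forTo i c b q => .seq (.const i 0) (.seq (.const c 0) (.seq (.add c c b)
      (.loop c (.seq q.toProg (.seq (.add i i 2) (.sub c c 2))))))

/-- The bookkeeping at the end of a round of a counting loop. -/
def bump (i c : ℕ) (s : RAMState) : RAMState :=
  (s.setReg i (s.reg i + 1)).setReg c (s.reg c - 1)

/-- The state reached by a command. -/
def run : Cmd → RAMState → RAMState
  | const i c, s => s.setReg i c
  | add i j l, s => s.setReg i (s.reg j + s.reg l)
  | sub i j l, s => s.setReg i (s.reg j - s.reg l)
  | load i a j, s => s.setReg i (s.arr a (s.reg j))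
  | store a j i, s => s.setArr a (s.reg j) (s.reg i)
  | seq p q, s => q.run (p.run s)
  | ite i p q, s => if s.reg i = 0 then q.run s else p.run s
  | forTo i c b q, s => (fun s => bump i c (q.run s))^[s.reg b] ((s.setReg i 0).setReg c (s.reg b))

/-- The registers that a command may change. -/
def wr : Cmd → List ℕ
  | const i _ => [i]
  | add i _ _ => [i]
  | sub i _ _ => [i]
  | load i _ _ => [i]
  | store _ _ _ => []
  | seq p q => p.wr ++ q.wr
  | ite _ p q => p.wr ++ q.wr
  | forTo i c _ q => i :: c :: q.wr

/-- The arrays that a command may change. -/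
def wa : Cmd → List ℕ
  | store a _ _ => [a]
  | seq p q => p.wa ++ q.wa
  | ite _ p q => p.wa ++ q.wa
  | forTo _ _ _ q => q.wa
  | _ => []

/-- The registers that bound the loops of a command. -/
def bds : Cmd → List ℕ
  | seq p q => p.bds ++ q.bds
  | ite _ p q => p.bds ++ q.bds
  | forTo _ _ b q => b :: q.bds
  | _ => []

/-- The counters of nested loops do not interfere, and register `2` is never written. -/
def ok : Cmd → Bool
  | seq p q => p.ok && q.ok
  | ite _ p q => p.ok && q.ok
  | forTo i c b q => q.ok && i != c && i != b && c != b && i != 2 && c != 2 &&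
      !q.wr.contains i && !q.wr.contains c
  | const i _ => i != 2
  | add i _ _ => i != 2
  | sub i _ _ => i != 2
  | load i _ _ => i != 2
  | store _ _ _ => true

/-- A bound on the number of steps if every loop has at most `K` rounds. -/
def cost : Cmd → ℕ → ℕ
  | seq p q, K => p.cost K + q.cost K
  | ite _ p q, K => p.cost K + q.cost K + 1
  | forTo _ _ _ q, K => K * (q.cost K + 3) + 4
  | _, _ => 1

theorem run_seq (p q : Cmd) (s : RAMState) : (p ;; q).run s = q.run (p.run s) := rfl

@[simp] theorem bump_reg (i c : ℕ) (s : RAMState) (j : ℕ) :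
    (bump i c s).reg j = if j = c then s.reg c - 1 else if j = i then s.reg i + 1 else s.reg j := by
  simp [bump]

@[simp] theorem bump_arr (i c : ℕ) (s : RAMState) : (bump i c s).arr = s.arr := rfl

theorem run_reg_of_notMem (p : Cmd) (s : RAMState) {r : ℕ} (h : r ∉ p.wr) :
    (p.run s).reg r = s.reg r := by
  induction p generalizing s with
  | const | add | sub | load => simp [wr] at h; simp [run, h]
  | store => simp [run]
  | seq p q hp hq => simp [wr] at h; simp [run, hp, hq, h]
  | ite i p q hp hq => simp [wr] at h; simp only [run]; split_ifs <;> simp [hp, hq, h]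
  | forTo i c b q hq =>
    simp [wr] at h
    have : ∀ N (s : RAMState), ((fun s => bump i c (q.run s))^[N] s).reg r = s.reg r := by
      intro N
      induction N with
      | zero => simp
      | succ N ih => intro s; simp [Function.iterate_succ_apply', ih, h, hq]
    simp [run, this, h]

theorem run_arr_of_notMem (p : Cmd) (s : RAMState) {a : ℕ} (h : a ∉ p.wa) :
    (p.run s).arr a = s.arr a := by
  induction p generalizing s with
  | const | add | sub | load => simp [run]
  | store => simp [wa] at h; simp [run, RAMState.setArr_arr_of_ne, h]
  | seq p q hp hq => simp [wa] at h; simp [run, hp, hq, h]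
  | ite i p q hp hq => simp [wa] at h; simp only [run]; split_ifs <;> simp [hp, hq, h]
  | forTo i c b q hq =>
    simp [wa] at h
    have : ∀ N (s : RAMState), ((fun s => bump i c (q.run s))^[N] s).arr a = s.arr a := by
      intro N
      induction N with
      | zero => simp
      | succ N ih => intro s; simp [Function.iterate_succ_apply', ih, h, hq]
    simp [run, this]

theorem two_notMem_wr {p : Cmd} (h : p.ok = true) : 2 ∉ p.wr := by
  induction p with
  | const | add | sub | load => simp [ok] at h; simp [wr]; omega
  | store => simp [wr]
  | seq p q hp hq | ite i p q hp hq =>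
    simp only [ok, Bool.and_eq_true] at h; simp [wr, hp h.1, hq h.2]
  | forTo i c b q hq =>
    simp [ok] at h; simp [wr, hq h.1.1.1.1.1.1.1]; omega

/-- A command halts in the state that `run` computes, within `cost` steps. -/
theorem exec (p : Cmd) (K : ℕ) (s : RAMState) (hok : p.ok = true) (h1 : s.reg 2 = 1)
    (hb : ∀ b ∈ p.bds, s.reg b ≤ K ∧ b ∉ p.wr) :
    ∃ t ≤ p.cost K, ∀ ω, RAMExec ω p.toProg s (p.run s) t := by
  induction p generalizing s with
  | const => exact ⟨1, by simp [cost], fun ω => .const ..⟩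
  | add => exact ⟨1, by simp [cost], fun ω => .add ..⟩
  | sub => exact ⟨1, by simp [cost], fun ω => .sub ..⟩
  | load => exact ⟨1, by simp [cost], fun ω => .load ..⟩
  | store => exact ⟨1, by simp [cost], fun ω => .store ..⟩
  | seq p q hp hq =>
    simp only [ok, Bool.and_eq_true] at hok
    simp only [bds, wr, List.mem_append, not_or] at hb
    obtain ⟨t, ht, h⟩ := hp s hok.1 h1 fun b hb' => ⟨(hb b (.inl hb')).1, (hb b (.inl hb')).2.1⟩
    obtain ⟨t', ht', h'⟩ := hq (p.run s) hok.2
      (by rw [run_reg_of_notMem _ _ (two_notMem_wr hok.1), h1]) fun b hb' => by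
        have := hb b (.inr hb')
        rw [run_reg_of_notMem _ _ this.2.1]
        exact ⟨this.1, this.2.2⟩
    exact ⟨t + t', by simp [cost]; omega, fun ω => .seq (h ω) (h' ω)⟩
  | ite i p q hp hq =>
    simp only [ok, Bool.and_eq_true] at hok
    simp only [bds, wr, List.mem_append, not_or] at hb
    by_cases hi : s.reg i = 0
    · obtain ⟨t, ht, h⟩ := hq s hok.2 h1 fun b hb' => ⟨(hb b (.inr hb')).1, (hb b (.inr hb')).2.2⟩
      exact ⟨t + 1, by simp [cost]; omega, fun ω => by
        rw [run, if_pos hi]; exact .ite_eq hi (h ω)⟩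
    · obtain ⟨t, ht, h⟩ := hp s hok.1 h1 fun b hb' => ⟨(hb b (.inl hb')).1, (hb b (.inl hb')).2.1⟩
      exact ⟨t + 1, by simp [cost]; omega, fun ω => by
        rw [run, if_neg hi]; exact .ite_ne hi (h ω)⟩
  | forTo i c b q hq =>
    have h2 := two_notMem_wr hok
    simp only [ok, Bool.and_eq_true, bne_iff_ne, Bool.not_eq_true', List.contains_eq_mem,
      decide_eq_false_iff_not, ne_eq] at hok
    obtain ⟨⟨⟨⟨⟨⟨⟨hqok, hic⟩, hib⟩, hcb⟩, hi2⟩, hc2⟩, hiq⟩, hcq⟩ := hok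
    simp only [bds, wr, List.mem_cons, not_or] at hb
    -- the loop itself, by induction on the value of its counter
    have loop : ∀ N (s : RAMState), s.reg c = N → s.reg 2 = 1 → (∀ b ∈ q.bds, s.reg b ≤ K) →
        ∃ t ≤ N * (q.cost K + 3) + 1, ∀ ω, RAMExec ω
          (.loop c (.seq q.toProg (.seq (.add i i 2) (.sub c c 2)))) s
          ((fun s => bump i c (q.run s))^[N] s) t := by
      intro N
      induction N with
      | zero => exact fun s hs _ _ => ⟨1, by simp, fun ω => .loop_eq hs⟩
      | succ N ih =>
        intro s hs hs2 hsb
        obtain ⟨t, ht, h⟩ := hq s hqok hs2 fun b' hb' => ⟨hsb b' hb', (hb b' (.inr hb')).2.2.2⟩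
        have hq2 : (q.run s).reg 2 = 1 := by
          rw [run_reg_of_notMem _ _ (two_notMem_wr hqok), hs2]
        obtain ⟨t', ht', h'⟩ := ih (bump i c (q.run s))
          (by simp [run_reg_of_notMem _ _ hcq, hs])
          (by simp [Ne.symm hi2, Ne.symm hc2, hq2]) fun b' hb' => by
            have := hb b' (.inr hb')
            simp [this.2.1, this.2.2.1, run_reg_of_notMem _ _ this.2.2.2, hsb b' hb']
        refine ⟨t + (1 + 1) + t' + 1, by rw [Nat.succ_mul]; omega, fun ω => ?_⟩
        have e : bump i c (q.run s) =
            ((q.run s).setReg i ((q.run s).reg i + (q.run s).reg 2)).setReg c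
              (((q.run s).setReg i ((q.run s).reg i + (q.run s).reg 2)).reg c -
              ((q.run s).setReg i ((q.run s).reg i + (q.run s).reg 2)).reg 2) := by
          simp [bump, hq2, Ne.symm hi2, Ne.symm hic]
        have hl := h' ω
        rw [e] at hl
        rw [Function.iterate_succ_apply]
        rw [e]
        exact .loop_ne (by omega) (.seq (h ω) (.seq (.add ..) (.sub ..))) hl
    obtain ⟨t, ht, h⟩ := loop (s.reg b) ((s.setReg i 0).setReg c (s.reg b)) (by simp)
      (by simp [Ne.symm hi2, Ne.symm hc2, h1]) fun b' hb' => by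
        have := hb b' (.inr hb')
        simp [this.2.1, this.2.2.1, this.1]
    refine ⟨1 + (1 + (1 + t)), ?_, fun ω => ?_⟩
    · have := Nat.mul_le_mul_right (q.cost K + 3) (hb b (.inl rfl)).1
      simp only [cost]; omega
    · refine .seq (.const ..) (.seq (.const ..) (.seq (.add ..) ?_))
      convert h ω using 1
      · simp only [RAMState.setReg, Function.update_self, Function.update_idem,
        Function.update_of_ne (Ne.symm hib), Function.update_of_ne (Ne.symm hcb), Nat.zero_add]
      · rfl

/-- Invariant rule for counting loops: `I j` holds before round `j`, when every register and array not
written by the loop still has its initial contents. -/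
theorem forTo_induct {i c b : ℕ} {q : Cmd} {s : RAMState} (I : ℕ → RAMState → Prop)
    (hic : i ≠ c) (hiq : i ∉ q.wr)
    (h0 : I 0 ((s.setReg i 0).setReg c (s.reg b)))
    (hstep : ∀ j < s.reg b, ∀ s' : RAMState, s'.reg i = j →
      (∀ r, r ∉ i :: c :: q.wr → s'.reg r = s.reg r) → (∀ a, a ∉ q.wa → s'.arr a = s.arr a) →
      I j s' → I (j + 1) (bump i c (q.run s'))) :
    I (s.reg b) ((forTo i c b q).run s) := by
  set s0 := (s.setReg i 0).setReg c (s.reg b) with hs0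
  have : ∀ N ≤ s.reg b,
      I N ((fun s => bump i c (q.run s))^[N] s0) ∧
      ((fun s => bump i c (q.run s))^[N] s0).reg i = N ∧
      (∀ r, r ∉ i :: c :: q.wr → ((fun s => bump i c (q.run s))^[N] s0).reg r = s.reg r) ∧
      ∀ a, a ∉ q.wa → ((fun s => bump i c (q.run s))^[N] s0).arr a = s.arr a := by
    intro N
    induction N with
    | zero =>
      refine fun _ => ⟨h0, by simp [hs0, hic], fun r hr => ?_, fun a _ => by simp [hs0]⟩
      simp at hr; simp [hs0, hr]
    | succ N ih =>
      intro hN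
      obtain ⟨h1, h2, h3, h4⟩ := ih (by omega)
      simp only [Function.iterate_succ_apply']
      refine ⟨hstep N (by omega) _ h2 h3 h4 h1, ?_, fun r hr => ?_, fun a ha => ?_⟩
      · simp [hic, run_reg_of_notMem _ _ hiq, h2]
      · rw [← h3 r hr]; simp at hr; simp [hr, run_reg_of_notMem _ _ hr.2.2]
      · simp [run_arr_of_notMem _ _ ha, h4 a ha]
  exact (this _ le_rfl).1

/-- The running time is polynomial in the largest number of rounds of a loop. -/
theorem exists_cost_le (p : Cmd) : ∃ C e : ℕ, ∀ K, p.cost K ≤ C * (K + 1) ^ e := by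
  induction p with
  | seq p q hp hq | ite i p q hp hq =>
    obtain ⟨C, e, h⟩ := hp
    obtain ⟨C', e', h'⟩ := hq
    refine ⟨C + C' + 1, e + e', fun K => ?_⟩
    have h1 : (K + 1) ^ e ≤ (K + 1) ^ (e + e') := Nat.pow_le_pow_right (by omega) (by omega)
    have h2 : (K + 1) ^ e' ≤ (K + 1) ^ (e + e') := Nat.pow_le_pow_right (by omega) (by omega)
    have h3 : 1 ≤ (K + 1) ^ (e + e') := Nat.one_le_pow _ _ (by omega)
    have := h K
    have := h' K
    simp only [cost]
    nlinarith [Nat.mul_le_mul_left C h1, Nat.mul_le_mul_left C' h2]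
  | forTo i c b q hq =>
    obtain ⟨C, e, h⟩ := hq
    refine ⟨C + 7, e + 1, fun K => ?_⟩
    have h3 : 1 ≤ (K + 1) ^ e := Nat.one_le_pow _ _ (by omega)
    have := h K
    have h4 : K * (q.cost K + 3) ≤ K * ((C + 3) * (K + 1) ^ e) := Nat.mul_le_mul_left _ (by nlinarith)
    simp only [cost, pow_succ]
    nlinarith [Nat.zero_le (K * (K + 1) ^ e), Nat.zero_le (C * (K + 1) ^ e)]
  | _ => exact ⟨1, 0, fun K => by simp [cost]⟩

end Cmd

/-! ### Sets of vertices described by degrees -/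

section Sets

variable {n : ℕ} (G : SimpleGraph (Fin n))

open Classical in
/-- The number of neighbours of `v` in `Q`. -/
noncomputable def degIn (Q : Finset (Fin n)) (v : Fin n) : ℕ := (Q.filter (G.Adj v)).card

/-- The number of ordered pairs of adjacent vertices of `S`, twice the number of edges induced on `S`. -/
noncomputable def adjPairs (S : Finset (Fin n)) : ℕ := ∑ v ∈ S, degIn G S v

open Classical in
/-- The basic operation of the algorithm: all vertices outside `B` that belong to `R`, or are the
vertex number `x`, or belong to `P`, have a number less than `y` and at least `θ` neighbours in `Q`.
The bound `y` serves to cut a set down to a prescribed size. -/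
noncomputable def opSet (B P Q R : Finset (Fin n)) (θ y x : ℕ) : Finset (Fin n) :=
  Finset.univ.filter fun v => v ∉ B ∧
    ((v ∈ P ∧ θ ≤ degIn G Q v ∧ (v : ℕ) < y) ∨ (v : ℕ) = x ∨ v ∈ R)

theorem mem_opSet {B P Q R : Finset (Fin n)} {θ y x : ℕ} {v : Fin n} :
    v ∈ opSet G B P Q R θ y x ↔ v ∉ B ∧
      ((v ∈ P ∧ θ ≤ degIn G Q v ∧ (v : ℕ) < y) ∨ (v : ℕ) = x ∨ v ∈ R) := by
  simp [opSet]

end Sets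

/-! ### The set operation on the machine -/

namespace Cmd

open Finset

/-- Copy register `j` to register `i ≠ j`. -/
def cp (i j : ℕ) : Cmd := const i 0 ;; add i i j

/-- Do nothing (register `9` is a dummy). -/
def skip : Cmd := const 9 0

/-- The machine keeps sets of vertices in array `2`, in the columns `0, 1, …, N - 1`: the vertex `v`
belongs to the set number `c` if the cell `c + v * N` is not `0`. -/
def col (n N : ℕ) (s : RAMState) (c : ℕ) : Finset (Fin n) :=
  univ.filter fun v => s.arr 2 (c + v * N) ≠ 0

theorem mem_col {n N : ℕ} {s : RAMState} {c : ℕ} {v : Fin n} :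
    v ∈ col n N s c ↔ s.arr 2 (c + v * N) ≠ 0 := by simp [col]

/-- The registers that every part of the program relies on. -/
structure Ctx {n : ℕ} (G : SimpleGraph (Fin n)) (N : ℕ) (s : RAMState) : Prop where
  reg0 : s.reg 0 = n
  reg2 : s.reg 2 = 1
  reg3 : s.reg 3 = N
  arr0 : s.arr 0 = (dksInput G 0).arr 0

theorem Ctx.of_eq {n : ℕ} {G : SimpleGraph (Fin n)} {N : ℕ} {s s' : RAMState} (h : Ctx G N s)
    (h0 : s'.reg 0 = s.reg 0) (h2 : s'.reg 2 = s.reg 2) (h3 : s'.reg 3 = s.reg 3)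
    (ha : s'.arr 0 = s.arr 0) : Ctx G N s' :=
  ⟨h0.trans h.reg0, h2.trans h.reg2, h3.trans h.reg3, ha.trans h.arr0⟩

theorem Ctx.run {n : ℕ} {G : SimpleGraph (Fin n)} {N : ℕ} {s : RAMState} (h : Ctx G N s) {p : Cmd}
    (hr : 0 ∉ p.wr ∧ 2 ∉ p.wr ∧ 3 ∉ p.wr ∧ 0 ∉ p.wa) : Ctx G N (p.run s) :=
  h.of_eq (run_reg_of_notMem _ _ hr.1) (run_reg_of_notMem _ _ hr.2.1)
    (run_reg_of_notMem _ _ hr.2.2.1) (run_arr_of_notMem _ _ hr.2.2.2)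

open Classical in
theorem dksInput_adj {n : ℕ} (G : SimpleGraph (Fin n)) (k : ℕ) (u v : Fin n) :
    (dksInput G k).arr 0 (u * n + v) = if G.Adj u v then 1 else 0 := by
  simp only [dksInput, true_and]
  congr 1
  refine propext ⟨?_, fun h => ⟨u, v, rfl, h⟩⟩
  rintro ⟨u', v', h, hadj⟩
  have hn : 0 < n := u.pos
  have h1 : (u : ℕ) = u' := by
    have := congrArg (· / n) h
    simpa [Nat.mul_comm _ n, Nat.mul_add_div hn, Nat.div_eq_of_lt v.2, Nat.div_eq_of_lt v'.2]
      using this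
  have h2 : (v : ℕ) = v' := by rw [h1] at h; omega
  rwa [Fin.ext h1, Fin.ext h2]

theorem card_filter_lt_succ {n j : ℕ} (hj : j < n) (p : Fin n → Prop) [DecidablePred p] :
    (univ.filter fun u : Fin n => (u : ℕ) < j + 1 ∧ p u).card =
      (univ.filter fun u : Fin n => (u : ℕ) < j ∧ p u).card + if p ⟨j, hj⟩ then 1 else 0 := by
  have : (univ.filter fun u : Fin n => (u : ℕ) < j + 1 ∧ p u) =
      (univ.filter fun u : Fin n => (u : ℕ) < j ∧ p u) ∪
        (univ.filter fun u : Fin n => u = ⟨j, hj⟩ ∧ p u) := by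
    ext u
    simp only [mem_filter, mem_univ, true_and, mem_union, Fin.ext_iff]
    constructor
    · rintro ⟨h1, h2⟩
      rcases Nat.lt_succ_iff_lt_or_eq.1 h1 with h | h
      exacts [.inl ⟨h, h2⟩, .inr ⟨h, h2⟩]
    · rintro (⟨h1, h2⟩ | ⟨h1, h2⟩)
      exacts [⟨by omega, h2⟩, ⟨by omega, h2⟩]
  rw [this, card_union_of_disjoint]
  · congr 1
    split_ifs with h
    · rw [card_eq_one]
      refine ⟨⟨j, hj⟩, ?_⟩
      ext u; simp only [mem_filter, mem_univ, true_and, mem_singleton]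
      exact ⟨fun h => h.1, by rintro rfl; exact ⟨rfl, h⟩⟩
    · rw [card_eq_zero, filter_eq_empty_iff]
      rintro u - ⟨rfl, h'⟩; exact h h'
  · rw [disjoint_left]
    intro u h1 h2
    simp only [mem_filter, mem_univ, true_and] at h1 h2
    obtain ⟨rfl, _⟩ := h2
    exact absurd h1.1 (lt_irrefl _)

/-- Register `66` receives the number of neighbours, in the set number `reg 23`, of the vertex whose
row of the adjacency matrix starts at `reg 64`. -/
def degCmd : Cmd :=
  const 66 0 ;; cp 65 23 ;; forTo 54 55 0
    (add 62 64 54 ;; load 62 0 62 ;;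
      ite 62 (load 62 2 65 ;; ite 62 (add 66 66 2) skip) skip ;; add 65 65 3)

theorem degCmd_spec {n : ℕ} {G : SimpleGraph (Fin n)} {N : ℕ} {s : RAMState} (h : Ctx G N s)
    (v : Fin n) (hv : s.reg 64 = v * n) :
    (degCmd.run s).reg 66 = degIn G (col n N s (s.reg 23)) v := by
  classical
  set s1 := (cp 65 23).run ((const 66 0).run s) with hs1
  set q : Cmd := add 62 64 54 ;; load 62 0 62 ;;
      ite 62 (load 62 2 65 ;; ite 62 (add 66 66 2) skip) skip ;; add 65 65 3 with hq
  have h1 : ∀ r, r ≠ 65 → r ≠ 66 → s1.reg r = s.reg r := by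
    intro r h1 h2; simp [hs1, run, cp, h1, h2]
  have h1a : s1.arr = s.arr := by simp [hs1, run, cp]
  have key := forTo_induct (i := 54) (c := 55) (b := 0) (q := q) (s := s1)
    (fun j s' => s'.reg 65 = s.reg 23 + j * N ∧ s'.reg 66 =
      (univ.filter fun u : Fin n => (u : ℕ) < j ∧ (G.Adj v u ∧ u ∈ col n N s (s.reg 23))).card)
    (by decide) (by decide) (by simp [hs1, run, cp]) (by
      intro j hj s' hi hr ha ⟨hI1, hI2⟩
      rw [h1 0 (by decide) (by decide), h.reg0] at hj
      have e64 : s'.reg 64 = v * n := by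
        rw [hr 64 (by decide), h1 64 (by decide) (by decide), hv]
      have e2 : s'.reg 2 = 1 := by rw [hr 2 (by decide), h1 2 (by decide) (by decide), h.reg2]
      have e3 : s'.reg 3 = N := by rw [hr 3 (by decide), h1 3 (by decide) (by decide), h.reg3]
      have ea : s'.arr 0 (v * n + j) = if G.Adj v ⟨j, hj⟩ then 1 else 0 := by
        rw [ha 0 (by decide), h1a, h.arr0]
        exact dksInput_adj G 0 v ⟨j, hj⟩
      have ec : s'.arr 2 (s.reg 23 + j * N) ≠ 0 ↔ ⟨j, hj⟩ ∈ col n N s (s.reg 23) := by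
        rw [ha 2 (by decide), h1a, mem_col]
      rw [card_filter_lt_succ hj, ← hI2]
      by_cases hA : G.Adj v ⟨j, hj⟩ <;> by_cases hC : s'.arr 2 (s.reg 23 + j * N) = 0 <;>
        simp [hq, ← ec, run, skip, hi, hI1, e64, e2, e3, ea, hA, hC, Nat.succ_mul, Nat.add_assoc])
  have e0 : s1.reg 0 = n := by rw [h1 0 (by decide) (by decide), h.reg0]
  rw [e0] at key
  refine key.2.trans ?_
  rw [degIn]
  congr 1
  ext u
  simp [and_comm]

/-- The part of `flagCmd` that deals with the set number `reg 22`. -/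
def flagDegCmd : Cmd :=
  const 63 0 ;; load 62 2 69 ;;
  ite 62 (sub 62 25 66 ;; ite 62 skip (sub 62 26 52 ;; ite 62 (const 63 1) skip)) skip

/-- The part of `flagCmd` that deals with the single vertex `reg 27`. -/
def flagVertexCmd : Cmd :=
  sub 62 52 27 ;; sub 61 27 52 ;; add 62 62 61 ;; ite 62 skip (const 63 1)

/-- Register `63` receives `1` if the current vertex belongs to the result of the set operation, and
`0` otherwise. -/
def flagCmd : Cmd :=
  flagDegCmd ;; flagVertexCmd ;;
  load 62 2 70 ;; ite 62 (const 63 1) skip ;;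
  load 62 2 68 ;; ite 62 (const 63 0) skip

open Classical in
theorem flagDegCmd_spec (s : RAMState) :
    (flagDegCmd.run s).reg 63 =
      if s.arr 2 (s.reg 69) ≠ 0 ∧ s.reg 25 ≤ s.reg 66 ∧ s.reg 52 < s.reg 26 then 1 else 0 := by
  by_cases hP : s.arr 2 (s.reg 69) = 0 <;> by_cases h1 : s.reg 25 ≤ s.reg 66 <;>
  by_cases h2 : s.reg 26 ≤ s.reg 52 <;>
  simp [flagDegCmd, run, skip, hP, h1, h2, Nat.sub_eq_zero_iff_le, ← not_le]

theorem flagVertexCmd_spec (s : RAMState) :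
    (flagVertexCmd.run s).reg 63 = if s.reg 52 = s.reg 27 then 1 else s.reg 63 := by
  have e : s.reg 52 = s.reg 27 ↔ s.reg 52 ≤ s.reg 27 ∧ s.reg 27 ≤ s.reg 52 := le_antisymm_iff
  simp only [e]
  by_cases h1 : s.reg 52 ≤ s.reg 27 <;> by_cases h2 : s.reg 27 ≤ s.reg 52 <;>
  simp [flagVertexCmd, run, skip, h1, h2, Nat.sub_eq_zero_iff_le]

open Classical in
theorem flagCmd_spec (s : RAMState) :
    (flagCmd.run s).reg 63 = if s.arr 2 (s.reg 68) = 0 ∧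
      ((s.arr 2 (s.reg 69) ≠ 0 ∧ s.reg 25 ≤ s.reg 66 ∧ s.reg 52 < s.reg 26) ∨
        s.reg 52 = s.reg 27 ∨ s.arr 2 (s.reg 70) ≠ 0) then 1 else 0 := by
  have h1 := flagDegCmd_spec s
  have h2 := flagVertexCmd_spec (flagDegCmd.run s)
  rw [h1, run_reg_of_notMem flagDegCmd s (r := 52) (by decide),
    run_reg_of_notMem flagDegCmd s (r := 27) (by decide)] at h2
  set s1 := flagVertexCmd.run (flagDegCmd.run s) with hs1
  have f : ∀ r, r ∉ flagDegCmd.wr → r ∉ flagVertexCmd.wr → s1.reg r = s.reg r :=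
    fun r h h' => (run_reg_of_notMem _ _ h').trans (run_reg_of_notMem _ _ h)
  have fa : s1.arr = s.arr := by
    funext a; exact (run_arr_of_notMem _ _ (by simp [flagVertexCmd, wa, skip])).trans
      (run_arr_of_notMem _ _ (by simp [flagDegCmd, wa, skip]))
  have e68 := f 68 (by decide) (by decide)
  have e70 := f 70 (by decide) (by decide)
  simp only [flagCmd, run, ← hs1]
  by_cases hB : s.arr 2 (s.reg 68) = 0 <;> by_cases hR : s.arr 2 (s.reg 70) = 0 <;>
  simp [run, skip, hB, hR, e68, e70, fa, h2]
  · by_cases hx : s.reg 52 = s.reg 27 <;> simp [hx]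

/-- The set number `reg 20` becomes `opSet` of the sets numbers `reg 21`, `reg 22`, `reg 23`, `reg 24`
with the parameters `reg 25`, `reg 26`, `reg 27`. -/
def opCmd : Cmd :=
  const 64 0 ;; cp 67 20 ;; cp 68 21 ;; cp 69 22 ;; cp 70 24 ;;
  forTo 52 53 0 (degCmd ;; flagCmd ;; store 2 67 63 ;;
    add 64 64 0 ;; add 67 67 3 ;; add 68 68 3 ;; add 69 69 3 ;; add 70 70 3)

theorem col_index_inj {N c d i j : ℕ} (hc : c < N) (hd : d < N) (h : c + i * N = d + j * N) :
    c = d ∧ i = j := by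
  have h0 : 0 < N := by omega
  have h1 := congrArg (· % N) h
  have h2 := congrArg (· / N) h
  simp only [Nat.add_mul_mod_self_right, Nat.mod_eq_of_lt hc, Nat.mod_eq_of_lt hd] at h1
  simp only [Nat.add_mul_div_right _ _ h0, Nat.div_eq_of_lt hc, Nat.div_eq_of_lt hd] at h2
  omega

set_option maxHeartbeats 1000000 in
theorem opCmd_spec {n : ℕ} {G : SimpleGraph (Fin n)} {N : ℕ} {s : RAMState} (h : Ctx G N s)
    (hD : s.reg 20 < N) (hB : s.reg 21 < N) (hP : s.reg 22 < N) (hQ : s.reg 23 < N)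
    (hR : s.reg 24 < N) :
    (∀ c < N, c ≠ s.reg 20 → col n N (opCmd.run s) c = col n N s c) ∧
    (s.reg 23 ≠ s.reg 20 → col n N (opCmd.run s) (s.reg 20) =
      opSet G (col n N s (s.reg 21)) (col n N s (s.reg 22)) (col n N s (s.reg 23))
        (col n N s (s.reg 24)) (s.reg 25) (s.reg 26) (s.reg 27)) := by
  classical
  set D := s.reg 20
  set A := opSet G (col n N s (s.reg 21)) (col n N s (s.reg 22)) (col n N s (s.reg 23))
        (col n N s (s.reg 24)) (s.reg 25) (s.reg 26) (s.reg 27) with hA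
  set s1 := (cp 70 24).run ((cp 69 22).run ((cp 68 21).run ((cp 67 20).run
    ((const 64 0).run s)))) with hs1
  set q : Cmd := degCmd ;; flagCmd ;; store 2 67 63 ;;
    add 64 64 0 ;; add 67 67 3 ;; add 68 68 3 ;; add 69 69 3 ;; add 70 70 3 with hq
  have h1 : ∀ r, r ∉ [64, 67, 68, 69, 70] → s1.reg r = s.reg r := by
    intro r h1; simp at h1; simp [hs1, run, cp, h1]
  have h1a : s1.arr = s.arr := by simp [hs1, run, cp]
  have key := forTo_induct (i := 52) (c := 53) (b := 0) (q := q) (s := s1)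
    (fun j s' => s'.reg 64 = j * n ∧ s'.reg 67 = D + j * N ∧ s'.reg 68 = s.reg 21 + j * N ∧
      s'.reg 69 = s.reg 22 + j * N ∧ s'.reg 70 = s.reg 24 + j * N ∧
      (∀ c < N, c ≠ D → ∀ i, s'.arr 2 (c + i * N) = s.arr 2 (c + i * N)) ∧
      (∀ i, j ≤ i → s'.arr 2 (D + i * N) = s.arr 2 (D + i * N)) ∧
      (s.reg 23 ≠ D → ∀ i : Fin n, (i : ℕ) < j →
        s'.arr 2 (D + i * N) = if i ∈ A then 1 else 0))
    (by decide) (by decide) (by simp [hs1, run, cp, D]) (by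
      intro j hj s' hi hr ha ⟨i1, i2, i3, i4, i5, i6, i7, i8⟩
      rw [h1 0 (by decide), h.reg0] at hj
      have hc : Ctx G N s' := h.of_eq (by rw [hr 0 (by decide), h1 0 (by decide)])
        (by rw [hr 2 (by decide), h1 2 (by decide)]) (by rw [hr 3 (by decide), h1 3 (by decide)])
        (by rw [ha 0 (by decide), h1a])
      have hdeg := degCmd_spec hc ⟨j, hj⟩ i1
      set s2 := degCmd.run s' with hs2
      have f2 : ∀ r, r ∉ degCmd.wr → s2.reg r = s'.reg r := fun r h => run_reg_of_notMem _ _ h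
      have f2a : s2.arr 2 = s'.arr 2 := run_arr_of_notMem _ _ (by decide)
      have hfl := flagCmd_spec s2
      set s3 := flagCmd.run s2 with hs3
      have f3 : ∀ r, r ∉ degCmd.wr → r ∉ flagCmd.wr → s3.reg r = s'.reg r :=
        fun r h h' => (run_reg_of_notMem _ _ h').trans (f2 r h)
      have f3a : s3.arr 2 = s'.arr 2 := (run_arr_of_notMem _ _ (by decide)).trans f2a
      have p25 : s'.reg 25 = s.reg 25 := by rw [hr 25 (by decide), h1 25 (by decide)]
      have p26 : s'.reg 26 = s.reg 26 := by rw [hr 26 (by decide), h1 26 (by decide)]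
      have p27 : s'.reg 27 = s.reg 27 := by rw [hr 27 (by decide), h1 27 (by decide)]
      have p23 : s'.reg 23 = s.reg 23 := by rw [hr 23 (by decide), h1 23 (by decide)]
      -- the columns of the operands are intact at the current vertex
      have hcur : ∀ c < N, s'.arr 2 (c + j * N) = s.arr 2 (c + j * N) := by
        intro c hc'
        by_cases hcD : c = D
        · rw [hcD]; exact i7 j le_rfl
        · exact i6 c hc' hcD j
      have hflag : s.reg 23 ≠ D → s3.reg 63 = if (⟨j, hj⟩ : Fin n) ∈ A then 1 else 0 := by
        intro hQD
        have hcolQ : col n N s' (s.reg 23) = col n N s (s.reg 23) := by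
          ext v; rw [mem_col, mem_col, i6 _ hQ hQD]
        rw [hfl, f2a, hdeg, f2 68 (by decide), f2 69 (by decide), f2 70 (by decide),
          f2 25 (by decide), f2 26 (by decide), f2 27 (by decide), f2 52 (by decide), i3, i4, i5,
          hi, p25, p26, p27, p23, hcolQ, hcur _ hB, hcur _ hP, hcur _ hR]
        congr 1
        simp only [hA, mem_opSet, mem_col, not_not]
      simp only [hq, run, ← hs2, ← hs3, bump_reg, bump_arr, RAMState.setReg_reg,
        RAMState.setReg_arr, RAMState.setArr_reg]
      have g : ∀ r, r ∉ degCmd.wr → r ∉ flagCmd.wr → s3.reg r = s'.reg r := f3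
      have e67 := (g 67 (by decide) (by decide)).trans i2
      simp [-ne_eq, RAMState.setArr_arr, g 64 (by decide) (by decide), g 68 (by decide) (by decide),
        g 69 (by decide) (by decide), g 70 (by decide) (by decide), g 3 (by decide) (by decide),
        g 0 (by decide) (by decide), e67, hc.reg0, hc.reg3, i1, i3, i4, i5, f3a]
      refine ⟨by ring, by ring, by ring, by ring, by ring, ?_, ?_, ?_⟩
      · intro c hcN hcD i
        rw [if_neg, i6 c hcN hcD]
        intro he
        exact hcD (col_index_inj hcN hD he).1
      · intro i hji
        have hN : N ≠ 0 := by omega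
        rw [if_neg (by omega), i7 i (by omega)]
      · intro hQD i hij
        have hN : N ≠ 0 := by omega
        rcases Nat.lt_or_eq_of_le hij with hlt | heq
        · rw [if_neg (by omega), i8 hQD i hlt]
        · have : i = ⟨j, hj⟩ := Fin.ext heq
          subst this
          simpa using hflag hQD)
  have e0 : s1.reg 0 = n := by rw [h1 0 (by decide), h.reg0]
  rw [e0] at key
  obtain ⟨-, -, -, -, -, k1, -, k3⟩ := key
  refine ⟨fun c hc hcD => ?_, fun hQD => ?_⟩
  · ext v; rw [mem_col, mem_col, ← k1 c hc hcD v]; rfl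
  · ext v
    rw [mem_col]
    have := k3 hQD v v.2
    change (opCmd.run s).arr 2 (D + v * N) = _ at this
    rw [this]; simp
/-! ### Counting, decoding and straight-line set programs on the machine -/

theorem sum_filter_lt_succ {n j : ℕ} (hj : j < n) (p : Fin n → Prop) [DecidablePred p]
    (f : Fin n → ℕ) :
    ∑ u with (u : Fin n).1 < j + 1 ∧ p u, f u =
      ∑ u with (u : Fin n).1 < j ∧ p u, f u + if p ⟨j, hj⟩ then f ⟨j, hj⟩ else 0 := by
  have h := fun u : Fin n => (show (u.1 < j + 1 ∧ p u) ↔ (u.1 < j ∧ p u) ∨ (u = ⟨j, hj⟩ ∧ p u) by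
    rw [Fin.ext_iff, ← or_and_right, ← Nat.lt_succ_iff_lt_or_eq])
  simp only [h]
  rw [filter_or, sum_union]
  · congr 1
    by_cases hp : p ⟨j, hj⟩
    · rw [if_pos hp, ← sum_singleton f ⟨j, hj⟩]
      congr 1
      ext u; simp only [mem_filter, mem_univ, true_and, mem_singleton]
      exact ⟨fun h => h.1, by rintro rfl; exact ⟨rfl, hp⟩⟩
    · rw [if_neg hp, sum_eq_zero]
      simp only [mem_filter, mem_univ, true_and]
      rintro u ⟨rfl, h'⟩; exact absurd h' hp
  · rw [disjoint_left]
    simp only [mem_filter, mem_univ, true_and]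
    rintro u h1 ⟨rfl, _⟩
    exact absurd h1.1 (lt_irrefl _)

/-- Registers `72`, `73`, `74` receive the cardinality of the set `S` number `reg 23`, the number
`adjPairs S`, and the product of the cardinality with `reg 31`. -/
def countCmd : Cmd :=
  const 72 0 ;; const 73 0 ;; const 74 0 ;; const 64 0 ;; cp 67 23 ;;
  forTo 52 53 0 (load 62 2 67 ;;
    ite 62 (degCmd ;; add 72 72 2 ;; add 73 73 66 ;; add 74 74 31) skip ;;
    add 64 64 0 ;; add 67 67 3)

theorem countCmd_spec {n : ℕ} {G : SimpleGraph (Fin n)} {N : ℕ} {s : RAMState} (h : Ctx G N s) :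
    (countCmd.run s).reg 72 = (col n N s (s.reg 23)).card ∧
    (countCmd.run s).reg 73 = adjPairs G (col n N s (s.reg 23)) ∧
    (countCmd.run s).reg 74 = s.reg 31 * (col n N s (s.reg 23)).card := by
  classical
  set S := col n N s (s.reg 23) with hS
  set s1 := (cp 67 23).run ((const 64 0).run ((const 74 0).run ((const 73 0).run
    ((const 72 0).run s)))) with hs1
  set q : Cmd := load 62 2 67 ;;
    ite 62 (degCmd ;; add 72 72 2 ;; add 73 73 66 ;; add 74 74 31) skip ;;
    add 64 64 0 ;; add 67 67 3 with hq
  have h1 : ∀ r, r ∉ [72, 73, 74, 64, 67] → s1.reg r = s.reg r := by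
    intro r h1; simp at h1; simp [hs1, run, cp, h1]
  have h1a : s1.arr = s.arr := by simp [hs1, run, cp]
  have key := forTo_induct (i := 52) (c := 53) (b := 0) (q := q) (s := s1)
    (fun j s' => s'.reg 64 = j * n ∧ s'.reg 67 = s.reg 23 + j * N ∧
      s'.reg 72 = ∑ u with (u : Fin n).1 < j ∧ u ∈ S, 1 ∧
      s'.reg 73 = ∑ u with (u : Fin n).1 < j ∧ u ∈ S, degIn G S u ∧
      s'.reg 74 = ∑ u with (u : Fin n).1 < j ∧ u ∈ S, s.reg 31)
    (by decide) (by decide) (by simp [hs1, run, cp]) (by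
      intro j hj s' hi hr ha ⟨i1, i2, i3, i4, i5⟩
      rw [h1 0 (by decide), h.reg0] at hj
      have hc : Ctx G N s' := h.of_eq (by rw [hr 0 (by decide), h1 0 (by decide)])
        (by rw [hr 2 (by decide), h1 2 (by decide)]) (by rw [hr 3 (by decide), h1 3 (by decide)])
        (by rw [ha 0 (by decide), h1a])
      have e31 : s'.reg 31 = s.reg 31 := by rw [hr 31 (by decide), h1 31 (by decide)]
      have e23 : s'.reg 23 = s.reg 23 := by rw [hr 23 (by decide), h1 23 (by decide)]
      have ea : s'.arr 2 = s.arr 2 := by rw [ha 2 (by decide), h1a]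
      have hm : (⟨j, hj⟩ : Fin n) ∈ S ↔ s'.arr 2 (s.reg 23 + j * N) ≠ 0 := by
        rw [hS, mem_col, ea]
      rw [sum_filter_lt_succ hj, sum_filter_lt_succ hj, sum_filter_lt_succ hj, ← i3, ← i4, ← i5]
      set s2 := (load 62 2 67).run s' with hs2
      have g2 : ∀ r, r ≠ 62 → s2.reg r = s'.reg r := by
        intro r hr; simp [hs2, run, hr]
      have g2a : s2.arr = s'.arr := by simp [hs2, run]
      have e62 : s2.reg 62 = s'.arr 2 (s.reg 23 + j * N) := by simp [hs2, run, i2]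
      have hc2 : Ctx G N s2 := hc.run (by decide)
      have hdeg := degCmd_spec hc2 ⟨j, hj⟩ (by rw [g2 _ (by decide)]; exact i1)
      have hcol : col n N s2 (s2.reg 23) = S := by
        ext v; rw [hS, mem_col, mem_col, g2a, ea, g2 _ (by decide), e23]
      rw [hcol] at hdeg
      have f : ∀ r, r ∉ degCmd.wr → r ≠ 62 → (degCmd.run s2).reg r = s'.reg r := fun r h h' =>
        (run_reg_of_notMem _ _ h).trans (g2 r h')
      have hrun : q.run s' = (add 67 67 3).run ((add 64 64 0).run
        ((ite 62 (degCmd ;; add 72 72 2 ;; add 73 73 66 ;; add 74 74 31) skip).run s2)) := rfl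
      rw [hrun]
      clear_value s2
      by_cases hC : s'.arr 2 (s.reg 23 + j * N) = 0
      · have hm' : (⟨j, hj⟩ : Fin n) ∉ S := by rw [hm]; simpa using hC
        simp [run, e62, hC, hm', skip, g2, i1, i2, hc.reg0, hc.reg3]
        constructor <;> ring
      · have hm' : (⟨j, hj⟩ : Fin n) ∈ S := by rw [hm]; simpa using hC
        simp [run, e62, hC, hm', f 0 (by decide), f 2 (by decide), f 3 (by decide),
          f 31 (by decide), f 64 (by decide), f 67 (by decide), f 72 (by decide),
          f 73 (by decide), f 74 (by decide), i1, i2, hc.reg0, hc.reg3, hc.reg2, hdeg, e31]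
        constructor <;> ring)
  rw [h1 0 (by decide), h.reg0] at key
  obtain ⟨-, -, k1, k2, k3⟩ := key
  have hf : (univ.filter fun u : Fin n => (u : ℕ) < n ∧ u ∈ S) = S := by ext u; simp
  rw [hf] at k1 k2 k3
  exact ⟨k1.trans (by simp), k2, k3.trans (by simp [mul_comm])⟩

/-- Division with remainder of `reg 60` by `N = reg 3`: the remainder replaces `reg 60`, and the
quotient is put into register `75`. Register `4` holds `N - 1`. -/
def divCmd : Cmd :=
  const 75 0 ;; forTo 48 49 7 (sub 62 60 4 ;; ite 62 (sub 60 60 3 ;; add 75 75 2) skip)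

theorem divCmd_spec {N t : ℕ} {s : RAMState} (hN : 0 < N) (h2 : s.reg 2 = 1) (h3 : s.reg 3 = N)
    (h4 : s.reg 4 = N - 1) (ht : s.reg 60 = t) (htM : t ≤ s.reg 7) :
    (divCmd.run s).reg 60 = t % N ∧ (divCmd.run s).reg 75 = t / N := by
  have key := forTo_induct (i := 48) (c := 49) (b := 7) (s := (const 75 0).run s)
    (q := sub 62 60 4 ;; ite 62 (sub 60 60 3 ;; add 75 75 2) skip)
    (fun j s' => s'.reg 75 = min j (t / N) ∧ s'.reg 60 = t - N * min j (t / N))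
    (by decide) (by decide) (by simp [run, ht]) (by
      intro j hj s' hi hr ha ⟨i1, i2⟩
      have e2 : s'.reg 2 = 1 := by rw [hr 2 (by decide)]; simp [run, h2]
      have e3 : s'.reg 3 = N := by rw [hr 3 (by decide)]; simp [run, h3]
      have e4 : s'.reg 4 = N - 1 := by rw [hr 4 (by decide)]; simp [run, h4]
      by_cases hlt : j < t / N
      · have h5 : N * (j + 1) ≤ t := (Nat.mul_le_mul_left N hlt).trans (Nat.mul_div_le t N)
        have h6 : N * (j + 1) = N * j + N := by ring
        rw [min_eq_left hlt.le] at i1 i2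
        rw [min_eq_left (Nat.succ_le_of_lt hlt)]
        have h7 : ¬ (t - N * j - (N - 1) = 0) := by omega
        simp [run, i1, i2, e2, e3, e4, h7]
        omega
      · rw [not_lt] at hlt
        rw [min_eq_right hlt] at i1 i2
        rw [min_eq_right (hlt.trans (Nat.le_succ j))]
        have h5 := Nat.div_add_mod t N
        have h6 := Nat.mod_lt t hN
        have h7 : t - N * (t / N) - (N - 1) = 0 := by omega
        simp [run, i1, i2, e4, h7, skip])
  have e7 : ((const 75 0).run s).reg 7 = s.reg 7 := by simp [run]
  have h5 := Nat.div_add_mod t N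
  rw [e7, min_eq_right ((Nat.div_le_self t N).trans htM)] at key
  exact ⟨key.2.trans (by omega), key.1⟩

/-- The digits of `reg 76` in base `N` are written into array `5`. -/
def decodeCmd : Cmd := cp 60 76 ;; forTo 46 47 5 (divCmd ;; store 5 46 60 ;; cp 60 75)

theorem decodeCmd_spec {N x : ℕ} {s : RAMState} (hN : 0 < N) (h2 : s.reg 2 = 1)
    (h3 : s.reg 3 = N) (h4 : s.reg 4 = N - 1) (hx : s.reg 76 = x) (hxM : x ≤ s.reg 7) :
    ∀ i < s.reg 5, (decodeCmd.run s).arr 5 i = x / N ^ i % N := by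
  have key := forTo_induct (i := 46) (c := 47) (b := 5) (s := (cp 60 76).run s)
    (q := divCmd ;; store 5 46 60 ;; cp 60 75)
    (fun j s' => s'.reg 60 = x / N ^ j ∧ ∀ i < j, s'.arr 5 i = x / N ^ i % N)
    (by decide) (by decide) (by simp [run, hx, cp]) (by
      intro j hj s' hi hr ha ⟨i1, i2⟩
      have e2 : s'.reg 2 = 1 := by rw [hr 2 (by decide)]; simp [run, h2, cp]
      have e3 : s'.reg 3 = N := by rw [hr 3 (by decide)]; simp [run, h3, cp]
      have e4 : s'.reg 4 = N - 1 := by rw [hr 4 (by decide)]; simp [run, h4, cp]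
      have e7 : s'.reg 7 = s.reg 7 := by rw [hr 7 (by decide)]; simp [run, cp]
      obtain ⟨d1, d2⟩ := divCmd_spec hN e2 e3 e4 i1 (by rw [e7]; exact (Nat.div_le_self _ _).trans hxM)
      have da : (divCmd.run s').arr 5 = s'.arr 5 := run_arr_of_notMem _ _ (by decide)
      have d46 : (divCmd.run s').reg 46 = j := by rw [run_reg_of_notMem _ _ (by decide), hi]
      refine ⟨?_, fun i hij => ?_⟩
      · simp [run, cp, d2, Nat.div_div_eq_div_mul, pow_succ]
      · simp only [run, cp, bump_arr, RAMState.setReg_arr, RAMState.setArr_arr, d46, d1, da,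
          true_and]
        split_ifs with hij'
        · rw [hij']
        · exact i2 i (by omega))
  have e5 : ((cp 60 76).run s).reg 5 = s.reg 5 := by simp [run, cp]
  rw [e5] at key
  exact key.2

/-- Every string of digits is the expansion of a number. -/
theorem exists_digits (N : ℕ) (dg : ℕ → ℕ) (m : ℕ) (h : ∀ i < m, dg i < N) :
    ∃ x < N ^ m, ∀ i < m, x / N ^ i % N = dg i := by
  induction m with
  | zero => exact ⟨0, by simp, by simp⟩
  | succ m ih =>
    obtain ⟨x, hx, hd⟩ := ih fun i hi => h i (by omega)
    have hN : 0 < N := (Nat.zero_le _).trans_lt (h m (by omega))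
    have hm := h m (by omega)
    refine ⟨x + dg m * N ^ m, ?_, fun i hi => ?_⟩
    · rw [pow_succ]
      have : (dg m + 1) * N ^ m ≤ N * N ^ m := Nat.mul_le_mul_right _ hm
      nlinarith
    · rcases Nat.lt_succ_iff_lt_or_eq.1 hi with hlt | rfl
      · rw [← hd i hlt]
        obtain ⟨e, rfl⟩ := Nat.exists_eq_add_of_lt hlt
        have : dg (i + e + 1) * N ^ (i + e + 1) = N ^ i * (N * (N ^ e * dg (i + e + 1))) := by ring
        rw [this, Nat.add_mul_div_left _ _ (pow_pos hN i), Nat.add_mul_mod_self_left]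
      · rw [Nat.add_mul_div_right _ _ (pow_pos hN i), Nat.div_eq_of_lt hx, Nat.zero_add,
          Nat.mod_eq_of_lt hm]

/-- `Z` is the sequence of sets produced by the first `ℓ` instructions of the straight-line set program
whose digits are `dg`. The sets with the numbers `0`, `1`, `2` are all vertices, the empty set and `F`;
instruction `j` applies `opSet` to earlier sets and produces the set number `3 + j`. -/
def IsRun {n : ℕ} (G : SimpleGraph (Fin n)) (F : Finset (Fin n)) (Z : ℕ → Finset (Fin n))
    (dg : ℕ → ℕ) (ℓ : ℕ) : Prop :=
  Z 0 = univ ∧ Z 1 = ∅ ∧ Z 2 = F ∧ ∀ j < ℓ,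
    dg (6 * j) < 3 + j ∧ dg (6 * j + 1) < 3 + j ∧ dg (6 * j + 2) < 3 + j ∧
    Z (3 + j) = opSet G F (Z (dg (6 * j))) (Z (dg (6 * j + 1))) (Z (dg (6 * j + 2)))
      (dg (6 * j + 3)) (dg (6 * j + 4)) (dg (6 * j + 5))

/-- Run the straight-line set program whose digits are in array `5`. -/
def progCmd : Cmd :=
  const 20 3 ;; const 21 2 ;; const 71 0 ;; forTo 50 51 6
    ((load 22 5 71 ;; add 71 71 2 ;; load 23 5 71 ;; add 71 71 2 ;; load 24 5 71 ;; add 71 71 2 ;;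
      load 25 5 71 ;; add 71 71 2 ;; load 26 5 71 ;; add 71 71 2 ;; load 27 5 71 ;; add 71 71 2) ;;
      opCmd ;; add 20 20 2)

theorem progCmd_spec {n : ℕ} {G : SimpleGraph (Fin n)} {N : ℕ} {s : RAMState} (h : Ctx G N s)
    (hN : s.reg 6 + 3 < N) (hdg : ∀ i < 6 * s.reg 6, s.arr 5 i < N) :
    (∀ c < N, c < 3 ∨ s.reg 6 + 3 ≤ c → col n N (progCmd.run s) c = col n N s c) ∧
    ∀ Z ℓ, ℓ ≤ s.reg 6 → (∀ c < 3, col n N s c = Z c) → IsRun G (Z 2) Z (s.arr 5) ℓ →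
      ∀ c < 3 + ℓ, col n N (progCmd.run s) c = Z c := by
  set s1 := (const 71 0).run ((const 21 2).run ((const 20 3).run s)) with hs1
  set ld : Cmd := load 22 5 71 ;; add 71 71 2 ;; load 23 5 71 ;; add 71 71 2 ;; load 24 5 71 ;;
    add 71 71 2 ;; load 25 5 71 ;; add 71 71 2 ;; load 26 5 71 ;; add 71 71 2 ;; load 27 5 71 ;;
    add 71 71 2 with hld
  have h1 : ∀ r, r ∉ [20, 21, 71] → s1.reg r = s.reg r := by
    intro r h1; simp at h1; simp [hs1, run, h1]
  have h1a : s1.arr = s.arr := by simp [hs1, run]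
  have key := forTo_induct (i := 50) (c := 51) (b := 6) (q := ld ;; opCmd ;; add 20 20 2) (s := s1)
    (fun j s' => s'.reg 20 = 3 + j ∧ s'.reg 21 = 2 ∧ s'.reg 71 = 6 * j ∧
      (∀ c < N, c < 3 ∨ s.reg 6 + 3 ≤ c → col n N s' c = col n N s c) ∧
      ∀ Z ℓ, ℓ ≤ s.reg 6 → (∀ c < 3, col n N s c = Z c) → IsRun G (Z 2) Z (s.arr 5) ℓ →
        ∀ c, c < 3 + j → c < 3 + ℓ → col n N s' c = Z c)
    (by decide) (by decide)
    (by
      refine ⟨by simp [hs1, run], by simp [hs1, run], by simp [hs1, run], fun c _ _ => rfl, ?_⟩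
      intro Z ℓ _ hZ _ c hc _
      exact hZ c hc)
    (by
      intro j hj s' hi hr ha ⟨i1, i2, i3, i4, i5⟩
      rw [h1 6 (by decide)] at hj
      have hc : Ctx G N s' := h.of_eq (by rw [hr 0 (by decide), h1 0 (by decide)])
        (by rw [hr 2 (by decide), h1 2 (by decide)]) (by rw [hr 3 (by decide), h1 3 (by decide)])
        (by rw [ha 0 (by decide), h1a])
      have ea : s'.arr 5 = s.arr 5 := by rw [ha 5 (by decide), h1a]
      set s2 := ld.run s' with hs2
      have hc2 : Ctx G N s2 := hc.run (by decide)
      have e2 := hc.reg2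
      have r20 : s2.reg 20 = 3 + j := by simp [hs2, hld, run, i1]
      have r21 : s2.reg 21 = 2 := by simp [hs2, hld, run, i2]
      have r71 : s2.reg 71 = 6 * j + 6 := by simp [hs2, hld, run, i3, e2]
      have r22 : s2.reg 22 = s.arr 5 (6 * j) := by simp [hs2, hld, run, i3, e2, ea]
      have r23 : s2.reg 23 = s.arr 5 (6 * j + 1) := by simp [hs2, hld, run, i3, e2, ea]
      have r24 : s2.reg 24 = s.arr 5 (6 * j + 2) := by simp [hs2, hld, run, i3, e2, ea]
      have r25 : s2.reg 25 = s.arr 5 (6 * j + 3) := by simp [hs2, hld, run, i3, e2, ea]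
      have r26 : s2.reg 26 = s.arr 5 (6 * j + 4) := by simp [hs2, hld, run, i3, e2, ea]
      have r27 : s2.reg 27 = s.arr 5 (6 * j + 5) := by simp [hs2, hld, run, i3, e2, ea]
      have hcol : ∀ c, col n N s2 c = col n N s' c := by
        intro c; ext v; rw [mem_col, mem_col, hs2, run_arr_of_notMem ld _ (by decide)]
      obtain ⟨o1, o2⟩ := opCmd_spec hc2 (by rw [r20]; omega) (by rw [r21]; omega)
        (by rw [r22]; exact hdg _ (by omega)) (by rw [r23]; exact hdg _ (by omega))
        (by rw [r24]; exact hdg _ (by omega))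
      rw [r20] at o1 o2
      rw [r21, r22, r23, r24, r25, r26, r27] at o2
      simp only [hcol] at o1 o2
      have f : ∀ r, r ∉ opCmd.wr → (opCmd.run s2).reg r = s2.reg r := fun r h =>
        run_reg_of_notMem _ _ h
      have hfin : ∀ c, col n N (bump 50 51 ((ld ;; opCmd ;; add 20 20 2).run s')) c =
          col n N (opCmd.run s2) c := fun c => rfl
      simp only [hfin]
      refine ⟨?_, ?_, ?_, ?_, ?_⟩
      · simp [run, ← hs2, f 20 (by decide), f 2 (by decide), r20, hc2.reg2, Nat.add_assoc]
      · simp [run, ← hs2, f 21 (by decide), r21]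
      · simp [run, ← hs2, f 71 (by decide), r71]; ring
      · intro c hcN hc'
        rw [o1 c hcN (by omega), i4 c hcN hc']
      · intro Z ℓ hℓ hZ hrun c hcj hcl
        by_cases hcD : c = 3 + j
        · subst hcD
          obtain ⟨p1, p2, p3, p4⟩ := hrun.2.2.2 j (by omega)
          rw [o2 (by omega), p4, i5 Z ℓ hℓ hZ hrun _ p1 (by omega),
            i5 Z ℓ hℓ hZ hrun _ p2 (by omega), i5 Z ℓ hℓ hZ hrun _ p3 (by omega),
            i4 2 (by omega) (by omega), hZ 2 (by omega)]
        · rw [o1 c (by omega) hcD, i5 Z ℓ hℓ hZ hrun c (by omega) hcl])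
  rw [h1 6 (by decide)] at key
  obtain ⟨-, -, -, k1, k2⟩ := key
  refine ⟨fun c hc hc' => k1 c hc hc', fun Z ℓ hℓ hZ hrun c hc => k2 Z ℓ hℓ hZ hrun c (by omega) hc⟩
/-! ### The search algorithm on the machine -/

/-- The registers that are fixed during the search: besides the size `n` of the graph and the size `k` of
the sets looked for, these are the base `N` of the digits, the length `m` of the set programs, the number
`M` of digit strings, and the numbers of the two auxiliary columns `m + 3` and `m + 4`. -/
structure MainCtx {n : ℕ} (G : SimpleGraph (Fin n)) (k N m M : ℕ) (s : RAMState) : Prop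
    extends Ctx G N s where
  reg1 : s.reg 1 = k
  reg4 : s.reg 4 = N - 1
  reg5 : s.reg 5 = 6 * m + 1
  reg6 : s.reg 6 = m
  reg7 : s.reg 7 = M
  reg8 : s.reg 8 = k + 1
  reg77 : s.reg 77 = 6 * m
  reg78 : s.reg 78 = m + 3
  reg79 : s.reg 79 = m + 4
  large : m + 4 < N

theorem MainCtx.of_eq {n : ℕ} {G : SimpleGraph (Fin n)} {k N m M : ℕ} {s s' : RAMState}
    (h : MainCtx G k N m M s)
    (hr : ∀ r ∈ [0, 1, 2, 3, 4, 5, 6, 7, 8, 77, 78, 79], s'.reg r = s.reg r)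
    (ha : s'.arr 0 = s.arr 0) : MainCtx G k N m M s' :=
  ⟨h.toCtx.of_eq (hr 0 (by decide)) (hr 2 (by decide)) (hr 3 (by decide)) ha,
    (hr 1 (by decide)).trans h.reg1, (hr 4 (by decide)).trans h.reg4,
    (hr 5 (by decide)).trans h.reg5, (hr 6 (by decide)).trans h.reg6,
    (hr 7 (by decide)).trans h.reg7, (hr 8 (by decide)).trans h.reg8,
    (hr 77 (by decide)).trans h.reg77, (hr 78 (by decide)).trans h.reg78,
    (hr 79 (by decide)).trans h.reg79, h.large⟩

theorem MainCtx.run {n : ℕ} {G : SimpleGraph (Fin n)} {k N m M : ℕ} {s : RAMState}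
    (h : MainCtx G k N m M s) {p : Cmd}
    (hr : (∀ r ∈ [0, 1, 2, 3, 4, 5, 6, 7, 8, 77, 78, 79], r ∉ p.wr) ∧ 0 ∉ p.wa) :
    MainCtx G k N m M (p.run s) :=
  h.of_eq (fun r hr' => run_reg_of_notMem _ _ (hr.1 r hr')) (run_arr_of_notMem _ _ hr.2)

theorem col_congr {n N : ℕ} {s s' : RAMState} (h : s'.arr 2 = s.arr 2) (c : ℕ) :
    col n N s' c = col n N s c := by
  ext v; rw [mem_col, mem_col, h]

/-- The set number `reg 20` becomes the union of the sets numbers `reg 22` and `reg 24`. -/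
def unionCmd : Cmd :=
  (const 21 1 ;; const 23 1 ;; const 25 0 ;; cp 26 0 ;; cp 27 0) ;; opCmd

theorem unionCmd_spec {n : ℕ} {G : SimpleGraph (Fin n)} {N : ℕ} {s : RAMState} (h : Ctx G N s)
    (hN : 1 < N) (h1 : col n N s 1 = ∅) (hD : s.reg 20 < N) (hD1 : s.reg 20 ≠ 1) (hP : s.reg 22 < N)
    (hR : s.reg 24 < N) :
    col n N (unionCmd.run s) (s.reg 20) = col n N s (s.reg 22) ∪ col n N s (s.reg 24) ∧
    ∀ c < N, c ≠ s.reg 20 → col n N (unionCmd.run s) c = col n N s c := by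
  set s1 := (const 21 1 ;; const 23 1 ;; const 25 0 ;; cp 26 0 ;; cp 27 0).run s with hs1
  have hc : Ctx G N s1 := h.run (by decide)
  have hcol : ∀ c, col n N s1 c = col n N s c := col_congr (by simp [hs1, run, cp])
  have g : ∀ r, r ∉ [21, 23, 25, 26, 27] → s1.reg r = s.reg r := by
    intro r hr; simp at hr; simp [hs1, run, cp, hr]
  have r21 : s1.reg 21 = 1 := by simp [hs1, run, cp]
  have r23 : s1.reg 23 = 1 := by simp [hs1, run, cp]
  have r25 : s1.reg 25 = 0 := by simp [hs1, run, cp]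
  have r26 : s1.reg 26 = n := by simp [hs1, run, cp, h.reg0]
  have r27 : s1.reg 27 = n := by simp [hs1, run, cp, h.reg0]
  have r20 := g 20 (by decide)
  have r22 := g 22 (by decide)
  have r24 := g 24 (by decide)
  obtain ⟨o1, o2⟩ := opCmd_spec hc (by omega) (by omega) (by omega) (by omega) (by omega)
  simp only [hcol, r20, r21, r22, r23, r24, r25, r26, r27] at o1 o2
  refine ⟨?_, o1⟩
  refine (o2 hD1.symm).trans ?_
  ext v
  simp [mem_opSet, h1, v.2.ne]

theorem IsRun.congr {n : ℕ} {G : SimpleGraph (Fin n)} {F : Finset (Fin n)} {Z : ℕ → Finset (Fin n)}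
    {dg dg' : ℕ → ℕ} {ℓ : ℕ} (h : IsRun G F Z dg ℓ) (hd : ∀ i < 6 * ℓ, dg' i = dg i) :
    IsRun G F Z dg' ℓ := by
  refine ⟨h.1, h.2.1, h.2.2.1, fun j hj => ?_⟩
  rw [hd _ (by omega), hd _ (by omega), hd _ (by omega), hd _ (by omega), hd _ (by omega),
    hd _ (by omega)]
  exact h.2.2.2 j hj

/-- The conditions under which the set `Y` replaces the set `F`: it has at most `k` vertices and, up
to the allowance `a`, average degree at least `g`. -/
def Acceptable {n : ℕ} (G : SimpleGraph (Fin n)) (k g a : ℕ) (Y : Finset (Fin n)) : Prop :=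
  Y.card ≤ k ∧ g * Y.card ≤ adjPairs G Y + a

/-- Run the set program number `reg 44` and form the union of its result with the current set `F`, the
set number `2`; it replaces `F` if it is acceptable. -/
def tryCmd : Cmd :=
  ((cp 76 44 ;; decodeCmd) ;; progCmd) ;;
  ((cp 20 78 ;; load 22 5 77 ;; const 24 2) ;; unionCmd) ;;
  (cp 23 78 ;; countCmd) ;;
  sub 62 72 1 ;; ite 62 skip (add 62 73 37 ;; sub 62 74 62 ;; ite 62 skip
    ((const 20 2 ;; cp 22 78 ;; cp 24 78) ;; unionCmd))

theorem tryCmd_spec {n : ℕ} {G : SimpleGraph (Fin n)} {k N m M x : ℕ} {s : RAMState}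
    (h : MainCtx G k N m M s) (h0 : col n N s 0 = univ) (h1 : col n N s 1 = ∅)
    (hx : s.reg 44 = x) (hxM : x ≤ M) :
    (col n N (tryCmd.run s) 0 = univ ∧ col n N (tryCmd.run s) 1 = ∅ ∧
      col n N (tryCmd.run s) (m + 4) = col n N s (m + 4)) ∧
    col n N s 2 ⊆ col n N (tryCmd.run s) 2 ∧
    (col n N (tryCmd.run s) 2 = col n N s 2 ∨
      Acceptable G k (s.reg 31) (s.reg 37) (col n N (tryCmd.run s) 2)) ∧
    ∀ Z ℓ dg, (∀ i < 6 * m + 1, x / N ^ i % N = dg i) → ℓ ≤ m → IsRun G (col n N s 2) Z dg ℓ →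
      dg (6 * m) < 3 + ℓ → Acceptable G k (s.reg 31) (s.reg 37) (col n N s 2 ∪ Z (dg (6 * m))) →
      Z (dg (6 * m)) ⊆ col n N (tryCmd.run s) 2 := by
  have hlarge := h.large
  have hN : 0 < N := by omega
  set F := col n N s 2 with hF
  set s1 := (cp 76 44 ;; decodeCmd).run s with hs1
  have c1 : MainCtx G k N m M s1 := h.run (by decide)
  have d1 : ∀ i < 6 * m + 1, s1.arr 5 i = x / N ^ i % N := by
    have := decodeCmd_spec (x := x) (s := (cp 76 44).run s) hN (by simp [run, cp, h.reg2])
      (by simp [run, cp, h.reg3]) (by simp [run, cp, h.reg4]) (by simp [run, cp, hx])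
      (by simp [run, cp, h.reg7, hxM])
    have e5 : ((cp 76 44).run s).reg 5 = 6 * m + 1 := by simp [run, cp, h.reg5]
    rw [e5] at this
    exact this
  have hcol1 : ∀ c, col n N s1 c = col n N s c := col_congr (run_arr_of_notMem _ _ (by decide))
  set s2 := progCmd.run s1 with hs2
  have c2 : MainCtx G k N m M s2 := c1.run (by decide)
  obtain ⟨p1, p2⟩ := progCmd_spec c1.toCtx (by rw [c1.reg6]; omega)
    (fun i hi => by rw [c1.reg6] at hi; rw [d1 i (by omega)]; exact Nat.mod_lt _ hN)
  rw [c1.reg6] at p1 p2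
  simp only [hcol1] at p1 p2
  rw [← hs2] at p1 p2
  have d2 : s2.arr 5 (6 * m) = x / N ^ (6 * m) % N := by
    rw [hs2, run_arr_of_notMem _ _ (by decide), d1 _ (by omega)]
  set r0 := s2.arr 5 (6 * m) with hr0
  have hr0N : r0 < N := by rw [d2]; exact Nat.mod_lt _ hN
  set s3 := (cp 20 78 ;; load 22 5 77 ;; const 24 2).run s2 with hs3
  have c3 : MainCtx G k N m M s3 := c2.run (by decide)
  have hcol3 : ∀ c, col n N s3 c = col n N s2 c := col_congr (run_arr_of_notMem _ _ (by decide))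
  have e20 : s3.reg 20 = m + 3 := by simp [hs3, run, cp, c2.reg78]
  have e22 : s3.reg 22 = r0 := by simp [hs3, run, cp, c2.reg77, hr0]
  have e24 : s3.reg 24 = 2 := by simp [hs3, run, cp]
  obtain ⟨u1, u2⟩ := unionCmd_spec c3.toCtx (by omega) (by rw [hcol3, p1 1 (by omega) (by omega), h1])
    (by omega) (by omega) (by omega) (by omega)
  simp only [e20, e22, e24, hcol3] at u1 u2
  set s4 := unionCmd.run s3 with hs4
  have c4 : MainCtx G k N m M s4 := c3.run (by decide)
  have hFs2 : col n N s2 2 = F := p1 2 (by omega) (by omega)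
  rw [hFs2] at u1
  set Y := col n N s2 r0 ∪ F with hY
  set s5 := (cp 23 78 ;; countCmd).run s4 with hs5
  have c5 : MainCtx G k N m M s5 := c4.run (by decide)
  have hcol5 : ∀ c, col n N s5 c = col n N s4 c := col_congr (run_arr_of_notMem _ _ (by decide))
  obtain ⟨n1, n2, n3⟩ := countCmd_spec (s := (cp 23 78).run s4) (G := G) (c4.toCtx.run (by decide))
  have e23 : ((cp 23 78).run s4).reg 23 = m + 3 := by simp [run, cp, c4.reg78]
  have hcol4' : col n N ((cp 23 78).run s4) (m + 3) = Y := by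
    rw [← u1]; exact col_congr (run_arr_of_notMem _ _ (by decide)) _
  rw [e23, hcol4'] at n1 n2 n3
  change s5.reg 72 = _ at n1
  change s5.reg 73 = _ at n2
  change s5.reg 74 = _ at n3
  have f : ∀ r, r ∉ (cp 76 44 ;; decodeCmd).wr → r ∉ progCmd.wr →
      r ∉ (cp 20 78 ;; load 22 5 77 ;; const 24 2).wr → r ∉ unionCmd.wr →
      s4.reg r = s.reg r := fun r h1 h2 h3 h4 => by
    rw [hs4, run_reg_of_notMem _ _ h4, hs3, run_reg_of_notMem _ _ h3, hs2,
      run_reg_of_notMem _ _ h2, hs1, run_reg_of_notMem _ _ h1]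
  have e31 : ((cp 23 78).run s4).reg 31 = s.reg 31 := by
    rw [run_reg_of_notMem _ _ (by decide), f 31 (by decide) (by decide) (by decide) (by decide)]
  have e37 : s5.reg 37 = s.reg 37 := by
    rw [hs5, run_reg_of_notMem _ _ (by decide),
      f 37 (by decide) (by decide) (by decide) (by decide)]
  rw [e31] at n3
  set acc : Cmd := (const 20 2 ;; cp 22 78 ;; cp 24 78) ;; unionCmd with hacc
  have hrun : tryCmd.run s = (sub 62 72 1 ;; ite 62 skip (add 62 73 37 ;; sub 62 74 62 ;;
      ite 62 skip acc)).run s5 := rfl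
  have hY5 : col n N s5 (m + 3) = Y := by rw [hcol5, u1]
  have hc5 : ∀ c < N, c < 3 ∨ m + 4 ≤ c → col n N s5 c = col n N s c := by
    intro c hc hc'
    rw [hcol5, u2 c hc (by omega), p1 c hc (by omega)]
  -- the two possible outcomes
  have hreject : ¬ Acceptable G k (s.reg 31) (s.reg 37) Y →
      ∀ c, col n N (tryCmd.run s) c = col n N s5 c := by
    intro hna
    have : (tryCmd.run s).arr 2 = s5.arr 2 := by
      rw [hrun]
      by_cases hk : Y.card - k = 0
      · have hg : ¬ (s.reg 31 * Y.card - (adjPairs G Y + s.reg 37) = 0) := by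
          rw [Nat.sub_eq_zero_iff_le] at hk ⊢
          exact fun h => hna ⟨hk, h⟩
        simp [run, n1, n2, n3, e37, c5.reg1, hk, hg, skip]
      · simp [run, n1, c5.reg1, hk, skip]
    exact fun c => col_congr this c
  have haccept : Acceptable G k (s.reg 31) (s.reg 37) Y →
      col n N (tryCmd.run s) 2 = Y ∧
      ∀ c < N, c ≠ 2 → col n N (tryCmd.run s) c = col n N s5 c := by
    rintro ⟨hk, hg⟩
    rw [← Nat.sub_eq_zero_iff_le] at hk hg
    set s6 := (sub 62 74 62).run ((add 62 73 37).run ((sub 62 72 1).run s5)) with hs6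
    have hr6 : tryCmd.run s = acc.run s6 := by
      rw [hrun]
      simp [run, n1, n2, n3, e37, c5.reg1, hk, hg, hs6]
    have c6 : MainCtx G k N m M s6 := c5.run (p := sub 62 72 1 ;; add 62 73 37 ;; sub 62 74 62)
      (by decide)
    set s7 := (const 20 2 ;; cp 22 78 ;; cp 24 78).run s6 with hs7
    have c7 : MainCtx G k N m M s7 := c6.run (by decide)
    have q20 : s7.reg 20 = 2 := by simp [hs7, run, cp]
    have q22 : s7.reg 22 = m + 3 := by simp [hs7, run, cp, c6.reg78]
    have q24 : s7.reg 24 = m + 3 := by simp [hs7, run, cp, c6.reg78]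
    have hcol7 : ∀ c, col n N s7 c = col n N s5 c := fun c => rfl
    obtain ⟨v1, v2⟩ := unionCmd_spec c7.toCtx (by omega)
      (by rw [hcol7, hc5 1 (by omega) (by omega), h1]) (by omega) (by omega) (by omega) (by omega)
    simp only [q20, q22, q24, hcol7, hY5, union_self] at v1 v2
    rw [hr6]
    exact ⟨v1, v2⟩
  have hres : ∀ Z ℓ dg, (∀ i < 6 * m + 1, x / N ^ i % N = dg i) → ℓ ≤ m → IsRun G F Z dg ℓ →
      dg (6 * m) < 3 + ℓ → col n N s2 r0 = Z (dg (6 * m)) := by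
    intro Z ℓ dg hdg hℓ hrunZ hr
    rw [← hdg _ (by omega), ← d2] at hr ⊢
    have hZ2 := hrunZ.2.2.1
    refine p2 Z ℓ hℓ (fun c hc => ?_) ?_ r0 hr
    · interval_cases c
      · rw [h0, hrunZ.1]
      · rw [h1, hrunZ.2.1]
      · rw [hZ2]
    · rw [hZ2]; exact hrunZ.congr fun i hi => by rw [d1 i (by omega), hdg i (by omega)]
  by_cases hA : Acceptable G k (s.reg 31) (s.reg 37) Y
  · obtain ⟨a1, a2⟩ := haccept hA
    refine ⟨⟨?_, ?_, ?_⟩, ?_, ?_, ?_⟩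
    · rw [a2 0 (by omega) (by omega), hc5 0 (by omega) (by omega), h0]
    · rw [a2 1 (by omega) (by omega), hc5 1 (by omega) (by omega), h1]
    · rw [a2 _ (by omega) (by omega), hc5 _ (by omega) (by omega)]
    · rw [a1]; exact subset_union_right
    · rw [a1]; exact .inr hA
    · intro Z ℓ dg hdg hℓ hrunZ hr _
      rw [a1, hY, hres Z ℓ dg hdg hℓ hrunZ hr]
      exact subset_union_left
  · have a := hreject hA
    refine ⟨⟨?_, ?_, ?_⟩, ?_, ?_, ?_⟩
    · rw [a, hc5 0 (by omega) (by omega), h0]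
    · rw [a, hc5 1 (by omega) (by omega), h1]
    · rw [a, hc5 _ (by omega) (by omega)]
    · rw [a, hc5 2 (by omega) (by omega)]
    · exact .inl (by rw [a, hc5 2 (by omega) (by omega)])
    · intro Z ℓ dg hdg hℓ hrunZ hr hAc
      refine absurd ?_ hA
      rwa [hY, hres Z ℓ dg hdg hℓ hrunZ hr, union_comm]

/-- A set `F` that no set program can enlarge to an acceptable set. -/
def Stable {n : ℕ} (G : SimpleGraph (Fin n)) (k N m g a : ℕ) (F : Finset (Fin n)) : Prop :=
  ∀ Z ℓ dg, (∀ i < 6 * m + 1, dg i < N) → ℓ ≤ m → IsRun G F Z dg ℓ → dg (6 * m) < 3 + ℓ →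
    Acceptable G k g a (F ∪ Z (dg (6 * m))) → Z (dg (6 * m)) ⊆ F

/-- Try all set programs. -/
def passCmd : Cmd := forTo 44 45 7 tryCmd

theorem passCmd_spec {n : ℕ} {G : SimpleGraph (Fin n)} {k N m : ℕ} {s : RAMState}
    (h : MainCtx G k N m (N ^ (6 * m + 1)) s) (h0 : col n N s 0 = univ) (h1 : col n N s 1 = ∅) :
    (col n N (passCmd.run s) 0 = univ ∧ col n N (passCmd.run s) 1 = ∅ ∧
      col n N (passCmd.run s) (m + 4) = col n N s (m + 4)) ∧
    col n N s 2 ⊆ col n N (passCmd.run s) 2 ∧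
    (col n N (passCmd.run s) 2 = col n N s 2 ∨
      Acceptable G k (s.reg 31) (s.reg 37) (col n N (passCmd.run s) 2)) ∧
    (col n N (passCmd.run s) 2 = col n N s 2 →
      Stable G k N m (s.reg 31) (s.reg 37) (col n N s 2)) := by
  set F := col n N s 2 with hF
  have key := forTo_induct (i := 44) (c := 45) (b := 7) (q := tryCmd) (s := s)
    (fun j s' => (col n N s' 0 = univ ∧ col n N s' 1 = ∅ ∧
        col n N s' (m + 4) = col n N s (m + 4)) ∧ F ⊆ col n N s' 2 ∧
      (col n N s' 2 = F ∨ Acceptable G k (s.reg 31) (s.reg 37) (col n N s' 2)) ∧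
      (col n N s' 2 = F → ∀ x < j, ∀ Z ℓ dg, (∀ i < 6 * m + 1, x / N ^ i % N = dg i) → ℓ ≤ m →
        IsRun G F Z dg ℓ → dg (6 * m) < 3 + ℓ →
        Acceptable G k (s.reg 31) (s.reg 37) (F ∪ Z (dg (6 * m))) → Z (dg (6 * m)) ⊆ F))
    (by decide +kernel) (by decide +kernel)
    ⟨⟨h0, h1, rfl⟩, subset_rfl, .inl rfl, fun _ x hx => absurd hx (by omega)⟩
    (by
      intro j hj s' hi hr ha ⟨⟨i0, i1, i2⟩, i3, i4, i5⟩
      rw [h.reg7] at hj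
      have hc : MainCtx G k N m (N ^ (6 * m + 1)) s' :=
        h.of_eq (fun r hr' => hr r (by revert r; decide +kernel)) (ha 0 (by decide +kernel))
      have e31 : s'.reg 31 = s.reg 31 := hr 31 (by decide +kernel)
      have e37 : s'.reg 37 = s.reg 37 := hr 37 (by decide +kernel)
      obtain ⟨⟨t0, t1, t2⟩, t3, t4, t5⟩ := tryCmd_spec hc i0 i1 hi hj.le
      rw [e31, e37] at t4 t5
      have hfin : ∀ c, col n N (bump 44 45 (tryCmd.run s')) c = col n N (tryCmd.run s') c :=
        col_congr (by rw [bump_arr])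
      simp only [hfin]
      refine ⟨⟨t0, t1, t2.trans i2⟩, i3.trans t3, ?_, ?_⟩
      · rcases t4 with t4 | t4
        · rw [t4]; exact i4
        · exact .inr t4
      · intro heq x hx Z ℓ dg hdg hℓ hrunZ hr0 hacc
        have hs' : col n N s' 2 = F := subset_antisymm (heq ▸ t3) i3
        rcases Nat.lt_succ_iff_lt_or_eq.1 hx with hlt | rfl
        · exact i5 hs' x hlt Z ℓ dg hdg hℓ hrunZ hr0 hacc
        · rw [hs', heq] at t5
          exact t5 Z ℓ dg hdg hℓ hrunZ hr0 hacc)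
  rw [h.reg7] at key
  rw [passCmd]
  generalize (forTo 44 45 7 tryCmd).run s = t at key ⊢
  obtain ⟨k1, k2, k3, k4⟩ := key
  refine ⟨k1, k2, k3, fun heq Z ℓ dg hdg => ?_⟩
  obtain ⟨x, hx, hd⟩ := exists_digits N dg (6 * m + 1) hdg
  exact k4 heq x hx Z ℓ dg hd

/-- The set `F` together with the vertices below `y₂` that have at least `θ` neighbours in `F`, and all
vertices below `y₃`. -/
noncomputable def extend {n : ℕ} (G : SimpleGraph (Fin n)) (F : Finset (Fin n)) (θ y₂ y₃ : ℕ) :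
    Finset (Fin n) :=
  univ.filter fun v => v ∈ F ∨ (θ ≤ degIn G F v ∧ (v : ℕ) < y₂) ∨ (v : ℕ) < y₃

/-- Extend the current set `F` (number `2`) with the parameters `reg 34`, `reg 35`, `reg 36`, and record
the result in column `reg 79` if it has `k` vertices and is at least as good as the set recorded
before. The number of adjacent pairs of the recorded set is kept in register `30`. -/
def finishCmd : Cmd :=
  ((cp 20 78 ;; const 21 1 ;; const 22 0 ;; const 23 2 ;; const 24 2 ;; cp 25 34 ;; cp 26 35 ;;
    cp 27 0) ;; opCmd) ;;
  ((const 22 0 ;; const 23 1 ;; cp 24 78 ;; const 25 0 ;; cp 26 36) ;; opCmd) ;;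
  (cp 23 78 ;; countCmd) ;;
  (sub 62 72 1 ;; sub 61 1 72 ;; add 62 62 61) ;; ite 62 skip (sub 62 30 73 ;; ite 62 skip
    (cp 30 73 ;; (cp 20 79 ;; cp 22 78 ;; cp 24 78) ;; unionCmd))

/-- Column `m + 4` is empty, or holds a set of `k` vertices; its number of adjacent pairs is in register
`30`. -/
def RecordOk {n : ℕ} (G : SimpleGraph (Fin n)) (k N m : ℕ) (s : RAMState) : Prop :=
  s.reg 30 = adjPairs G (col n N s (m + 4)) ∧
    ((col n N s (m + 4)).card = k ∨ col n N s (m + 4) = ∅)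

/-- The record of `s'` is at least as good as the record of `s`. -/
def RecordLe (n N m k : ℕ) (s s' : RAMState) : Prop :=
  s.reg 30 ≤ s'.reg 30 ∧ ((col n N s (m + 4)).card = k → (col n N s' (m + 4)).card = k)

/-- The record of `s` is at least as good as the set `O`, if `O` has `k` vertices. -/
def Beats {n : ℕ} (G : SimpleGraph (Fin n)) (k N m : ℕ) (s : RAMState) (O : Finset (Fin n)) : Prop :=
  O.card = k → (col n N s (m + 4)).card = k ∧ adjPairs G O ≤ s.reg 30

theorem RecordLe.refl (n N m k : ℕ) (s : RAMState) : RecordLe n N m k s s := ⟨le_rfl, id⟩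

theorem RecordLe.trans {n N m k : ℕ} {s s' s'' : RAMState} (h : RecordLe n N m k s s')
    (h' : RecordLe n N m k s' s'') : RecordLe n N m k s s'' := ⟨h.1.trans h'.1, h'.2 ∘ h.2⟩

theorem Beats.mono {n : ℕ} {G : SimpleGraph (Fin n)} {k N m : ℕ} {s s' : RAMState}
    {O : Finset (Fin n)} (h : Beats G k N m s O) (h' : RecordLe n N m k s s') :
    Beats G k N m s' O :=
  fun hO => ⟨h'.2 (h hO).1, (h hO).2.trans h'.1⟩

theorem finishCmd_spec {n : ℕ} {G : SimpleGraph (Fin n)} {k N m M : ℕ} {s : RAMState}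
    (h : MainCtx G k N m M s) (h0 : col n N s 0 = univ) (h1 : col n N s 1 = ∅)
    (hrec : RecordOk G k N m s) :
    (∀ c < 3, col n N (finishCmd.run s) c = col n N s c) ∧ RecordOk G k N m (finishCmd.run s) ∧
    RecordLe n N m k s (finishCmd.run s) ∧
    Beats G k N m (finishCmd.run s)
      (extend G (col n N s 2) (s.reg 34) (s.reg 35) (s.reg 36)) := by
  have hlarge := h.large
  set F := col n N s 2 with hF
  set s1 := (cp 20 78 ;; const 21 1 ;; const 22 0 ;; const 23 2 ;; const 24 2 ;; cp 25 34 ;;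
    cp 26 35 ;; cp 27 0).run s with hs1
  have c1 : MainCtx G k N m M s1 := h.run (by decide)
  have hcol1 : ∀ c, col n N s1 c = col n N s c := fun c => rfl
  have a20 : s1.reg 20 = m + 3 := by simp [hs1, run, cp, h.reg78]
  have a21 : s1.reg 21 = 1 := by simp [hs1, run, cp]
  have a22 : s1.reg 22 = 0 := by simp [hs1, run, cp]
  have a23 : s1.reg 23 = 2 := by simp [hs1, run, cp]
  have a24 : s1.reg 24 = 2 := by simp [hs1, run, cp]
  have a25 : s1.reg 25 = s.reg 34 := by simp [hs1, run, cp]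
  have a26 : s1.reg 26 = s.reg 35 := by simp [hs1, run, cp]
  have a27 : s1.reg 27 = n := by simp [hs1, run, cp, h.reg0]
  obtain ⟨o1, o2⟩ := opCmd_spec c1.toCtx (by omega) (by omega) (by omega) (by omega) (by omega)
  replace o2 := o2 (by omega)
  simp only [a20, a21, a22, a23, a24, a25, a26, a27, hcol1, h0, h1, ← hF] at o1 o2
  set s2 := opCmd.run s1 with hs2
  have c2 : MainCtx G k N m M s2 := c1.run (by decide)
  set s3 := (const 22 0 ;; const 23 1 ;; cp 24 78 ;; const 25 0 ;; cp 26 36).run s2 with hs3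
  have c3 : MainCtx G k N m M s3 := c2.run (by decide)
  have hcol3 : ∀ c, col n N s3 c = col n N s2 c := fun c => rfl
  have f2 : ∀ r, r ∉ opCmd.wr → s2.reg r = s1.reg r := fun r hr => run_reg_of_notMem _ _ hr
  have b20 : s3.reg 20 = m + 3 := by simp [hs3, run, cp, f2 20 (by decide), a20]
  have b21 : s3.reg 21 = 1 := by simp [hs3, run, cp, f2 21 (by decide), a21]
  have b22 : s3.reg 22 = 0 := by simp [hs3, run, cp]
  have b23 : s3.reg 23 = 1 := by simp [hs3, run, cp]
  have b24 : s3.reg 24 = m + 3 := by simp [hs3, run, cp, c2.reg78]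
  have b25 : s3.reg 25 = 0 := by simp [hs3, run, cp]
  have b26 : s3.reg 26 = s.reg 36 := by simp [hs3, run, cp, f2 36 (by decide), hs1]
  have b27 : s3.reg 27 = n := by simp [hs3, run, cp, f2 27 (by decide), a27]
  obtain ⟨o3, o4⟩ := opCmd_spec c3.toCtx (by omega) (by omega) (by omega) (by omega) (by omega)
  replace o4 := o4 (by omega)
  simp only [b20, b21, b22, b23, b24, b25, b26, b27, hcol3] at o3 o4
  rw [o1 0 (by omega) (by omega), o1 1 (by omega) (by omega), h0, h1, o2] at o4
  set s4 := opCmd.run s3 with hs4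
  have c4 : MainCtx G k N m M s4 := c3.run (by decide)
  set O := extend G F (s.reg 34) (s.reg 35) (s.reg 36) with hO
  have hO4 : col n N s4 (m + 3) = O := by
    rw [o4]
    ext v
    simp only [mem_opSet, hO, extend, mem_filter, mem_univ, true_and, notMem_empty,
      not_false_eq_true, v.2.ne, false_or, Nat.zero_le]
    tauto
  have hc4 : ∀ c < N, c ≠ m + 3 → col n N s4 c = col n N s c := fun c hc hc' => by
    rw [o3 c hc hc', o1 c hc hc']
  set s5 := (cp 23 78 ;; countCmd).run s4 with hs5
  have c5 : MainCtx G k N m M s5 := c4.run (by decide)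
  have hcol5 : ∀ c, col n N s5 c = col n N s4 c := col_congr (run_arr_of_notMem _ _ (by decide))
  obtain ⟨n1, n2, -⟩ := countCmd_spec (s := (cp 23 78).run s4) (G := G) (c4.toCtx.run (by decide))
  have e23 : ((cp 23 78).run s4).reg 23 = m + 3 := by simp [run, cp, c4.reg78]
  have hcol4' : col n N ((cp 23 78).run s4) (m + 3) = O := by
    rw [← hO4]; rfl
  rw [e23, hcol4'] at n1 n2
  change s5.reg 72 = _ at n1
  change s5.reg 73 = _ at n2
  have e30 : s5.reg 30 = s.reg 30 := by
    rw [hs5, run_reg_of_notMem _ _ (by decide), hs4, run_reg_of_notMem _ _ (by decide), hs3,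
      run_reg_of_notMem _ _ (by decide), hs2, run_reg_of_notMem _ _ (by decide), hs1,
      run_reg_of_notMem _ _ (by decide)]
  have hc5 : ∀ c < N, c ≠ m + 3 → col n N s5 c = col n N s c := fun c hc hc' => by
    rw [hcol5, hc4 c hc hc']
  set rec : Cmd := cp 30 73 ;; (cp 20 79 ;; cp 22 78 ;; cp 24 78) ;; unionCmd with hrecd
  set s6 := (sub 62 72 1 ;; sub 61 1 72 ;; add 62 62 61).run s5 with hs6
  have hrun : finishCmd.run s = (ite 62 skip (sub 62 30 73 ;; ite 62 skip rec)).run s6 := rfl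
  have c6 : MainCtx G k N m M s6 := c5.run (by decide)
  have hcol6 : ∀ c, col n N s6 c = col n N s5 c := fun c => rfl
  have e62 : s6.reg 62 = O.card - k + (k - O.card) := by simp [hs6, run, n1, c5.reg1]
  have e73 : s6.reg 73 = adjPairs G O := by simp [hs6, run, n2]
  have e30' : s6.reg 30 = s.reg 30 := by simp [hs6, run, e30]
  clear_value s6
  have hreject : ¬ (O.card = k ∧ s.reg 30 ≤ adjPairs G O) →
      (finishCmd.run s).reg 30 = s.reg 30 ∧
      ∀ c, col n N (finishCmd.run s) c = col n N s5 c := by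
    intro hna
    have key : (finishCmd.run s).reg 30 = s6.reg 30 ∧ (finishCmd.run s).arr = s6.arr := by
      rw [hrun]
      by_cases hk : O.card - k + (k - O.card) = 0
      · have hg : ¬ (s.reg 30 - adjPairs G O = 0) := by
          rw [Nat.sub_eq_zero_iff_le]
          exact fun h => hna ⟨by omega, h⟩
        rw [hk] at e62
        simp [run, e62, e73, e30', hg, skip]
      · rw [← e62] at hk
        simp [run, hk, skip]
    exact ⟨key.1.trans e30', fun c => (col_congr (by rw [key.2]) c).trans (hcol6 c)⟩
  have haccept : (O.card = k ∧ s.reg 30 ≤ adjPairs G O) →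
      (finishCmd.run s).reg 30 = adjPairs G O ∧ col n N (finishCmd.run s) (m + 4) = O ∧
      ∀ c < N, c ≠ m + 4 → col n N (finishCmd.run s) c = col n N s5 c := by
    rintro ⟨hk, hg⟩
    rw [← Nat.sub_eq_zero_iff_le] at hg
    rw [hk, Nat.sub_self] at e62
    have hr6 : finishCmd.run s = rec.run ((sub 62 30 73).run s6) := by
      rw [hrun]
      simp [run, e62, e73, e30', hg]
    set s7 := (sub 62 30 73 ;; cp 30 73 ;; cp 20 79 ;; cp 22 78 ;; cp 24 78).run s6 with hs7
    have c7 : MainCtx G k N m M s7 := c6.run (by decide)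
    have q20 : s7.reg 20 = m + 4 := by simp [hs7, run, cp, c6.reg79]
    have q22 : s7.reg 22 = m + 3 := by simp [hs7, run, cp, c6.reg78]
    have q24 : s7.reg 24 = m + 3 := by simp [hs7, run, cp, c6.reg78]
    have q30 : s7.reg 30 = adjPairs G O := by simp [hs7, run, cp, e73]
    have hcol7 : ∀ c, col n N s7 c = col n N s5 c := fun c => hcol6 c
    obtain ⟨v1, v2⟩ := unionCmd_spec c7.toCtx (by omega)
      (by rw [hcol7, hc5 1 (by omega) (by omega), h1]) (by omega) (by omega) (by omega) (by omega)
    simp only [q20, q22, q24, hcol7, hcol5, hO4, union_self] at v1 v2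
    rw [hr6]
    refine ⟨(run_reg_of_notMem unionCmd s7 (by decide)).trans q30, v1, fun c hc hc' => ?_⟩
    rw [hcol5]; exact v2 c hc hc'
  by_cases hA : O.card = k ∧ s.reg 30 ≤ adjPairs G O
  · obtain ⟨a1, a2, a3⟩ := haccept hA
    refine ⟨fun c hc => ?_, ⟨?_, ?_⟩, ⟨?_, ?_⟩, ?_⟩
    · rw [a3 c (by omega) (by omega), hc5 c (by omega) (by omega)]
    · rw [a1, a2]
    · rw [a2]; exact .inl hA.1
    · rw [a1]; exact hA.2
    · rw [a2]; exact fun _ => hA.1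
    · rw [Beats, a1, a2]; exact fun _ => ⟨hA.1, le_rfl⟩
  · obtain ⟨a1, a2⟩ := hreject hA
    have a3 : col n N (finishCmd.run s) (m + 4) = col n N s (m + 4) := by
      rw [a2, hc5 _ (by omega) (by omega)]
    refine ⟨fun c hc => ?_, ⟨?_, ?_⟩, ⟨?_, ?_⟩, ?_⟩
    · rw [a2 c, hc5 c (by omega) (by omega)]
    · rw [a1, a3]; exact hrec.1
    · rw [a3]; exact hrec.2
    · rw [a1]
    · rw [a3]; exact id
    · intro hk
      rw [a1, a3]
      have hlt : adjPairs G O < s.reg 30 := by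
        by_contra hle
        exact hA ⟨hk, not_lt.1 hle⟩
      refine ⟨?_, hlt.le⟩
      rcases hrec.2 with h | h
      · exact h
      · rw [hrec.1, h] at hlt
        simp [adjPairs] at hlt

/-- Record the extensions of the current set `F` for all choices of three parameters, which are the
digits of a loop counter. -/
def extendCmd : Cmd :=
  forTo 44 45 7 ((cp 76 44 ;; decodeCmd) ;; (const 71 0 ;; load 34 5 71 ;; add 71 71 2 ;;
    load 35 5 71 ;; add 71 71 2 ;; load 36 5 71) ;; finishCmd)

theorem extendCmd_spec {n : ℕ} {G : SimpleGraph (Fin n)} {k N m : ℕ} {s : RAMState} (hm : 1 ≤ m)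
    (h : MainCtx G k N m (N ^ (6 * m + 1)) s) (h0 : col n N s 0 = univ) (h1 : col n N s 1 = ∅)
    (hrec : RecordOk G k N m s) :
    (∀ c < 3, col n N (extendCmd.run s) c = col n N s c) ∧ RecordOk G k N m (extendCmd.run s) ∧
    RecordLe n N m k s (extendCmd.run s) ∧ ∀ θ < N, ∀ y₂ < N, ∀ y₃ < N,
      Beats G k N m (extendCmd.run s) (extend G (col n N s 2) θ y₂ y₃) := by
  have hlarge := h.large
  set F := col n N s 2 with hF
  have key := forTo_induct (i := 44) (c := 45) (b := 7)
    (q := (cp 76 44 ;; decodeCmd) ;; (const 71 0 ;; load 34 5 71 ;; add 71 71 2 ;;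
      load 35 5 71 ;; add 71 71 2 ;; load 36 5 71) ;; finishCmd) (s := s)
    (fun j s' => (∀ c < 3, col n N s' c = col n N s c) ∧ RecordOk G k N m s' ∧
      RecordLe n N m k s s' ∧
      ∀ x < j, ∀ dg : ℕ → ℕ, (∀ i < 6 * m + 1, x / N ^ i % N = dg i) →
        Beats G k N m s' (extend G F (dg 0) (dg 1) (dg 2)))
    (by decide +kernel) (by decide +kernel)
    ⟨fun _ _ => rfl, hrec, .refl .., fun x hx => absurd hx (by omega)⟩
    (by
      intro j hj s' hi hr ha ⟨i0, i1, i2, i3⟩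
      rw [h.reg7] at hj
      have hc : MainCtx G k N m (N ^ (6 * m + 1)) s' :=
        h.of_eq (fun r hr' => hr r (by revert r; decide +kernel)) (ha 0 (by decide +kernel))
      set s1 := (cp 76 44 ;; decodeCmd).run s' with hs1
      have c1 : MainCtx G k N m (N ^ (6 * m + 1)) s1 := hc.run (by decide)
      have d1 : ∀ i < 6 * m + 1, s1.arr 5 i = j / N ^ i % N := by
        have := decodeCmd_spec (x := j) (s := (cp 76 44).run s') (N := N) (by omega)
          (by simp [run, cp, hc.reg2]) (by simp [run, cp, hc.reg3]) (by simp [run, cp, hc.reg4])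
          (by simp [run, cp, hi]) (by simp [run, cp, hc.reg7, hj.le])
        have e5 : ((cp 76 44).run s').reg 5 = 6 * m + 1 := by simp [run, cp, hc.reg5]
        rw [e5] at this
        exact this
      have hcol1 : ∀ c, col n N s1 c = col n N s' c :=
        col_congr (run_arr_of_notMem _ _ (by decide))
      have f1 : s1.reg 30 = s'.reg 30 := run_reg_of_notMem _ _ (by decide)
      set s2 := (const 71 0 ;; load 34 5 71 ;; add 71 71 2 ;; load 35 5 71 ;; add 71 71 2 ;;
        load 36 5 71).run s1 with hs2
      have c2 : MainCtx G k N m (N ^ (6 * m + 1)) s2 := c1.run (by decide)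
      have hcol2 : ∀ c, col n N s2 c = col n N s1 c :=
        col_congr (run_arr_of_notMem _ _ (by decide))
      have e2 := c1.reg2
      have a34 : s2.reg 34 = s1.arr 5 0 := by simp [hs2, run]
      have a35 : s2.reg 35 = s1.arr 5 1 := by simp [hs2, run, e2]
      have a36 : s2.reg 36 = s1.arr 5 2 := by simp [hs2, run, e2]
      have f2 : s2.reg 30 = s1.reg 30 := run_reg_of_notMem _ _ (by decide)
      have hrun : ((cp 76 44 ;; decodeCmd) ;; (const 71 0 ;; load 34 5 71 ;; add 71 71 2 ;;
          load 35 5 71 ;; add 71 71 2 ;; load 36 5 71) ;; finishCmd).run s' = finishCmd.run s2 := by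
        rw [run_seq, run_seq]
      rw [hrun]
      clear_value s2
      have r2 : RecordOk G k N m s2 := by
        rw [RecordOk, hcol2, hcol1, f2, f1]; exact i1
      have l2 : RecordLe n N m k s' s2 := by
        rw [RecordLe, hcol2, hcol1, f2, f1]; exact ⟨le_rfl, id⟩
      obtain ⟨p0, p1, p2, p3⟩ := finishCmd_spec c2
        (by rw [hcol2, hcol1, i0 0 (by omega), h0]) (by rw [hcol2, hcol1, i0 1 (by omega), h1]) r2
      rw [hcol2, hcol1, i0 2 (by omega), a34, a35, a36] at p3
      generalize finishCmd.run s2 = s3 at p0 p1 p2 p3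
      have hcol3 : ∀ c, col n N (bump 44 45 s3) c = col n N s3 c := col_congr (by rw [bump_arr])
      have h30 : (bump 44 45 s3).reg 30 = s3.reg 30 := by simp
      generalize bump 44 45 s3 = s4 at hcol3 h30
      have r4 : RecordOk G k N m s4 := by rw [RecordOk, hcol3, h30]; exact p1
      have l4 : RecordLe n N m k s3 s4 := ⟨h30.ge, by rw [hcol3]; exact id⟩
      refine ⟨fun c hc => by rw [hcol3, p0 c hc, hcol2, hcol1, i0 c hc], r4,
        i2.trans ((l2.trans p2).trans l4), fun x hx dg hdg => ?_⟩
      rcases Nat.lt_succ_iff_lt_or_eq.1 hx with hlt | rfl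
      · exact (i3 x hlt dg hdg).mono ((l2.trans p2).trans l4)
      · have e : ∀ i < 3, s1.arr 5 i = dg i := fun i hi => by
          rw [d1 i (by omega), hdg i (by omega)]
        rw [e 0 (by omega), e 1 (by omega), e 2 (by omega)] at p3
        exact p3.mono l4)
  rw [h.reg7] at key
  rw [extendCmd]
  generalize (forTo 44 45 7 ((cp 76 44 ;; decodeCmd) ;; (const 71 0 ;; load 34 5 71 ;;
    add 71 71 2 ;; load 35 5 71 ;; add 71 71 2 ;; load 36 5 71) ;; finishCmd)).run s = t at key ⊢
  obtain ⟨k0, k1, k2, k3⟩ := key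
  refine ⟨k0, k1, k2, fun θ hθ y₂ hy₂ y₃ hy₃ => ?_⟩
  obtain ⟨x, hx, hd⟩ := exists_digits N (fun i => if i = 0 then θ else if i = 1 then y₂ else
    if i = 2 then y₃ else 0) (6 * m + 1) (fun i _ => by
      split_ifs
      all_goals first | assumption | omega)
  exact k3 x hx _ hd

/-- Enlarge `F` by passes through all set programs, and record the extensions of `F` after each
of the `k + 1` passes. -/
def passesCmd : Cmd := forTo 42 43 8 (passCmd ;; extendCmd)

/-- What the greedy phase finds: a stable set `F` between `F₀` and an acceptable set. -/
def GreedySet {n : ℕ} (G : SimpleGraph (Fin n)) (k N m g : ℕ) (F₀ F : Finset (Fin n)) : Prop :=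
  F₀ ⊆ F ∧ (F = F₀ ∨ Acceptable G k g (g * F₀.card) F) ∧ Stable G k N m g (g * F₀.card) F

theorem passesCmd_spec {n : ℕ} {G : SimpleGraph (Fin n)} {k N m : ℕ} {s : RAMState} (hm : 1 ≤ m)
    (h : MainCtx G k N m (N ^ (6 * m + 1)) s) (h0 : col n N s 0 = univ) (h1 : col n N s 1 = ∅)
    (hrec : RecordOk G k N m s) (hg : s.reg 37 = s.reg 31 * (col n N s 2).card) :
    (col n N (passesCmd.run s) 0 = univ ∧ col n N (passesCmd.run s) 1 = ∅) ∧
    RecordOk G k N m (passesCmd.run s) ∧ RecordLe n N m k s (passesCmd.run s) ∧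
    ((col n N s 2).card ≤ k → ∃ F, GreedySet G k N m (s.reg 31) (col n N s 2) F ∧
      ∀ θ < N, ∀ y₂ < N, ∀ y₃ < N, Beats G k N m (passesCmd.run s) (extend G F θ y₂ y₃)) := by
  set F₀ := col n N s 2 with hF₀
  have key := forTo_induct (i := 42) (c := 43) (b := 8) (q := passCmd ;; extendCmd) (s := s)
    (fun j s' => (col n N s' 0 = univ ∧ col n N s' 1 = ∅) ∧ F₀ ⊆ col n N s' 2 ∧
      (col n N s' 2 = F₀ ∨ Acceptable G k (s.reg 31) (s.reg 37) (col n N s' 2)) ∧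
      RecordOk G k N m s' ∧ RecordLe n N m k s s' ∧
      (j ≤ (col n N s' 2).card ∨ ∃ F, GreedySet G k N m (s.reg 31) F₀ F ∧
        ∀ θ < N, ∀ y₂ < N, ∀ y₃ < N, Beats G k N m s' (extend G F θ y₂ y₃)))
    (by decide +kernel) (by decide +kernel)
    ⟨⟨h0, h1⟩, subset_rfl, .inl rfl, hrec, .refl .., .inl (Nat.zero_le _)⟩
    (by
      intro j hj s' hi hr ha ⟨⟨i0, i1⟩, i2, i3, i4, i5, i6⟩
      have hc : MainCtx G k N m (N ^ (6 * m + 1)) s' :=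
        h.of_eq (fun r hr' => hr r (by revert r; decide +kernel)) (ha 0 (by decide +kernel))
      have e31 : s'.reg 31 = s.reg 31 := hr 31 (by decide +kernel)
      have e37 : s'.reg 37 = s.reg 37 := hr 37 (by decide +kernel)
      obtain ⟨⟨p0, p1, p2⟩, p3, p4, p5⟩ := passCmd_spec hc i0 i1
      rw [e31, e37] at p4 p5
      set s1 := passCmd.run s' with hs1
      have f1 : ∀ r, r ∉ passCmd.wr → s1.reg r = s'.reg r := fun r hr => run_reg_of_notMem _ _ hr
      have c1 : MainCtx G k N m (N ^ (6 * m + 1)) s1 := hc.run (by decide +kernel)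
      have r1 : RecordOk G k N m s1 := by
        rw [RecordOk, p2, f1 30 (by decide +kernel)]; exact i4
      obtain ⟨q0, q1, q2, q3⟩ := extendCmd_spec hm c1 p0 p1 r1
      have l1 : RecordLe n N m k s' (extendCmd.run s1) :=
        RecordLe.trans ⟨(f1 30 (by decide +kernel)).ge, by rw [p2]; exact id⟩ q2
      have hfin : ∀ c, col n N (bump 42 43 ((passCmd ;; extendCmd).run s')) c =
          col n N (extendCmd.run s1) c := col_congr (by rw [bump_arr, run_seq])
      have hfin30 : (bump 42 43 ((passCmd ;; extendCmd).run s')).reg 30 =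
          (extendCmd.run s1).reg 30 := by
        rw [bump_reg, if_neg (by decide), if_neg (by decide), run_seq]
      have hacc : col n N s1 2 = F₀ ∨ Acceptable G k (s.reg 31) (s.reg 37) (col n N s1 2) := by
        rcases p4 with p4 | p4
        · rw [p4]; exact i3
        · exact .inr p4
      clear_value s1
      generalize bump 42 43 ((passCmd ;; extendCmd).run s') = s3 at hfin hfin30 ⊢
      generalize extendCmd.run s1 = s2 at q0 q1 q2 q3 l1 hfin hfin30
      have r3 : RecordOk G k N m s3 := by rw [RecordOk, hfin, hfin30]; exact q1
      have l3 : RecordLe n N m k s2 s3 := ⟨hfin30.ge, by rw [hfin]; exact id⟩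
      simp only [hfin]
      rw [q0 0 (by omega), q0 1 (by omega), q0 2 (by omega)]
      refine ⟨⟨p0, p1⟩, i2.trans p3, hacc, r3, i5.trans (l1.trans l3), ?_⟩
      rcases i6 with i6 | ⟨F, hF, hB⟩
      · by_cases heq : col n N s1 2 = col n N s' 2
        · refine .inr ⟨col n N s1 2, ⟨i2.trans p3, ?_, ?_⟩,
            fun θ hθ y₂ hy₂ y₃ hy₃ => (q3 θ hθ y₂ hy₂ y₃ hy₃).mono l3⟩
          · rw [← hg]; exact hacc
          · rw [← hg, heq]; exact p5 heq
        · refine .inl (Nat.succ_le_of_lt (i6.trans_lt (card_lt_card ?_)))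
          exact ssubset_of_subset_of_ne p3 (Ne.symm heq)
      · exact .inr ⟨F, hF, fun θ hθ y₂ hy₂ y₃ hy₃ => (hB θ hθ y₂ hy₂ y₃ hy₃).mono (l1.trans l3)⟩)
  rw [h.reg8] at key
  rw [passesCmd]
  generalize (forTo 42 43 8 (passCmd ;; extendCmd)).run s = t at key ⊢
  obtain ⟨k1, -, k3, k4, k5, k6⟩ := key
  refine ⟨k1, k4, k5, fun hk => k6.resolve_left fun hle => ?_⟩
  rcases k3 with k3 | k3
  · rw [k3] at hle; omega
  · have := k3.1; omega

/-- The first vertices, up to the bound `y`, of degree at least `Θ`. -/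
noncomputable def heavy {n : ℕ} (G : SimpleGraph (Fin n)) (Θ y : ℕ) : Finset (Fin n) :=
  univ.filter fun v => Θ ≤ degIn G univ v ∧ (v : ℕ) < y

/-- Load the first three digits as parameters and start with a set of vertices of large degree. -/
def initCmd : Cmd :=
  (const 71 0 ;; load 31 5 71 ;; add 71 71 2 ;; load 32 5 71 ;; add 71 71 2 ;; load 33 5 71 ;;
    const 20 2 ;; const 21 1 ;; const 22 0 ;; const 23 0 ;; const 24 1 ;; cp 25 32 ;; cp 26 33 ;;
    cp 27 0) ;; opCmd ;; (const 23 2 ;; countCmd) ;; cp 37 74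

theorem initCmd_spec {n : ℕ} {G : SimpleGraph (Fin n)} {k N m M : ℕ} {s : RAMState}
    (h : MainCtx G k N m M s) (h0 : col n N s 0 = univ) (h1 : col n N s 1 = ∅) :
    (∀ c < N, c ≠ 2 → col n N (initCmd.run s) c = col n N s c) ∧
    col n N (initCmd.run s) 2 = heavy G (s.arr 5 1) (s.arr 5 2) ∧
    (initCmd.run s).reg 31 = s.arr 5 0 ∧
    (initCmd.run s).reg 37 = s.arr 5 0 * (heavy G (s.arr 5 1) (s.arr 5 2)).card := by
  have hlarge := h.large
  set s1 := (const 71 0 ;; load 31 5 71 ;; add 71 71 2 ;; load 32 5 71 ;; add 71 71 2 ;;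
    load 33 5 71 ;; const 20 2 ;; const 21 1 ;; const 22 0 ;; const 23 0 ;; const 24 1 ;;
    cp 25 32 ;; cp 26 33 ;; cp 27 0).run s with hs1
  have c1 : MainCtx G k N m M s1 := h.run (by decide +kernel)
  have hcol1 : ∀ c, col n N s1 c = col n N s c := col_congr (run_arr_of_notMem _ _ (by decide +kernel))
  have e2 := h.reg2
  have a20 : s1.reg 20 = 2 := by simp [hs1, run, cp]
  have a21 : s1.reg 21 = 1 := by simp [hs1, run, cp]
  have a22 : s1.reg 22 = 0 := by simp [hs1, run, cp]
  have a23 : s1.reg 23 = 0 := by simp [hs1, run, cp]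
  have a24 : s1.reg 24 = 1 := by simp [hs1, run, cp]
  have a25 : s1.reg 25 = s.arr 5 1 := by simp [hs1, run, cp, e2]
  have a26 : s1.reg 26 = s.arr 5 2 := by simp [hs1, run, cp, e2]
  have a27 : s1.reg 27 = n := by simp [hs1, run, cp, h.reg0]
  have a31 : s1.reg 31 = s.arr 5 0 := by simp [hs1, run, cp]
  obtain ⟨o1, o2⟩ := opCmd_spec c1.toCtx (by omega) (by omega) (by omega) (by omega) (by omega)
  replace o2 := o2 (by omega)
  simp only [a20, a21, a22, a23, a24, a25, a26, a27, hcol1, h0, h1] at o1 o2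
  set s2 := opCmd.run s1 with hs2
  have c2 : MainCtx G k N m M s2 := c1.run (by decide +kernel)
  have hF : col n N s2 2 = heavy G (s.arr 5 1) (s.arr 5 2) := by
    rw [o2]
    ext v
    simp [mem_opSet, heavy, v.2.ne]
  obtain ⟨-, -, n3⟩ := countCmd_spec (s := (const 23 2).run s2) (G := G) (c2.toCtx.run (by decide +kernel))
  have e23 : ((const 23 2).run s2).reg 23 = 2 := by simp [run]
  have e31 : ((const 23 2).run s2).reg 31 = s.arr 5 0 := by
    rw [run_reg_of_notMem _ _ (by decide +kernel), hs2, run_reg_of_notMem _ _ (by decide +kernel), a31]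
  have ec : col n N ((const 23 2).run s2) 2 = heavy G (s.arr 5 1) (s.arr 5 2) := hF
  rw [e23, e31, ec] at n3
  have hrun : initCmd.run s = (cp 37 74).run (countCmd.run ((const 23 2).run s2)) := rfl
  have hcol : ∀ c, col n N (initCmd.run s) c = col n N s2 c :=
    col_congr ((run_arr_of_notMem ((const 23 2 ;; countCmd) ;; cp 37 74) s2 (by decide +kernel)))
  have f : ∀ r, r ∉ ((const 23 2 ;; countCmd) ;; cp 37 74).wr → r ∉ opCmd.wr →
      (initCmd.run s).reg r = s1.reg r := fun r hr hr' =>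
    (run_reg_of_notMem ((const 23 2 ;; countCmd) ;; cp 37 74) s2 hr).trans
      (run_reg_of_notMem _ _ hr')
  refine ⟨fun c hc hc2 => ?_, ?_, ?_, ?_⟩
  · rw [hcol, o1 c hc hc2]
  · rw [hcol, hF]
  · rw [f 31 (by decide +kernel) (by decide +kernel), a31]
  · rw [hrun]
    simp [run, cp]
    exact n3
/-! ### The search, its initialization and its output -/

/-- The search: for every choice of three digits, run the greedy phase with these parameters. -/
def searchCmd : Cmd := forTo 40 41 7 ((cp 76 40 ;; decodeCmd) ;; initCmd ;; passesCmd)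

theorem searchCmd_spec {n : ℕ} {G : SimpleGraph (Fin n)} {k N m : ℕ} {s : RAMState} (hm : 1 ≤ m)
    (h : MainCtx G k N m (N ^ (6 * m + 1)) s) (h0 : col n N s 0 = univ) (h1 : col n N s 1 = ∅)
    (hrec : RecordOk G k N m s) :
    RecordOk G k N m (searchCmd.run s) ∧ ∀ g < N, ∀ Θ < N, ∀ y₁ < N,
      (heavy G Θ y₁).card ≤ k → ∃ F, GreedySet G k N m g (heavy G Θ y₁) F ∧
        ∀ θ < N, ∀ y₂ < N, ∀ y₃ < N,
          Beats G k N m (searchCmd.run s) (extend G F θ y₂ y₃) := by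
  have hlarge := h.large
  have key := forTo_induct (i := 40) (c := 41) (b := 7)
    (q := (cp 76 40 ;; decodeCmd) ;; initCmd ;; passesCmd) (s := s)
    (fun j s' => (col n N s' 0 = univ ∧ col n N s' 1 = ∅) ∧ RecordOk G k N m s' ∧
      ∀ x < j, ∀ dg : ℕ → ℕ, (∀ i < 6 * m + 1, x / N ^ i % N = dg i) →
        (heavy G (dg 1) (dg 2)).card ≤ k → ∃ F, GreedySet G k N m (dg 0) (heavy G (dg 1) (dg 2)) F ∧
          ∀ θ < N, ∀ y₂ < N, ∀ y₃ < N, Beats G k N m s' (extend G F θ y₂ y₃))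
    (by decide +kernel) (by decide +kernel)
    ⟨⟨h0, h1⟩, hrec, fun x hx => absurd hx (by omega)⟩
    (by
      intro j hj s' hi hr ha ⟨⟨i0, i1⟩, i2, i3⟩
      rw [h.reg7] at hj
      have hc : MainCtx G k N m (N ^ (6 * m + 1)) s' :=
        h.of_eq (fun r hr' => hr r (by revert r; decide +kernel)) (ha 0 (by decide +kernel))
      set s1 := (cp 76 40 ;; decodeCmd).run s' with hs1
      have c1 : MainCtx G k N m (N ^ (6 * m + 1)) s1 := hc.run (by decide)
      have d1 : ∀ i < 6 * m + 1, s1.arr 5 i = j / N ^ i % N := by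
        have := decodeCmd_spec (x := j) (s := (cp 76 40).run s') (N := N) (by omega)
          (by simp [run, cp, hc.reg2]) (by simp [run, cp, hc.reg3]) (by simp [run, cp, hc.reg4])
          (by simp [run, cp, hi]) (by simp [run, cp, hc.reg7, hj.le])
        have e5 : ((cp 76 40).run s').reg 5 = 6 * m + 1 := by simp [run, cp, hc.reg5]
        rw [e5] at this
        exact this
      have hrun : ((cp 76 40 ;; decodeCmd) ;; initCmd ;; passesCmd).run s' =
          passesCmd.run (initCmd.run s1) := by rw [run_seq, run_seq]
      rw [hrun]
      have hcol1 : ∀ c, col n N s1 c = col n N s' c :=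
        col_congr (run_arr_of_notMem _ _ (by decide))
      have f1 : s1.reg 30 = s'.reg 30 := run_reg_of_notMem _ _ (by decide)
      obtain ⟨t1, t2, t3, t7⟩ := initCmd_spec c1 (by rw [hcol1, i0]) (by rw [hcol1, i1])
      have f2 : (initCmd.run s1).reg 30 = s1.reg 30 := run_reg_of_notMem _ _ (by decide)
      have c2 : MainCtx G k N m (N ^ (6 * m + 1)) (initCmd.run s1) := c1.run (by decide)
      generalize initCmd.run s1 = s2 at t1 t2 t3 t7 f2 c2
      have hcol2 : ∀ c < N, c ≠ 2 → col n N s2 c = col n N s' c := fun c hc hc2 => by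
        rw [t1 c hc hc2, hcol1]
      have r2 : RecordOk G k N m s2 := by
        rw [RecordOk, hcol2 _ (by omega) (by omega), f2, f1]; exact i2
      have l2 : RecordLe n N m k s' s2 := by
        rw [RecordLe, hcol2 _ (by omega) (by omega), f2, f1]; exact ⟨le_rfl, id⟩
      obtain ⟨⟨p0, p1⟩, p2, p3, p4⟩ := passesCmd_spec hm c2
        (by rw [hcol2 _ (by omega) (by omega), i0]) (by rw [hcol2 _ (by omega) (by omega), i1]) r2
        (by rw [t7, t3, t2])
      rw [t2, t3] at p4
      generalize passesCmd.run s2 = s3 at p0 p1 p2 p3 p4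
      have hcol3 : ∀ c, col n N (bump 40 41 s3) c = col n N s3 c := col_congr (by rw [bump_arr])
      have h30 : (bump 40 41 s3).reg 30 = s3.reg 30 := by simp
      generalize bump 40 41 s3 = s4 at hcol3 h30
      have r4 : RecordOk G k N m s4 := by rw [RecordOk, hcol3, h30]; exact p2
      have l4 : RecordLe n N m k s3 s4 := ⟨h30.ge, by rw [hcol3]; exact id⟩
      refine ⟨⟨by rw [hcol3, p0], by rw [hcol3, p1]⟩, r4, fun x hx dg hdg hk => ?_⟩
      rcases Nat.lt_succ_iff_lt_or_eq.1 hx with hlt | rfl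
      · obtain ⟨F, hF, hB⟩ := i3 x hlt dg hdg hk
        exact ⟨F, hF, fun θ hθ y₂ hy₂ y₃ hy₃ =>
          (hB θ hθ y₂ hy₂ y₃ hy₃).mono ((l2.trans p3).trans l4)⟩
      · have e : ∀ i < 3, s1.arr 5 i = dg i := fun i hi => by
          rw [d1 i (by omega), hdg i (by omega)]
        rw [e 0 (by omega), e 1 (by omega), e 2 (by omega)] at p4
        obtain ⟨F, hF, hB⟩ := p4 hk
        exact ⟨F, hF, fun θ hθ y₂ hy₂ y₃ hy₃ => (hB θ hθ y₂ hy₂ y₃ hy₃).mono l4⟩)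
  rw [h.reg7] at key
  rw [searchCmd]
  generalize (forTo 40 41 7 ((cp 76 40 ;; decodeCmd) ;; initCmd ;; passesCmd)).run s = t at key ⊢
  obtain ⟨-, k1, k2⟩ := key
  refine ⟨k1, fun g hg Θ hΘ y₁ hy₁ hk => ?_⟩
  obtain ⟨x, hx, hd⟩ := exists_digits N (fun i => if i = 0 then g else if i = 1 then Θ else
    if i = 2 then y₁ else 0)
    (6 * m + 1) (fun i _ => by
      split_ifs
      all_goals first | assumption | omega)
  exact k2 x hx _ hd hk

/-- Make the set number `0` the set of all vertices. -/
def fillCmd : Cmd := const 67 0 ;; forTo 52 53 0 (store 2 67 2 ;; add 67 67 3)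

theorem fillCmd_spec {n : ℕ} {G : SimpleGraph (Fin n)} {N : ℕ} {s : RAMState} (h : Ctx G N s)
    (ha : ∀ j, s.arr 2 j = 0) :
    col n N (fillCmd.run s) 0 = univ ∧ ∀ c < N, c ≠ 0 → col n N (fillCmd.run s) c = ∅ := by
  have key := forTo_induct (i := 52) (c := 53) (b := 0) (q := store 2 67 2 ;; add 67 67 3)
    (s := (const 67 0).run s)
    (fun j s' => s'.reg 67 = j * N ∧ (∀ i < j, s'.arr 2 (i * N) = 1) ∧
      ∀ c < N, c ≠ 0 → ∀ i, s'.arr 2 (c + i * N) = 0)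
    (by decide) (by decide) (by simp [run, ha]) (by
      intro j hj s' hi hr ha' ⟨i1, i2, i3⟩
      have e2 : s'.reg 2 = 1 := by rw [hr 2 (by decide)]; simp [run, h.reg2]
      have e3 : s'.reg 3 = N := by rw [hr 3 (by decide)]; simp [run, h.reg3]
      refine ⟨?_, fun i hij => ?_, fun c hc hc0 i => ?_⟩
      · simp [run, i1, e3]; ring
      · simp only [run, bump_arr, RAMState.setReg_arr, RAMState.setArr_arr, i1, e2, true_and]
        split_ifs with hij'
        · rfl
        · rcases Nat.lt_succ_iff_lt_or_eq.1 hij with hlt | rfl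
          · exact i2 i hlt
          · exact absurd rfl hij'
      · simp only [run, bump_arr, RAMState.setReg_arr, RAMState.setArr_arr, i1, true_and]
        rw [if_neg, i3 c hc hc0 i]
        intro he
        exact hc0 (col_index_inj (d := 0) hc (by omega) (by rw [he, Nat.zero_add])).1)
  have e0 : ((const 67 0).run s).reg 0 = n := by simp [run, h.reg0]
  rw [e0] at key
  rw [fillCmd, run_seq]
  generalize (forTo 52 53 0 (store 2 67 2 ;; add 67 67 3)).run ((const 67 0).run s) = t at key ⊢
  refine ⟨?_, fun c hc hc0 => ?_⟩
  · ext v; simp [mem_col, key.2.1 v v.2]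
  · ext v; simp [mem_col, key.2.2 c hc hc0]

/-- Copy the set number `reg 79` to the output array. -/
def outCmd : Cmd := cp 67 79 ;; forTo 52 53 0 (load 62 2 67 ;; store 1 52 62 ;; add 67 67 3)

theorem outCmd_spec {n : ℕ} {G : SimpleGraph (Fin n)} {N : ℕ} {s : RAMState} (h : Ctx G N s) :
    dksOutput n (outCmd.run s) = col n N s (s.reg 79) := by
  have key := forTo_induct (i := 52) (c := 53) (b := 0)
    (q := load 62 2 67 ;; store 1 52 62 ;; add 67 67 3) (s := (cp 67 79).run s)
    (fun j s' => s'.reg 67 = s.reg 79 + j * N ∧ ∀ i < j, s'.arr 1 i = s.arr 2 (s.reg 79 + i * N))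
    (by decide) (by decide) (by simp [run, cp]) (by
      intro j hj s' hi hr ha' ⟨i1, i2⟩
      have e3 : s'.reg 3 = N := by rw [hr 3 (by decide)]; simp [run, h.reg3, cp]
      have ea : s'.arr 2 = s.arr 2 := by rw [ha' 2 (by decide)]; simp [run, cp]
      refine ⟨?_, fun i hij => ?_⟩
      · simp [run, i1, e3]; ring
      · simp only [run, bump_arr, RAMState.setReg_arr, RAMState.setArr_arr, RAMState.setReg_reg,
          i1, hi, true_and]
        simp only [Nat.reduceEqDiff, reduceIte, ea]
        split_ifs with hij'
        · rw [hij']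
        · exact i2 i (by omega))
  have e0 : ((cp 67 79).run s).reg 0 = n := by simp [run, h.reg0, cp]
  rw [e0] at key
  rw [outCmd, run_seq]
  generalize (forTo 52 53 0 (load 62 2 67 ;; store 1 52 62 ;; add 67 67 3)).run
    ((cp 67 79).run s) = t at key ⊢
  ext v
  rw [mem_col, dksOutput, mem_filter, key.2 v v.2]
  simp

/-- Store the constants of the program. -/
def constCmd (q p c : ℕ) : Cmd := const 10 q ;; const 11 p ;; const 12 c

/-- With `a = reg 10` and `b = reg 11`, registers `14` and `13` receive the powers `2 ^ (a * e)` and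
`2 ^ (b * e)`, where `e` is maximal with `2 ^ (a * e) ≤ n`. -/
def rootCmd : Cmd :=
  const 14 1 ;; const 13 1 ;; forTo 40 41 0 (cp 15 14 ;; forTo 42 43 10 (add 15 15 15) ;;
    sub 62 15 0 ;; ite 62 skip (cp 14 15 ;; forTo 42 43 11 (add 13 13 13)))

theorem run_ite_of_eq {i : ℕ} {p q : Cmd} {s : RAMState} (h : s.reg i = 0) :
    (ite i p q).run s = q.run s := if_pos h

theorem run_ite_of_ne {i : ℕ} {p q : Cmd} {s : RAMState} (h : s.reg i ≠ 0) :
    (ite i p q).run s = p.run s := if_neg h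

theorem double_spec (r b : ℕ) (s : RAMState) (hr : r ≠ 42) (hr' : r ≠ 43) :
    ((forTo 42 43 b (add r r r)).run s).reg r = 2 ^ s.reg b * s.reg r :=
  forTo_induct (i := 42) (c := 43) (b := b) (q := add r r r) (s := s)
    (fun j s' => s'.reg r = 2 ^ j * s.reg r) (by decide) (by simp [wr]; omega)
    (by simp [hr, hr']) (by
      intro j hj s' hi h h' hI
      simp [run, hI, hr, hr', pow_succ]; ring)

theorem rootCmd_spec {n : ℕ} {s : RAMState} (hn : 1 ≤ n) (h0 : s.reg 0 = n) (hq : 1 ≤ s.reg 10) :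
    ∃ e, 2 ^ (s.reg 10 * e) ≤ n ∧ n < 2 ^ (s.reg 10 * (e + 1)) ∧
      (rootCmd.run s).reg 13 = 2 ^ (s.reg 11 * e) := by
  set s1 := (const 13 1).run ((const 14 1).run s) with hs1
  set body : Cmd := cp 15 14 ;; forTo 42 43 10 (add 15 15 15) ;;
    sub 62 15 0 ;; ite 62 skip (cp 14 15 ;; forTo 42 43 11 (add 13 13 13)) with hbody
  have key := forTo_induct (i := 40) (c := 41) (b := 0) (q := body) (s := s1)
    (fun j s' => ∃ e, s'.reg 14 = 2 ^ (s.reg 10 * e) ∧ 2 ^ (s.reg 10 * e) ≤ n ∧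
      (n < 2 ^ (s.reg 10 * (e + 1)) ∨ j < 2 ^ (s.reg 10 * e)) ∧ s'.reg 13 = 2 ^ (s.reg 11 * e))
    (by decide) (by decide) ⟨0, by simp [hs1, run], by simpa using hn, by simp, by simp [hs1, run]⟩
    (by
      intro j hj s' hi hr ha ⟨e, i1, i2, i3, i4⟩
      have e0 : s'.reg 0 = n := by rw [hr 0 (by decide)]; simp [hs1, run, h0]
      have e10 : s'.reg 10 = s.reg 10 := by rw [hr 10 (by decide)]; simp [hs1, run]
      have e11 : s'.reg 11 = s.reg 11 := by rw [hr 11 (by decide)]; simp [hs1, run]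
      set s2 := (cp 15 14).run s' with hs2
      have g : ∀ r, r ≠ 15 → s2.reg r = s'.reg r := fun r h => by simp [hs2, run, cp, h]
      have g15 : s2.reg 15 = s'.reg 14 := by simp [hs2, run, cp]
      set s3 := (forTo 42 43 10 (add 15 15 15)).run s2 with hs3
      have d : s3.reg 15 = 2 ^ (s.reg 10 * (e + 1)) := by
        rw [hs3, double_spec 15 10 s2 (by decide) (by decide), g15, g 10 (by decide), e10, i1,
          ← pow_add]
        congr 1; ring
      have g3 : ∀ r, r ∉ [42, 43, 15] → s3.reg r = s'.reg r := fun r h => by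
        rw [hs3, run_reg_of_notMem _ _ (by simpa [wr] using h), g r (by simp at h; tauto)]
      have hrun : body.run s' =
        (ite 62 skip (cp 14 15 ;; forTo 42 43 11 (add 13 13 13))).run ((sub 62 15 0).run s3) := rfl
      rw [hrun]
      clear_value s3
      by_cases hle : 2 ^ (s.reg 10 * (e + 1)) ≤ n
      · have e62 : ((sub 62 15 0).run s3).reg 62 = 0 := by
          simp [run, d, g3 0 (by decide), e0, hle]
        have hrun2 : (ite 62 skip (cp 14 15 ;; forTo 42 43 11 (add 13 13 13))).run
            ((sub 62 15 0).run s3) = (forTo 42 43 11 (add 13 13 13)).run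
              ((cp 14 15).run ((sub 62 15 0).run s3)) := by
          rw [run_ite_of_eq e62, run_seq]
        rw [hrun2]
        set s4 := (cp 14 15).run ((sub 62 15 0).run s3) with hs4
        have f13 : s4.reg 13 = 2 ^ (s.reg 11 * e) := by
          simp [hs4, run, cp, g3 13 (by decide), i4]
        have f14 : s4.reg 14 = 2 ^ (s.reg 10 * (e + 1)) := by simp [hs4, run, cp, d]
        have f11 : s4.reg 11 = s.reg 11 := by simp [hs4, run, cp, g3 11 (by decide), e11]
        have d2 := double_spec 13 11 s4 (by decide) (by decide)
        have d3 : ((forTo 42 43 11 (add 13 13 13)).run s4).reg 14 = s4.reg 14 :=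
          run_reg_of_notMem _ _ (by decide)
        generalize (forTo 42 43 11 (add 13 13 13)).run s4 = s5 at d2 d3
        refine ⟨e + 1, by simp [d3, f14], hle, ?_, ?_⟩
        · rcases i3 with h | h
          · omega
          · right
            have h1 : 2 ^ (s.reg 10 * e) < 2 ^ (s.reg 10 * (e + 1)) :=
              Nat.pow_lt_pow_right (by omega) (by nlinarith)
            omega
        · rw [f11, f13] at d2
          simp only [bump_reg, Nat.reduceEqDiff, reduceIte, d2, ← pow_add]
          congr 1; ring
      · have e62 : ¬ ((sub 62 15 0).run s3).reg 62 = 0 := by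
          simp [run, d, g3 0 (by decide), e0]; omega
        rw [run_ite_of_ne e62]
        refine ⟨e, ?_, i2, .inl (by omega), ?_⟩
        · simp [run, skip, g3 14 (by decide), i1]
        · simp [run, skip, g3 13 (by decide), i4])
  have e0 : s1.reg 0 = n := by simp [hs1, run, h0]
  rw [e0] at key
  have hrun : rootCmd.run s = (forTo 40 41 0 body).run s1 := rfl
  rw [hrun]
  generalize (forTo 40 41 0 body).run s1 = t at key ⊢
  obtain ⟨e, -, h1, h2, h3⟩ := key
  exact ⟨e, h1, by omega, h3⟩

/-- Compute the fixed registers of the search, except the number of digit strings. -/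
def sizeCmd : Cmd :=
  (const 6 0 ;; forTo 40 41 12 (add 6 6 13)) ;;
  add 3 0 6 ;; const 62 5 ;; add 3 3 62 ;; sub 4 3 2 ;;
  add 5 6 6 ;; add 5 5 6 ;; add 77 5 5 ;; add 5 77 2 ;; const 62 3 ;; add 78 6 62 ;; add 79 78 2 ;;
  add 8 1 2

theorem sizeCmd_spec (s : RAMState) (h2 : s.reg 2 = 1) :
    let m := s.reg 12 * s.reg 13
    (sizeCmd.run s).reg 3 = s.reg 0 + m + 5 ∧ (sizeCmd.run s).reg 4 = s.reg 0 + m + 5 - 1 ∧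
    (sizeCmd.run s).reg 5 = 6 * m + 1 ∧ (sizeCmd.run s).reg 6 = m ∧
    (sizeCmd.run s).reg 8 = s.reg 1 + 1 ∧ (sizeCmd.run s).reg 77 = 6 * m ∧
    (sizeCmd.run s).reg 78 = m + 3 ∧ (sizeCmd.run s).reg 79 = m + 4 := by
  intro m
  set s1 := (const 6 0 ;; forTo 40 41 12 (add 6 6 13)).run s with hs1
  have key := forTo_induct (i := 40) (c := 41) (b := 12) (q := add 6 6 13)
    (s := (const 6 0).run s) (fun j s' => s'.reg 6 = j * s.reg 13) (by decide) (by decide)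
    (by simp [run]) (by
      intro j hj s' hi hr ha hI
      have e13 : s'.reg 13 = s.reg 13 := by rw [hr 13 (by decide)]; simp [run]
      simp [run, hI, e13]; ring)
  have e6 : s1.reg 6 = m := key.trans (by simp [run, m])
  have g : ∀ r, r ∉ [6, 40, 41] → s1.reg r = s.reg r := fun r hr => by
    rw [hs1, run_reg_of_notMem _ _ (by simp [wr] at hr ⊢; tauto)]
  have g0 := g 0 (by decide)
  have g1 := g 1 (by decide)
  have g2 := (g 2 (by decide)).trans h2
  have hrun : sizeCmd.run s = (add 3 0 6 ;; const 62 5 ;; add 3 3 62 ;; sub 4 3 2 ;;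
    add 5 6 6 ;; add 5 5 6 ;; add 77 5 5 ;; add 5 77 2 ;; const 62 3 ;; add 78 6 62 ;;
    add 79 78 2 ;; add 8 1 2).run s1 := rfl
  rw [hrun]
  clear_value s1
  refine ⟨?_, ?_, ?_, ?_, ?_, ?_, ?_, ?_⟩ <;> simp [run, e6, g0, g1, g2] <;> omega

/-- Register `7` receives the power `reg 3 ^ reg 5`. -/
def powCmd : Cmd :=
  const 7 1 ;; forTo 40 41 5 (const 62 0 ;; forTo 42 43 3 (add 62 62 7) ;; cp 7 62)

theorem powCmd_spec (s : RAMState) : (powCmd.run s).reg 7 = s.reg 3 ^ s.reg 5 := by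
  have key := forTo_induct (i := 40) (c := 41) (b := 5)
    (q := const 62 0 ;; forTo 42 43 3 (add 62 62 7) ;; cp 7 62)
    (s := (const 7 1).run s) (fun j s' => s'.reg 7 = s.reg 3 ^ j) (by decide) (by decide)
    (by simp [run]) (by
      intro j hj s' hi hr ha hI
      have e3 : s'.reg 3 = s.reg 3 := by rw [hr 3 (by decide)]; simp [run]
      have key2 := forTo_induct (i := 42) (c := 43) (b := 3) (q := add 62 62 7)
        (s := (const 62 0).run s') (fun j s'' => s''.reg 62 = j * s'.reg 7) (by decide) (by decide)
        (by simp [run]) (by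
          intro i hi s'' hi' hr' ha' hI'
          have e7 : s''.reg 7 = s'.reg 7 := by rw [hr' 7 (by decide)]; simp [run]
          simp [run, hI', e7]; ring)
      have e3' : ((const 62 0).run s').reg 3 = s.reg 3 := by simp [run, e3]
      rw [e3', hI] at key2
      rw [run_seq, run_seq]
      generalize (forTo 42 43 3 (add 62 62 7)).run ((const 62 0).run s') = t at key2
      simp [run, cp, key2, pow_succ]; ring)
  have e5 : ((const 7 1).run s).reg 5 = s.reg 5 := by simp [run]
  rw [e5] at key
  exact key

/-- What the search achieves on `(G, k)`: the output `S` is at least as dense as every completion, to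
`k` vertices, of the greedy sets for all choices of the parameters. -/
def SearchOptimal {n : ℕ} (G : SimpleGraph (Fin n)) (k N m : ℕ) (S : Finset (Fin n)) : Prop :=
  ∀ g < N, ∀ Θ < N, ∀ y₁ < N, (heavy G Θ y₁).card ≤ k →
    ∃ F, GreedySet G k N m g (heavy G Θ y₁) F ∧ ∀ θ < N, ∀ y₂ < N, ∀ y₃ < N,
      (extend G F θ y₂ y₃).card = k →
        S.card = k ∧ adjPairs G (extend G F θ y₂ y₃) ≤ adjPairs G S

theorem cost_seq (p q : Cmd) (K : ℕ) : (p ;; q).cost K = p.cost K + q.cost K := rfl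

theorem add_pow_le_mul_pow (M r E : ℕ) : (M + r + 1) ^ E ≤ (r + 1) ^ E * (M + 1) ^ E := by
  rw [← Nat.mul_pow]
  exact Nat.pow_le_pow_left (by nlinarith) _

/-- There is a program which, on a graph with `n` vertices, searches with set programs of length
`c * 2 ^ (p * e)`, where `e` is maximal with `2 ^ (q * e) ≤ n`. -/
theorem exists_search_program {q p c : ℕ} (hq : 1 ≤ q) (hc : 1 ≤ c) :
    ∃ (P : RAMProg) (C E : ℕ), ∀ (n k : ℕ) (G : SimpleGraph (Fin n)), 1 ≤ n → k ≤ n →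
      ∃ e, 2 ^ (q * e) ≤ n ∧ n < 2 ^ (q * (e + 1)) ∧
        ∀ m N, m = c * 2 ^ (p * e) → N = n + m + 5 → ∃ s t,
          (∀ ω, RAMExec ω P (dksInput G k) s t) ∧ t ≤ C * (N ^ (6 * m + 1) + 1) ^ E ∧
          SearchOptimal G k N m (dksOutput n s) := by
  obtain ⟨C, E, hCE⟩ := exists_cost_le
    (const 2 1 ;; constCmd q p c ;; rootCmd ;; sizeCmd ;; powCmd ;; fillCmd ;; searchCmd ;; outCmd)
  refine ⟨.seq (.const 2 1) (.seq (constCmd q p c).toProg (.seq rootCmd.toProg (.seq sizeCmd.toProg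
    (.seq powCmd.toProg (.seq fillCmd.toProg (.seq searchCmd.toProg outCmd.toProg)))))),
    C * (q + p + c + 1) ^ E, E, fun n k G hn hk => ?_⟩
  set s0 := (dksInput G k).setReg 2 1 with hs0
  have r0 : s0.reg 0 = n := by simp [hs0, dksInput]
  have r1 : s0.reg 1 = k := by simp [hs0, dksInput]
  have r2 : s0.reg 2 = 1 := by simp [hs0]
  have r30 : s0.reg 30 = 0 := by simp [hs0, dksInput]
  have a0 : s0.arr 0 = (dksInput G 0).arr 0 := rfl
  have a2 : ∀ j, s0.arr 2 j = 0 := fun j => by simp [hs0, dksInput]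
  have x0 : ∀ ω, RAMExec ω (.const 2 1) (dksInput G k) s0 1 := fun ω => .const ..
  clear_value s0
  -- the phases that do not touch the registers `0`, `1`, `2`, `30` and the arrays
  have keep : ∀ (p : Cmd) (s : RAMState), p.wa = [] → (∀ r ∈ [0, 1, 2, 30], r ∉ p.wr) →
      (p.run s).reg 0 = s.reg 0 ∧ (p.run s).reg 1 = s.reg 1 ∧ (p.run s).reg 2 = s.reg 2 ∧
      (p.run s).reg 30 = s.reg 30 ∧ (p.run s).arr = s.arr := fun p s h h' =>
    ⟨run_reg_of_notMem _ _ (h' _ (by simp)), run_reg_of_notMem _ _ (h' _ (by simp)),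
      run_reg_of_notMem _ _ (h' _ (by simp)), run_reg_of_notMem _ _ (h' _ (by simp)),
      funext fun a => run_arr_of_notMem _ _ (by simp [h])⟩
  have x1 := fun K => exec (constCmd q p c) K s0 rfl r2 (by simp [constCmd, bds])
  obtain ⟨k10, k11, k12, k130, k1a⟩ := keep (constCmd q p c) s0 rfl (by simp [constCmd, wr])
  have k1q : ((constCmd q p c).run s0).reg 10 = q := by simp [constCmd, run]
  have k1p : ((constCmd q p c).run s0).reg 11 = p := by simp [constCmd, run]
  have k1c : ((constCmd q p c).run s0).reg 12 = c := by simp [constCmd, run]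
  generalize (constCmd q p c).run s0 = s1 at x1 k10 k11 k12 k130 k1a k1q k1p k1c
  have x2 := fun K => exec rootCmd K s1 (by decide) (k12.trans r2)
  obtain ⟨e, h1, h2, k2e⟩ := rootCmd_spec hn (k10.trans r0) (by rw [k1q]; exact hq)
  rw [k1q] at h1 h2
  rw [k1p] at k2e
  obtain ⟨k20, k21, k22, k230, k2a⟩ := keep rootCmd s1 (by decide) (by decide)
  have k2c : (rootCmd.run s1).reg 12 = s1.reg 12 := run_reg_of_notMem _ _ (by decide)
  generalize rootCmd.run s1 = s2 at x2 k20 k21 k22 k230 k2a k2c k2e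
  rw [k10, r0] at k20
  rw [k11, r1] at k21
  rw [k12, r2] at k22
  rw [k1c] at k2c
  refine ⟨e, h1, h2, fun m N hm hN => ?_⟩
  have x3 := fun K => exec sizeCmd K s2 (by decide) k22
  have k3 := sizeCmd_spec s2 k22
  obtain ⟨k30, k31, k32, k330, k3a⟩ := keep sizeCmd s2 (by decide) (by decide)
  generalize sizeCmd.run s2 = s3 at x3 k3 k30 k31 k32 k330 k3a
  simp only [k2c, k2e, ← hm, k20, ← hN, k21] at k3
  rw [k20] at k30
  rw [k21] at k31
  rw [k22] at k32
  obtain ⟨k33, k34, k35, k36, k38, k377, k378, k379⟩ := k3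
  have x4 := fun K => exec powCmd K s3 (by decide) k32
  have k47 := powCmd_spec s3
  rw [k33, k35] at k47
  obtain ⟨k40, k41, k42, k430, k4a⟩ := keep powCmd s3 (by decide) (by decide)
  have k4 : ∀ r ∈ [3, 4, 5, 6, 8, 77, 78, 79], (powCmd.run s3).reg r = s3.reg r :=
    fun r hr => run_reg_of_notMem _ _ (by revert r; decide)
  generalize powCmd.run s3 = s4 at x4 k47 k40 k41 k42 k430 k4a k4
  have ea : s4.arr = s0.arr := by rw [k4a, k3a, k2a, k1a]
  have c4 : MainCtx G k N m (N ^ (6 * m + 1)) s4 :=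
    { reg0 := k40.trans k30
      reg2 := k42.trans k32
      reg3 := (k4 3 (by simp)).trans k33
      arr0 := by rw [ea, a0]
      reg1 := k41.trans k31
      reg4 := by rw [k4 4 (by simp), k34, hN]
      reg5 := (k4 5 (by simp)).trans k35
      reg6 := (k4 6 (by simp)).trans k36
      reg7 := k47
      reg8 := (k4 8 (by simp)).trans k38
      reg77 := (k4 77 (by simp)).trans k377
      reg78 := (k4 78 (by simp)).trans k378
      reg79 := (k4 79 (by simp)).trans k379
      large := by omega }
  have e30 : s4.reg 30 = 0 := by rw [k430, k330, k230, k130, r30]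
  have ea2 : ∀ j, s4.arr 2 j = 0 := by rw [ea]; exact a2
  have x5 := fun K => exec fillCmd K s4 (by decide) c4.reg2
  obtain ⟨f1, f2⟩ := fillCmd_spec c4.toCtx ea2
  have c5 : MainCtx G k N m (N ^ (6 * m + 1)) (fillCmd.run s4) := c4.run (by decide)
  have f30 : (fillCmd.run s4).reg 30 = s4.reg 30 := run_reg_of_notMem _ _ (by decide)
  generalize fillCmd.run s4 = s5 at x5 f1 f2 c5 f30
  have x6 := fun K => exec searchCmd K s5 (by decide +kernel) c5.reg2
  have hm1 : 1 ≤ m := by rw [hm]; exact Nat.mul_pos hc (by positivity)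
  obtain ⟨g1, g2⟩ := searchCmd_spec hm1 c5 f1 (f2 1 (by omega) (by omega))
    ⟨by rw [f30, e30, f2 _ (by omega) (by omega)]; rfl, .inr (f2 _ (by omega) (by omega))⟩
  have c6 : MainCtx G k N m (N ^ (6 * m + 1)) (searchCmd.run s5) :=
    c5.of_eq (fun r hr => run_reg_of_notMem _ _ (by revert r; decide +kernel))
      (run_arr_of_notMem _ _ (by decide +kernel))
  generalize searchCmd.run s5 = s6 at x6 g1 g2 c6
  have x7 := fun K => exec outCmd K s6 (by decide) c6.reg2
  have hout := outCmd_spec c6.toCtx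
  rw [c6.reg79] at hout
  set M := N ^ (6 * m + 1) with hM
  have hNM : N ≤ M := by
    rw [hM]; exact Nat.le_self_pow (by omega) N
  have hmM : 6 * m + 1 < M := Nat.lt_pow_self (by omega)
  obtain ⟨t1, l1, y1⟩ := x1 (M + q + p + c)
  obtain ⟨t2, l2, y2⟩ := x2 (M + q + p + c) (by
    have : ∀ b ∈ rootCmd.bds, b ∈ [0, 10, 11] ∧ b ∉ rootCmd.wr := by decide
    intro b hb
    refine ⟨?_, (this b hb).2⟩
    have := (this b hb).1
    simp only [List.mem_cons, List.not_mem_nil, or_false] at this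
    rcases this with rfl | rfl | rfl
    · rw [k10, r0]; omega
    · rw [k1q]; omega
    · rw [k1p]; omega)
  obtain ⟨t3, l3, y3⟩ := x3 (M + q + p + c) (by
    have : ∀ b ∈ sizeCmd.bds, b = 12 ∧ b ∉ sizeCmd.wr := by decide
    intro b hb
    refine ⟨?_, (this b hb).2⟩
    rw [(this b hb).1, k2c]; omega)
  obtain ⟨t4, l4, y4⟩ := x4 (M + q + p + c) (by
    have : ∀ b ∈ powCmd.bds, b ∈ [3, 5] ∧ b ∉ powCmd.wr := by decide
    intro b hb
    refine ⟨?_, (this b hb).2⟩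
    have := (this b hb).1
    simp only [List.mem_cons, List.not_mem_nil, or_false] at this
    rcases this with rfl | rfl
    · rw [k33]; omega
    · rw [k35]; omega)
  have bd : ∀ s, MainCtx G k N m M s → ∀ b ∈ [0, 5, 6, 7, 8], s.reg b ≤ M + q + p + c := by
    intro s hs b hb
    simp only [List.mem_cons, List.not_mem_nil, or_false] at hb
    rcases hb with rfl | rfl | rfl | rfl | rfl
    · rw [hs.reg0]; omega
    · rw [hs.reg5]; omega
    · rw [hs.reg6]; omega
    · rw [hs.reg7]; omega
    · rw [hs.reg8]; omega
  obtain ⟨t5, l5, y5⟩ := x5 (M + q + p + c) (by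
    have : ∀ b ∈ fillCmd.bds, b ∈ [0, 5, 6, 7, 8] ∧ b ∉ fillCmd.wr := by decide
    exact fun b hb => ⟨bd _ c4 b (this b hb).1, (this b hb).2⟩)
  obtain ⟨t6, l6, y6⟩ := x6 (M + q + p + c) (by
    have : ∀ b ∈ searchCmd.bds, b ∈ [0, 5, 6, 7, 8] ∧ b ∉ searchCmd.wr := by decide +kernel
    exact fun b hb => ⟨bd _ c5 b (this b hb).1, (this b hb).2⟩)
  obtain ⟨t7, l7, y7⟩ := x7 (M + q + p + c) (by
    have : ∀ b ∈ outCmd.bds, b ∈ [0, 5, 6, 7, 8] ∧ b ∉ outCmd.wr := by decide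
    exact fun b hb => ⟨bd _ c6 b (this b hb).1, (this b hb).2⟩)
  refine ⟨_, _, fun ω => .seq (x0 ω) (.seq (y1 ω) (.seq (y2 ω) (.seq (y3 ω) (.seq (y4 ω)
    (.seq (y5 ω) (.seq (y6 ω) (y7 ω))))))), ?_, ?_⟩
  · have hcost := hCE (M + q + p + c)
    rw [cost_seq, cost_seq, cost_seq, cost_seq, cost_seq, cost_seq, cost_seq] at hcost
    have hpow : (M + q + p + c + 1) ^ E ≤ (q + p + c + 1) ^ E * (M + 1) ^ E := by
      have := add_pow_le_mul_pow M (q + p + c) E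
      rwa [← add_assoc, ← add_assoc] at this
    have h1 : 1 ≤ (const 2 1).cost (M + q + p + c) := le_rfl
    refine ((Nat.add_le_add h1 (Nat.add_le_add l1 (Nat.add_le_add l2 (Nat.add_le_add l3
      (Nat.add_le_add l4 (Nat.add_le_add l5 (Nat.add_le_add l6 l7))))))).trans hcost).trans ?_
    calc C * (M + q + p + c + 1) ^ E
      _ ≤ C * ((q + p + c + 1) ^ E * (M + 1) ^ E) := Nat.mul_le_mul_left _ hpow
      _ = _ := by ring
  · intro g hg Θ hΘ y₁ hy₁ hk
    obtain ⟨F, hF, hB⟩ := g2 g hg Θ hΘ y₁ hy₁ hk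
    refine ⟨F, hF, fun θ hθ y₂ hy₂ y₃ hy₃ hcard => ?_⟩
    rw [hout, ← g1.1]
    exact hB θ hθ y₂ hy₂ y₃ hy₃ hcard

end Cmd

/-! ### Sets that can be built by short set programs -/

section Combinatorics

open Finset

variable {n : ℕ} {G : SimpleGraph (Fin n)}

/-- The sets in the list `l` are produced, last one first, by a set program on `F`, starting from `F`,
the empty set and the set of all vertices. -/
inductive Chain (G : SimpleGraph (Fin n)) (F : Finset (Fin n)) : List (Finset (Fin n)) → Prop
  | base : Chain G F [F, ∅, univ]
  | cons {l : List (Finset (Fin n))} {P Q R : Finset (Fin n)} {θ y x : ℕ} (hl : Chain G F l)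
      (hP : P ∈ l) (hQ : Q ∈ l) (hR : R ∈ l) (hθ : θ ≤ n) (hy : y ≤ n) (hx : x ≤ n) :
      Chain G F (opSet G F P Q R θ y x :: l)

theorem Chain.empty_mem {F : Finset (Fin n)} {l : List (Finset (Fin n))} (h : Chain G F l) :
    ∅ ∈ l := by
  induction h with
  | base => simp
  | cons _ _ _ _ _ _ _ ih => exact List.mem_cons_of_mem _ ih

theorem Chain.univ_mem {F : Finset (Fin n)} {l : List (Finset (Fin n))} (h : Chain G F l) :
    univ ∈ l := by
  induction h with
  | base => simp
  | cons _ _ _ _ _ _ _ ih => exact List.mem_cons_of_mem _ ih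

theorem Chain.exists_isRun {F : Finset (Fin n)} {l : List (Finset (Fin n))} (h : Chain G F l) :
    ∃ Z dg ℓ, l.length = ℓ + 3 ∧ Cmd.IsRun G F Z dg ℓ ∧ (∀ i < 6 * ℓ, dg i < n + ℓ + 3) ∧
      ∀ A ∈ l, ∃ c < 3 + ℓ, Z c = A := by
  induction h with
  | base =>
    refine ⟨fun i => if i = 0 then univ else if i = 1 then ∅ else F, fun _ => 0, 0, rfl, ?_, by simp,
      ?_⟩
    · exact ⟨by simp, by simp, by simp, by simp⟩
    · intro A hA
      simp only [List.mem_cons, List.not_mem_nil, or_false] at hA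
      rcases hA with rfl | rfl | rfl
      exacts [⟨2, by omega, by simp⟩, ⟨1, by omega, by simp⟩, ⟨0, by omega, by simp⟩]
  | @cons l P Q R θ y x hl hP hQ hR hθ hy hx ih =>
    obtain ⟨Z, dg, ℓ, hlen, ⟨z0, z1, z2, z3⟩, hdg, hc⟩ := ih
    obtain ⟨a, ha, rfl⟩ := hc P hP
    obtain ⟨b, hb, rfl⟩ := hc Q hQ
    obtain ⟨c, hc', rfl⟩ := hc R hR
    have hZ : ∀ i < 3 + ℓ, Function.update Z (3 + ℓ)
        (opSet G F (Z a) (Z b) (Z c) θ y x) i = Z i := fun i hi =>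
      Function.update_of_ne (by omega) _ _
    refine ⟨Function.update Z (3 + ℓ) (opSet G F (Z a) (Z b) (Z c) θ y x),
      fun i => if i < 6 * ℓ then dg i else if i = 6 * ℓ then a else if i = 6 * ℓ + 1 then b else
        if i = 6 * ℓ + 2 then c else if i = 6 * ℓ + 3 then θ else if i = 6 * ℓ + 4 then y else x,
      ℓ + 1, by simp [hlen], ⟨?_, ?_, ?_, fun j hj => ?_⟩, fun i hi => ?_, fun A hA => ?_⟩
    · rw [hZ 0 (by omega), z0]
    · rw [hZ 1 (by omega), z1]
    · rw [hZ 2 (by omega), z2]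
    · rcases Nat.lt_succ_iff_lt_or_eq.1 hj with hlt | rfl
      · have e : ∀ r < 6, 6 * j + r < 6 * ℓ := fun r hr => by omega
        have e0 : 6 * j < 6 * ℓ := by omega
        simp only [e0, e 1 (by omega), e 2 (by omega), e 3 (by omega), e 4 (by omega),
          e 5 (by omega), if_true]
        obtain ⟨w1, w2, w3, w4⟩ := z3 j hlt
        refine ⟨w1, w2, w3, ?_⟩
        rw [hZ _ (by omega), hZ _ (by omega), hZ _ (by omega), hZ _ (by omega), w4]
      · have e : ∀ r, ¬ 6 * j + r < 6 * j := fun r => by omega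
        simp only [lt_irrefl, e, if_false, if_true, Nat.add_left_cancel_iff,
          Nat.add_eq_left, Nat.reduceEqDiff]
        rw [hZ _ ha, hZ _ hb, hZ _ hc', Function.update_self]
        exact ⟨ha, hb, hc', rfl⟩
    · dsimp only
      have := hdg i
      split_ifs <;> omega
    · rcases List.mem_cons.1 hA with rfl | hA
      · exact ⟨3 + ℓ, by omega, Function.update_self ..⟩
      · obtain ⟨d, hd, rfl⟩ := hc A hA
        exact ⟨d, by omega, hZ d hd⟩

/-- A stable set cannot be enlarged by a set that a short set program builds. -/
theorem Cmd.Stable.subset {k m g a : ℕ} {F A : Finset (Fin n)} {l : List (Finset (Fin n))}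
    (hF : Cmd.Stable G k (n + m + 5) m g a F) (h : Chain G F l) (hl : l.length ≤ m + 3)
    (hA : A ∈ l) (hacc : Cmd.Acceptable G k g a (F ∪ A)) : A ⊆ F := by
  obtain ⟨Z, dg, ℓ, hlen, hrun, hdg, hc⟩ := h.exists_isRun
  obtain ⟨c, hc, rfl⟩ := hc A hA
  have := hF Z ℓ (fun i => if i < 6 * ℓ then dg i else c) (fun i _ => by
    have := hdg i
    split_ifs <;> omega) (by omega) (hrun.congr fun i hi => by simp [hi])
  rw [if_neg (by omega)] at this
  exact this hc hacc

/-! ### Counting lemmas -/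

/-- A function that grows by at most one per step takes every value in between. -/
theorem Nat.exists_eq_of_succ_le {f : ℕ → ℕ} (hf : ∀ y, f (y + 1) ≤ f y + 1) {w : ℕ}
    (h0 : f 0 ≤ w) {b : ℕ} (hb : w ≤ f b) : ∃ y ≤ b, f y = w := by
  induction b with
  | zero => exact ⟨0, le_rfl, by omega⟩
  | succ b ih =>
    by_cases h : w ≤ f b
    · obtain ⟨y, hy, e⟩ := ih h
      exact ⟨y, by omega, e⟩
    · exact ⟨b + 1, le_rfl, by have := hf b; omega⟩

theorem card_filter_lt_succ_le (p q : Fin n → Prop) [DecidablePred p] [DecidablePred q] (y : ℕ) :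
    (univ.filter fun v : Fin n => p v ∨ (q v ∧ (v : ℕ) < y + 1)).card ≤
      (univ.filter fun v : Fin n => p v ∨ (q v ∧ (v : ℕ) < y)).card + 1 := by
  by_cases hy : y < n
  · refine (card_le_card (t := insert ⟨y, hy⟩ (univ.filter fun v : Fin n =>
      p v ∨ (q v ∧ (v : ℕ) < y))) fun v hv => ?_).trans (card_insert_le _ _)
    simp only [mem_filter, mem_univ, true_and, mem_insert, Fin.ext_iff] at hv ⊢
    rcases hv with h | ⟨h, h'⟩
    · exact .inr (.inl h)
    · rcases Nat.lt_succ_iff_lt_or_eq.1 h' with h' | h'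
      · exact .inr (.inr ⟨h, h'⟩)
      · exact .inl h'
  · refine (card_le_card fun v hv => ?_).trans (Nat.le_succ _)
    simp only [mem_filter, mem_univ, true_and] at hv ⊢
    exact hv.imp_right fun h => ⟨h.1, by omega⟩

/-- A bound on the numbers of its vertices cuts a set down to any smaller size. -/
theorem exists_cut (A : Finset (Fin n)) {w : ℕ} (hw : w ≤ A.card) :
    ∃ y ≤ n, (A.filter fun v : Fin n => (v : ℕ) < y).card = w := by
  have key := Nat.exists_eq_of_succ_le (f := fun y => (univ.filter fun v : Fin n =>
    False ∨ (v ∈ A ∧ (v : ℕ) < y)).card) (card_filter_lt_succ_le _ _) (w := w) (b := n)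
    (by simp) (by simpa [filter_and, filter_mem_eq_inter] using hw)
  obtain ⟨y, hy, e⟩ := key
  refine ⟨y, hy, ?_⟩
  rw [← e]
  congr 1
  ext v
  simp

/-- A number below `2 ^ ℓ` is at most the sum of the powers of two that do not exceed it. -/
theorem le_sum_pow_two {ℓ x : ℕ} (hx : x < 2 ^ ℓ) :
    x ≤ ∑ i ∈ range ℓ, if 2 ^ i ≤ x then 2 ^ i else 0 := by
  induction ℓ with
  | zero => simp at hx; simp [hx]
  | succ ℓ ih =>
    by_cases h : x < 2 ^ ℓ
    · exact (ih h).trans (sum_le_sum_of_subset (range_subset_range.2 (Nat.le_succ _)))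
    · have : ∀ i ∈ range (ℓ + 1), (if 2 ^ i ≤ x then 2 ^ i else 0) = 2 ^ i := fun i hi => by
        rw [if_pos]
        have : 2 ^ i ≤ 2 ^ ℓ := Nat.pow_le_pow_right (by omega) (by simp at hi; omega)
        omega
      rw [sum_congr rfl this, Nat.geomSum_eq le_rfl]
      omega

/-- A sum of numbers below `2 ^ ℓ` is, up to the factor `ℓ`, given by one of the thresholds `2 ^ i`. -/
theorem exists_threshold {α : Type*} (B : Finset α) (f : α → ℕ) {ℓ : ℕ} (hℓ : 1 ≤ ℓ)
    (hf : ∀ v ∈ B, f v < 2 ^ ℓ) :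
    ∃ i < ℓ, ∑ v ∈ B, f v ≤ ℓ * (2 ^ i * (B.filter fun v => 2 ^ i ≤ f v).card) := by
  have h1 : ∑ v ∈ B, f v ≤ ∑ i ∈ range ℓ, 2 ^ i * (B.filter fun v => 2 ^ i ≤ f v).card := by
    calc ∑ v ∈ B, f v ≤ ∑ v ∈ B, ∑ i ∈ range ℓ, if 2 ^ i ≤ f v then 2 ^ i else 0 :=
          sum_le_sum fun v hv => le_sum_pow_two (hf v hv)
      _ = _ := by
        rw [sum_comm]
        refine sum_congr rfl fun i _ => ?_
        rw [← sum_filter, sum_const, smul_eq_mul, mul_comm]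
  obtain ⟨i, hi, hmax⟩ := exists_max_image (range ℓ)
    (fun i => 2 ^ i * (B.filter fun v => 2 ^ i ≤ f v).card) ⟨0, by simp; omega⟩
  refine ⟨i, by simpa using hi, h1.trans ?_⟩
  simpa using sum_le_card_nsmul _ _ _ hmax

/-! ### Degrees into sets of vertices -/

theorem degIn_mono {Q Q' : Finset (Fin n)} (h : Q ⊆ Q') (v : Fin n) : degIn G Q v ≤ degIn G Q' v := by
  classical
  exact card_le_card (filter_subset_filter _ h)

theorem degIn_le_card (Q : Finset (Fin n)) (v : Fin n) : degIn G Q v ≤ Q.card := by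
  classical
  exact card_filter_le _ _

theorem degIn_le (Q : Finset (Fin n)) (v : Fin n) : degIn G Q v ≤ n :=
  (degIn_le_card Q v).trans (by simpa using card_le_univ Q)

theorem sum_degIn_comm (A B : Finset (Fin n)) : ∑ v ∈ A, degIn G B v = ∑ u ∈ B, degIn G A u := by
  classical
  have := sum_card_bipartiteAbove_eq_sum_card_bipartiteBelow (s := A) (t := B) G.Adj
  simp only [bipartiteAbove, bipartiteBelow] at this
  simp only [degIn]
  rw [this]
  refine sum_congr rfl fun u _ => ?_
  congr 1
  ext v
  simp [G.adj_comm]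

theorem degIn_union_le (A B : Finset (Fin n)) (v : Fin n) :
    degIn G (A ∪ B) v ≤ degIn G A v + degIn G B v := by
  classical
  rw [degIn, filter_union]
  exact card_union_le _ _

theorem adjPairs_mono {A B : Finset (Fin n)} (h : A ⊆ B) : adjPairs G A ≤ adjPairs G B :=
  (sum_le_sum fun v _ => degIn_mono h v).trans (sum_le_sum_of_subset h)

theorem sum_degIn_le_adjPairs {A B C : Finset (Fin n)} (hA : A ⊆ C) (hB : B ⊆ C) :
    ∑ v ∈ A, degIn G B v ≤ adjPairs G C :=
  (sum_le_sum fun v _ => degIn_mono hB v).trans (sum_le_sum_of_subset hA)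

theorem adjPairs_union {A B : Finset (Fin n)} (h : Disjoint A B) :
    adjPairs G A + adjPairs G B ≤ adjPairs G (A ∪ B) := by
  rw [adjPairs, adjPairs, adjPairs, sum_union h]
  exact add_le_add (sum_le_sum fun v _ => degIn_mono subset_union_left v)
    (sum_le_sum fun v _ => degIn_mono subset_union_right v)

/-- An adjacent pair of vertices of `T` lies outside `F`, or one of the two is a neighbour of the other
in `F`. -/
theorem adjPairs_le_sdiff (T F : Finset (Fin n)) :
    adjPairs G T ≤ adjPairs G (T \ F) + 2 * ∑ v ∈ T, degIn G F v := by
  have h1 : ∀ v, degIn G T v ≤ degIn G (T \ F) v + degIn G F v := fun v =>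
    (degIn_mono (fun u hu => by by_cases h : u ∈ F <;> simp [hu, h]) v).trans (degIn_union_le _ _ v)
  have h2 : ∑ v ∈ T, degIn G (T \ F) v ≤ adjPairs G (T \ F) + ∑ v ∈ T, degIn G F v := by
    rw [sum_degIn_comm, adjPairs, ← sum_degIn_comm F T, sum_degIn_comm F T]
    have : ∑ v ∈ T, degIn G F v ≥ ∑ v ∈ T \ F, degIn G F v := sum_le_sum_of_subset sdiff_subset
    refine (sum_le_sum fun v _ => h1 v).trans ?_
    rw [sum_add_distrib]
    omega
  have h3 : adjPairs G T ≤ ∑ v ∈ T, (degIn G (T \ F) v + degIn G F v) := sum_le_sum fun v _ => h1 v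
  rw [sum_add_distrib] at h3
  omega

/-- A set of large average degree contains a set of large minimum degree. -/
theorem exists_min_degree {d : ℕ} {Q : Finset (Fin n)} (h : 2 * d * Q.card < adjPairs G Q) :
    ∃ T ⊆ Q, T.Nonempty ∧ ∀ v ∈ T, d + 1 ≤ degIn G T v := by
  classical
  induction Q using Finset.strongInduction with
  | H Q ih =>
    by_cases hQ : ∀ v ∈ Q, d + 1 ≤ degIn G Q v
    · refine ⟨Q, subset_rfl, ?_, hQ⟩
      rw [nonempty_iff_ne_empty]
      rintro rfl
      simp [adjPairs] at h
    · push Not at hQ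
      obtain ⟨v, hv, hd⟩ := hQ
      have h1 := adjPairs_le_sdiff (G := G) Q {v}
      rw [sum_degIn_comm, sum_singleton, sdiff_singleton_eq_erase] at h1
      have h2 := card_erase_of_mem hv
      have h3 : 1 ≤ Q.card := card_pos.2 ⟨v, hv⟩
      have h4 : 2 * d * (Q.erase v).card + 2 * d = 2 * d * Q.card := by
        rw [h2, ← Nat.mul_succ, Nat.succ_eq_add_one, Nat.sub_add_cancel h3]
      obtain ⟨T, hT, hT'⟩ := ih _ (erase_ssubset hv) (by omega)
      exact ⟨T, hT.trans (erase_subset _ _), hT'⟩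

/-! ### Local search and the two ways to continue a chain -/

/-- A small set outside `F` with average degree at least `g`. -/
def IsGood (G : SimpleGraph (Fin n)) (F : Finset (Fin n)) (k g : ℕ) (X : Finset (Fin n)) : Prop :=
  Disjoint X F ∧ X.Nonempty ∧ 2 * X.card ≤ k ∧ g * X.card ≤ adjPairs G X

/-- If many vertices have many neighbours in `S`, then two set operations find a good set: some of
these vertices, together with those vertices of `S` that see many of them. -/
theorem exists_isGood {F S W : Finset (Fin n)} {k g ℓ b : ℕ} {l : List (Finset (Fin n))} (hk : 4 ≤ k)
    (hn : n < 2 ^ ℓ) (hg : 1 ≤ g) (hl : Chain G F l) (hS : S ∈ l) (hSF : Disjoint S F)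
    (hW : W.Nonempty) (hWF : Disjoint W F) (hb : ∀ u ∈ W, b ≤ degIn G S u) (h1 : 2 * g * ℓ ≤ b)
    (h2 : 2 * g * ℓ * S.card ≤ b * min W.card (k / 4)) :
    ∃ l' X, Chain G F l' ∧ l'.length = l.length + 2 ∧ X ∈ l' ∧ IsGood G F k g X := by
  have hw0 := hW.card_pos
  set w := min W.card (k / 4) with hw
  have hw1 : 1 ≤ w := by omega
  have hbn : b ≤ n := by
    obtain ⟨u, hu⟩ := hW
    exact (hb u hu).trans (degIn_le _ _)
  obtain ⟨u₀, hu₀⟩ := hW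
  have hn1 : 1 ≤ n := Fin.pos u₀
  have hℓ : 1 ≤ ℓ := by
    by_contra h
    have : ℓ = 0 := by omega
    subst this
    simp at hn
    omega
  -- the first `w` vertices outside `F` with at least `b` neighbours in `S`
  set B := univ.filter fun v => v ∉ F ∧ b ≤ degIn G S v with hB
  have hWB : W ⊆ B := fun u hu => by
    simp only [hB, mem_filter, mem_univ, true_and]
    exact ⟨disjoint_left.1 hWF hu, hb u hu⟩
  obtain ⟨y, hy, hyw⟩ := exists_cut B (w := w) (by have := card_le_card hWB; omega)
  set R := opSet G F univ S ∅ b y n with hR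
  have hRB : R = B.filter fun v : Fin n => (v : ℕ) < y := by
    ext v
    simp [hR, hB, mem_opSet, v.2.ne]
    tauto
  have hRcard : R.card = w := by rw [hRB]; exact hyw
  have hRF : Disjoint R F := disjoint_left.2 fun v hv => ((mem_opSet G).1 hv).1
  have hsum : b * w ≤ ∑ v ∈ S, degIn G R v := by
    rw [sum_degIn_comm, mul_comm, ← hRcard, ← smul_eq_mul]
    refine card_nsmul_le_sum _ _ _ fun v hv => ?_
    rw [hRB] at hv
    simp only [hB, mem_filter] at hv
    exact hv.1.2.2
  -- the first few vertices of `S` with at least `2 ^ i` neighbours among them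
  obtain ⟨i, -, hi⟩ := exists_threshold S (degIn G R) hℓ fun v _ => (degIn_le R v).trans_lt hn
  set A := S.filter fun v => 2 ^ i ≤ degIn G R v with hA
  have hAS : A.card ≤ S.card := card_le_card (filter_subset _ _)
  have hbw : b * w ≤ ℓ * (2 ^ i * A.card) := hsum.trans hi
  have hA0 : A.Nonempty := by
    rw [← card_pos]
    by_contra h
    have : A.card = 0 := by omega
    rw [this] at hbw
    have : 1 ≤ b := le_trans (by nlinarith) h1
    nlinarith
  have h2i : 2 ^ i ≤ n := by
    obtain ⟨v, hv⟩ := hA0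
    exact (mem_filter.1 hv).2.trans (degIn_le _ _)
  obtain ⟨z, hz, hzs⟩ := exists_cut A (w := min A.card (k / 4)) (by omega)
  set s := min A.card (k / 4) with hs
  set X := opSet G F S R R (2 ^ i) z n with hX
  have hXR : R ⊆ X := fun v hv => (mem_opSet G).2 ⟨((mem_opSet G).1 hv).1, .inr (.inr hv)⟩
  have hXA : (A.filter fun v : Fin n => (v : ℕ) < z) ⊆ X := fun v hv => by
    simp only [hA, mem_filter] at hv
    exact (mem_opSet G).2 ⟨disjoint_left.1 hSF hv.1.1, .inl ⟨hv.1.1, hv.1.2, hv.2⟩⟩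
  have hXle : X.card ≤ w + s := by
    rw [← hRcard, ← hzs]
    refine (card_le_card fun v hv => ?_).trans (card_union_le _ _)
    have := ((mem_opSet G).1 hv).2
    simp only [hA, mem_union, mem_filter]
    rcases this with h | h | h
    · exact .inr ⟨⟨h.1, h.2.1⟩, h.2.2⟩
    · exact absurd h v.2.ne
    · exact .inl h
  refine ⟨X :: R :: l, X, .cons (.cons hl hl.univ_mem hS hl.empty_mem hbn hy le_rfl)
    (List.mem_cons_of_mem _ hS) List.mem_cons_self List.mem_cons_self h2i hz le_rfl, rfl,
    List.mem_cons_self, disjoint_left.2 fun v hv => ((mem_opSet G).1 hv).1,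
    (card_pos.1 (by omega)).mono hXR, by omega, ?_⟩
  have hadj : 2 ^ i * s ≤ adjPairs G X := by
    refine le_trans ?_ (sum_degIn_le_adjPairs hXA hXR)
    rw [mul_comm, ← hzs, ← smul_eq_mul]
    refine card_nsmul_le_sum _ _ _ fun v hv => ?_
    simp only [hA, mem_filter] at hv
    exact hv.1.2
  have hgX : g * X.card ≤ g * (w + s) := Nat.mul_le_mul_left _ hXle
  have e1 : 2 * g * S.card ≤ 2 ^ i * A.card := by
    refine Nat.le_of_mul_le_mul_left (c := ℓ) ?_ hℓ
    calc ℓ * (2 * g * S.card) = 2 * g * ℓ * S.card := by ring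
      _ ≤ _ := h2.trans hbw
  refine hgX.trans (le_trans ?_ hadj)
  by_cases hc : A.card ≤ k / 4
  · have hsA : s = A.card := by omega
    have e2 : 2 * g * w ≤ 2 ^ i * A.card := by
      refine Nat.le_of_mul_le_mul_left (c := ℓ) ?_ hℓ
      calc ℓ * (2 * g * w) = 2 * g * ℓ * w := by ring
        _ ≤ b * w := Nat.mul_le_mul_right _ h1
        _ ≤ _ := hbw
    have e3 : 2 * g * A.card ≤ 2 * g * S.card := Nat.mul_le_mul_left _ hAS
    rw [hsA]
    nlinarith
  · have hsk : s = k / 4 := by omega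
    have e3 : 2 * g ≤ 2 ^ i := by
      exact Nat.le_of_mul_le_mul_right ((Nat.mul_le_mul_left _ hAS).trans e1) hA0.card_pos
    calc g * (w + s) ≤ g * (s + s) := Nat.mul_le_mul_left _ (by omega)
      _ = 2 * g * s := by ring
      _ ≤ _ := Nat.mul_le_mul_right _ e3

/-- Dyadic bucketing of the endpoints `u` of the selected edges `(v, u)`, `u ∈ Nb v`, by their degree
into `S` and by the number of selected edges at `u`. -/
theorem exists_bucket {S T Q : Finset (Fin n)} {Nb : Fin n → Finset (Fin n)} {d ℓ : ℕ} (hℓ : 1 ≤ ℓ)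
    (hn : n < 2 ^ ℓ) (hT : T ⊆ S) (hsub : ∀ v ∈ T, Nb v ⊆ Q) (hcard : ∀ v ∈ T, (Nb v).card = d)
    (hadj : ∀ v ∈ T, ∀ u ∈ Nb v, G.Adj v u) :
    ∃ a b W, W ⊆ Q ∧ (∀ u ∈ W, a ≤ (T.filter fun v => u ∈ Nb v).card) ∧
      (∀ u ∈ W, a ≤ degIn G S u) ∧ (∀ u ∈ W, b ≤ degIn G S u ∧ degIn G S u < 2 * b) ∧ d * T.card ≤ ℓ * (ℓ * (a * W.card)) := by
  classical
  set f : Fin n → ℕ := fun u => (T.filter fun v => u ∈ Nb v).card with hf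
  have hfd : ∀ u, f u ≤ degIn G S u := fun u => card_le_card fun v hv => by
    simp only [mem_filter] at hv ⊢
    exact ⟨hT hv.1, (hadj v hv.1 u hv.2).symm⟩
  have hsum : ∑ u ∈ Q, f u = d * T.card := by
    have := sum_card_bipartiteAbove_eq_sum_card_bipartiteBelow (s := T) (t := Q) fun v u => u ∈ Nb v
    simp only [bipartiteAbove, bipartiteBelow] at this
    rw [← this, mul_comm, ← smul_eq_mul]
    refine sum_const_nat fun v hv => ?_
    rw [filter_mem_eq_inter, inter_eq_right.2 (hsub v hv), hcard v hv]
  set Q' := Q.filter fun u => degIn G S u ≠ 0 with hQ'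
  have hsum' : ∑ u ∈ Q', f u = d * T.card := by
    rw [← hsum]
    refine sum_subset (filter_subset _ _) fun u hu hu' => ?_
    have : degIn G S u = 0 := by
      by_contra h
      exact hu' (mem_filter.2 ⟨hu, h⟩)
    have := hfd u
    omega
  have hlog : ∀ u ∈ Q', Nat.log 2 (degIn G S u) ∈ range ℓ := fun u hu => by
    rw [mem_range]
    exact Nat.log_lt_of_lt_pow (mem_filter.1 hu).2 ((degIn_le S u).trans_lt hn)
  obtain ⟨i, -, hmax⟩ := exists_max_image (range ℓ)
    (fun i => ∑ u ∈ Q' with Nat.log 2 (degIn G S u) = i, f u) ⟨0, by simp; omega⟩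
  set Q'' := Q'.filter fun u => Nat.log 2 (degIn G S u) = i with hQ''
  have hsum'' : d * T.card ≤ ℓ * ∑ u ∈ Q'', f u := by
    rw [← hsum', ← sum_fiberwise_of_maps_to hlog]
    simpa using sum_le_card_nsmul _ _ _ hmax
  obtain ⟨j, -, hj⟩ := exists_threshold Q'' f hℓ fun u _ =>
    ((hfd u).trans (degIn_le S u)).trans_lt hn
  refine ⟨2 ^ j, 2 ^ i, Q''.filter fun u => 2 ^ j ≤ f u, ?_, fun u hu => (mem_filter.1 hu).2,
    fun u hu => (mem_filter.1 hu).2.trans (hfd u), fun u hu => ?_, hsum''.trans (Nat.mul_le_mul_left _ hj)⟩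
  · exact (filter_subset _ _).trans ((filter_subset _ _).trans (filter_subset _ _))
  · have h1 := mem_filter.1 (mem_filter.1 hu).1
    have h2 := (mem_filter.1 h1.1).2
    rw [← h1.2, ← Nat.pow_succ']
    exact ⟨Nat.pow_log_le_self 2 h2, Nat.lt_pow_succ_log_self (by omega) _⟩

/-- Greedy covering: as long as fewer than half of the selected edges are lost, some vertex of `W`
covers an average number of new vertices. -/
theorem exists_cover {T W : Finset (Fin n)} {Nb : Fin n → Finset (Fin n)} {d e : ℕ}
    (hcard : ∀ v ∈ T, (Nb v).card = d) (he : e ≤ ∑ u ∈ W, (T.filter fun v => u ∈ Nb v).card)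
    (j : ℕ) (hj : j ≤ 1 ∨ j * d ≤ W.card) :
    ∃ U ⊆ W, U.card ≤ j ∧ j * e ≤ 2 * W.card * (T.filter fun v => ∃ u ∈ U, u ∈ Nb v).card := by
  classical
  induction j with
  | zero => exact ⟨∅, by simp, by simp, by simp⟩
  | succ j ih =>
    obtain ⟨U, hU, hUj, hUe⟩ := ih (by
      rcases hj with h | h
      · exact .inl (by omega)
      · exact .inr (le_trans (Nat.mul_le_mul_right _ (Nat.le_succ _)) h))
    set C := T.filter fun v => ∃ u ∈ U, u ∈ Nb v with hC
    by_cases hCe : 2 * (d * C.card) ≤ e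
    · rcases W.eq_empty_or_nonempty with rfl | hW
      · simp only [sum_empty, Nat.le_zero] at he
        subst he
        exact ⟨∅, by simp, by simp, by simp⟩
      -- the edges at vertices that are not yet covered
      have hlost : ∑ u ∈ W, (C.filter fun v => u ∈ Nb v).card ≤ d * C.card := by
        have := sum_card_bipartiteAbove_eq_sum_card_bipartiteBelow (s := C) (t := W)
          fun v u => u ∈ Nb v
        simp only [bipartiteAbove, bipartiteBelow] at this
        rw [← this, mul_comm, ← smul_eq_mul]
        refine sum_le_card_nsmul _ _ _ fun v hv => ?_
        rw [← hcard v (mem_filter.1 hv).1, filter_mem_eq_inter]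
        exact card_le_card inter_subset_right
      have hsplit : ∀ u, (T.filter fun v => u ∈ Nb v).card ≤
          (C.filter fun v => u ∈ Nb v).card + ((T \ C).filter fun v => u ∈ Nb v).card := fun u => by
        rw [← card_union_of_disjoint (disjoint_filter_filter disjoint_sdiff), ← filter_union,
          union_sdiff_of_subset (filter_subset _ _)]
      obtain ⟨u, hu, hmax⟩ := exists_max_image W
        (fun u => ((T \ C).filter fun v => u ∈ Nb v).card) hW
      have hnew : e ≤ 2 * (W.card * ((T \ C).filter fun v => u ∈ Nb v).card) := by
        have h1 := sum_le_card_nsmul _ _ _ hmax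
        have h2 := sum_le_sum fun u (_ : u ∈ W) => hsplit u
        rw [sum_add_distrib] at h2
        rw [smul_eq_mul] at h1
        omega
      refine ⟨insert u U, insert_subset hu hU, (card_insert_le _ _).trans (by omega), ?_⟩
      have hcov : C.card + ((T \ C).filter fun v => u ∈ Nb v).card ≤
          (T.filter fun v => ∃ x ∈ insert u U, x ∈ Nb v).card := by
        rw [← card_union_of_disjoint]
        · refine card_le_card fun v hv => ?_
          simp only [hC, mem_union, mem_filter, mem_sdiff, mem_insert, exists_eq_or_imp] at hv ⊢
          tauto
        · exact disjoint_sdiff.mono_right (filter_subset _ _)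
      calc (j + 1) * e = j * e + e := by ring
        _ ≤ 2 * W.card * C.card + 2 * (W.card * ((T \ C).filter fun v => u ∈ Nb v).card) :=
          add_le_add hUe hnew
        _ = 2 * W.card * (C.card + ((T \ C).filter fun v => u ∈ Nb v).card) := by ring
        _ ≤ _ := Nat.mul_le_mul_left _ hcov
    · refine ⟨U, hU, by omega, ?_⟩
      rcases hj with h | h
      · have : U = ∅ := by
          rw [← card_eq_zero]; omega
        subst this
        simp [hC] at hCe
      · calc (j + 1) * e ≤ (j + 1) * (2 * (d * C.card)) := Nat.mul_le_mul_left _ (by omega)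
          _ = 2 * ((j + 1) * d) * C.card := by ring
          _ ≤ 2 * W.card * C.card := Nat.mul_le_mul_right _ (by omega)

/-- Every set of vertices outside `F` can be built vertex by vertex. -/
theorem Chain.exists_mem_append {F : Finset (Fin n)} {l : List (Finset (Fin n))} (hl : Chain G F l)
    {U : Finset (Fin n)} (hU : Disjoint U F) :
    ∃ l', Chain G F l' ∧ U ∈ l' ∧ l ⊆ l' ∧ l'.length = l.length + U.card := by
  classical
  induction U using Finset.induction_on with
  | empty => exact ⟨l, hl, hl.empty_mem, List.Subset.refl _, rfl⟩
  | insert u U hu ih =>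
    rw [disjoint_insert_left] at hU
    obtain ⟨l', h1, h2, h3, h4⟩ := ih hU.2
    have : opSet G F ∅ ∅ U 0 0 u = insert u U := by
      ext v
      simp only [mem_opSet, mem_insert, notMem_empty, false_and, false_or, Fin.val_inj]
      constructor
      · exact fun h => h.2
      · rintro (rfl | h)
        · exact ⟨hU.1, .inl rfl⟩
        · exact ⟨disjoint_left.1 hU.2 h, .inr h⟩
    refine ⟨insert u U :: l', this ▸ h1.cons h1.empty_mem h1.empty_mem h2 (Nat.zero_le _)
      (Nat.zero_le _) u.2.le, List.mem_cons_self, List.subset_cons_of_subset _ h3, ?_⟩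
    rw [List.length_cons, h4, card_insert_of_notMem hu]
    omega

/-! ### The potential along a chain of sets -/

/-- A stage of the chain argument: a set `S` outside `F` that the set program `l` produces, and a
non-empty part `R` of it that lies in the dense set `T`. -/
structure IsStage (G : SimpleGraph (Fin n)) (F T : Finset (Fin n)) (l : List (Finset (Fin n)))
    (S R : Finset (Fin n)) : Prop where
  chain : Chain G F l
  mem : S ∈ l
  disjoint : Disjoint S F
  subset : R ⊆ S
  subset' : R ⊆ T
  nonempty : R.Nonempty

/-- The numerical content of one step. Unless there is a good set, the edges that leave `R` inside `T`
yield a set of `w` vertices, which either becomes the next `R`, or whose neighbourhoods cover much of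
`R` so that `S` can be replaced by the neighbourhood of a few of its vertices. -/
theorem IsStage.exists_next {F T S R : Finset (Fin n)} {Nb : Fin n → Finset (Fin n)}
    {k g ℓ d Θ M : ℕ} {l : List (Finset (Fin n))} (h : IsStage G F T l S R) (hk : 4 ≤ k)
    (hn : n < 2 ^ ℓ) (hℓ : 1 ≤ ℓ) (hg : 1 ≤ g) (hd : 1 ≤ d) (hTF : Disjoint T F) (hTk : T.card ≤ k)
    (hsub : ∀ v ∈ T, Nb v ⊆ T) (hcard : ∀ v ∈ T, (Nb v).card = d)
    (hadj : ∀ v ∈ T, ∀ u ∈ Nb v, G.Adj v u) (hΘ : ∀ v ∉ F, degIn G univ v ≤ Θ)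
    (hM : l.length + 2 ≤ M)
    (hno : ∀ l X, Chain G F l → l.length ≤ M → X ∈ l → ¬ IsGood G F k g X) :
    ∃ w a b, 1 ≤ w ∧ w ≤ k ∧ 1 ≤ a ∧ a < 2 * b ∧ d * R.card ≤ ℓ * (ℓ * (a * w)) ∧
      ((b < 16 * g * ℓ ∧ ∃ l' S' R', IsStage G F T l' S' R' ∧ l'.length = l.length + 1 ∧
        R'.card = w ∧ a * S'.card ≤ Θ * S.card) ∨
      (b * w < 16 * g * ℓ * S.card ∧ ∀ j, 1 ≤ j → j ≤ 1 ∨ j * d ≤ w → ∃ l' S' R',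
        IsStage G F T l' S' R' ∧ l'.length ≤ l.length + j + 1 ∧ S'.card ≤ 2 * b * j ∧
        j * a ≤ 2 * R'.card)) := by
  classical
  obtain ⟨hl, hS, hSF, hRS, hRT, hR⟩ := h
  obtain ⟨a, b, W, hWT, hWa, hWa', hWb, hmain⟩ := exists_bucket (G := G) hℓ hn hRS
    (fun v hv => hsub v (hRT hv)) (fun v hv => hcard v (hRT hv)) fun v hv => hadj v (hRT hv)
  have hpos : 0 < d * R.card := Nat.mul_pos hd hR.card_pos
  have haw : 0 < a * W.card := by
    by_contra h0
    have : a * W.card = 0 := by omega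
    rw [this] at hmain
    omega
  have ha : 1 ≤ a := Nat.pos_of_ne_zero fun h => by simp [h] at haw
  have hw : 1 ≤ W.card := Nat.pos_of_ne_zero fun h => by simp [h] at haw
  have hWne : W.Nonempty := card_pos.1 hw
  have hWk : W.card ≤ k := (card_le_card hWT).trans hTk
  have hWF : Disjoint W F := hTF.mono_left hWT
  have hab : a < 2 * b := by
    obtain ⟨u, hu⟩ := hWne
    exact (hWa' u hu).trans_lt (hWb u hu).2
  have hσ : 1 ≤ S.card := hR.card_pos.trans_le (card_le_card hRS)
  -- the local search fails
  have hfail : b < 2 * g * ℓ ∨ b * W.card < 16 * g * ℓ * S.card := by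
    by_contra hcon
    push Not at hcon
    obtain ⟨c1, c2⟩ := hcon
    have h8 : W.card ≤ 8 * min W.card (k / 4) := by omega
    obtain ⟨l', X, x1, x2, x3, x4⟩ := exists_isGood hk hn hg hl hS hSF hWne hWF
      (fun u hu => (hWb u hu).1) c1 (by
        have : b * W.card ≤ b * (8 * min W.card (k / 4)) := Nat.mul_le_mul_left _ h8
        nlinarith)
    exact hno l' X x1 (by omega) x3 x4
  have hgℓ : 1 ≤ g * ℓ := Nat.mul_pos hg hℓ
  refine ⟨W.card, a, b, hw, hWk, ha, hab, hmain, ?_⟩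
  by_cases hcase : S.card ≤ W.card
  · -- the vertices with `a` neighbours in `S`, of which there are few as all degrees are at most `Θ`
    refine .inl ⟨?_, opSet G F univ S ∅ a n n :: l, opSet G F univ S ∅ a n n, W,
      ⟨.cons hl hl.univ_mem hS hl.empty_mem ?_ le_rfl le_rfl, List.mem_cons_self,
        disjoint_left.2 fun v hv => ((mem_opSet G).1 hv).1, fun u hu => ?_, hWT, hWne⟩, rfl, rfl, ?_⟩
    · rcases hfail with h | h
      · nlinarith
      · by_contra hb
        have h1 : 16 * g * ℓ * S.card ≤ b * S.card := Nat.mul_le_mul_right _ (by omega)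
        have h2 : b * S.card ≤ b * W.card := Nat.mul_le_mul_left _ hcase
        omega
    · obtain ⟨u, hu⟩ := hWne
      exact (hWa' u hu).trans (degIn_le _ _)
    · exact (mem_opSet G).2 ⟨disjoint_left.1 hWF hu, .inl ⟨mem_univ _, hWa' u hu, u.2⟩⟩
    · set S' := opSet G F univ S ∅ a n n with hS'
      calc a * S'.card ≤ ∑ v ∈ S', degIn G S v := by
            rw [mul_comm, ← smul_eq_mul]
            refine card_nsmul_le_sum _ _ _ fun v hv => ?_
            have := ((mem_opSet G).1 hv).2
            simp only [mem_univ, true_and, notMem_empty, or_false] at this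
            rcases this with h | h
            · exact h.1
            · exact absurd h v.2.ne
        _ = ∑ u ∈ S, degIn G S' u := sum_degIn_comm _ _
        _ ≤ ∑ _u ∈ S, Θ := sum_le_sum fun u hu =>
            (degIn_mono (subset_univ _) u).trans (hΘ u (disjoint_left.1 hSF hu))
        _ = Θ * S.card := by rw [sum_const, smul_eq_mul, mul_comm]
  · -- the neighbours in `S` of a few vertices of `W`
    refine .inr ⟨?_, fun j hj1 hj => ?_⟩
    · rcases hfail with h | h
      · have h1 : b * W.card ≤ 2 * g * ℓ * W.card := Nat.mul_le_mul_right _ h.le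
        have h2 : 2 * g * ℓ * W.card < 16 * g * ℓ * S.card := by nlinarith
        omega
      · exact h
    · obtain ⟨U, hUW, hUj, hcov⟩ := exists_cover (T := R) (W := W) (e := a * W.card)
        (fun v hv => hcard v (hRT hv)) (by
          rw [mul_comm, ← smul_eq_mul]
          exact card_nsmul_le_sum _ _ _ hWa) j hj
      obtain ⟨l', y1, y2, y3, y4⟩ := hl.exists_mem_append (hWF.mono_left hUW)
      have hcov' : j * a ≤ 2 * (R.filter fun v => ∃ u ∈ U, u ∈ Nb v).card := by
        refine Nat.le_of_mul_le_mul_right (c := W.card) ?_ hw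
        calc j * a * W.card = j * (a * W.card) := by ring
          _ ≤ _ := hcov
          _ = _ := by ring
      refine ⟨opSet G F S U ∅ 1 n n :: l', opSet G F S U ∅ 1 n n,
        R.filter fun v => ∃ u ∈ U, u ∈ Nb v,
        ⟨.cons y1 (y3 hS) y2 y1.empty_mem (Fin.pos hR.choose) le_rfl le_rfl, List.mem_cons_self,
          disjoint_left.2 fun v hv => ((mem_opSet G).1 hv).1, fun v hv => ?_,
          (filter_subset _ _).trans hRT, ?_⟩, ?_, ?_, hcov'⟩
      · obtain ⟨hv, u, hu, huv⟩ := mem_filter.1 hv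
        refine (mem_opSet G).2 ⟨disjoint_left.1 hSF (hRS hv), .inl ⟨hRS hv, ?_, v.2⟩⟩
        exact card_pos.2 ⟨u, mem_filter.2 ⟨hu, hadj v (hRT hv) u huv⟩⟩
      · rw [← card_pos]
        have : 1 ≤ j * a := Nat.mul_pos hj1 ha
        omega
      · rw [List.length_cons, y4]; omega
      · set S' := opSet G F S U ∅ 1 n n with hS'
        have hmem : ∀ v ∈ S', v ∈ S ∧ 1 ≤ degIn G U v := fun v hv => by
          have := ((mem_opSet G).1 hv).2
          simp only [notMem_empty, or_false] at this
          rcases this with h | h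
          · exact ⟨h.1, h.2.1⟩
          · exact absurd h v.2.ne
        calc S'.card ≤ ∑ v ∈ S', degIn G U v := by
              rw [card_eq_sum_ones]
              exact sum_le_sum fun v hv => (hmem v hv).2
          _ ≤ ∑ v ∈ S, degIn G U v := sum_le_sum_of_subset fun v hv => (hmem v hv).1
          _ = ∑ u ∈ U, degIn G S u := sum_degIn_comm _ _
          _ ≤ U.card • (2 * b) := sum_le_card_nsmul _ _ _ fun u hu => (hWb u (hUW hu)).2.le
          _ ≤ 2 * b * j := by
            rw [smul_eq_mul, mul_comm]
            exact Nat.mul_le_mul_left _ hUj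

/-- The quantity that grows along the chain. -/
noncomputable def potential (r : ℝ) (S R : Finset (Fin n)) : ℝ :=
  Real.log R.card - r * Real.log S.card

/-- One step increases the potential by `K`. -/
theorem IsStage.exists_potential_le {F T S R : Finset (Fin n)} {Nb : Fin n → Finset (Fin n)}
    {k g ℓ d Θ M L : ℕ} {r K : ℝ} {l : List (Finset (Fin n))} (h : IsStage G F T l S R) (hk : 4 ≤ k)
    (hn : n < 2 ^ ℓ) (hℓ : 1 ≤ ℓ) (hg : 1 ≤ g) (hd : 1 ≤ d) (hL : 1 ≤ L) (hTF : Disjoint T F)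
    (hTk : T.card ≤ k) (hsub : ∀ v ∈ T, Nb v ⊆ T) (hcard : ∀ v ∈ T, (Nb v).card = d)
    (hadj : ∀ v ∈ T, ∀ u ∈ Nb v, G.Adj v u) (hΘ : ∀ v ∉ F, degIn G univ v ≤ Θ)
    (hM : l.length + 2 ≤ M)
    (hno : ∀ l X, Chain G F l → l.length ≤ M → X ∈ l → ¬ IsGood G F k g X)
    (hr0 : 0 ≤ r) (hr1 : r ≤ 1)
    (hK1 : K ≤ Real.log d - 2 * Real.log ℓ - (1 - r) * (Real.log 32 + Real.log g + Real.log ℓ) -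
      r * Real.log Θ)
    (hK2 : K ≤ Real.log d - Real.log 2 - 2 * Real.log ℓ - (1 - r) * (Real.log 2 + Real.log d) -
      r * (Real.log 32 + Real.log g + Real.log ℓ))
    (hK3 : K ≤ Real.log d - Real.log 2 - 2 * Real.log ℓ - (1 - r) * (Real.log k - Real.log L) -
      r * (Real.log 32 + Real.log g + Real.log ℓ)) :
    ∃ l' S' R', IsStage G F T l' S' R' ∧ l'.length ≤ l.length + L + 1 ∧
      potential r S R + K ≤ potential r S' R' := by
  obtain ⟨w, a, b, hw, hwk, ha, hab, hmain, hcase⟩ :=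
    h.exists_next hk hn hℓ hg hd hTF hTk hsub hcard hadj hΘ hM hno
  have hσ : 1 ≤ S.card := h.nonempty.card_pos.trans_le (card_le_card h.subset)
  have hτ : 1 ≤ R.card := h.nonempty.card_pos
  -- logarithms of products of positive integers
  have lg : ∀ {x y : ℕ}, 1 ≤ x → x ≤ y → Real.log x ≤ Real.log y := fun hx hxy =>
    Real.log_le_log (by exact_mod_cast hx) (by exact_mod_cast hxy)
  have lm : ∀ {x y : ℕ}, 1 ≤ x → 1 ≤ y → Real.log (x * y : ℕ) = Real.log x + Real.log y :=
    fun hx hy => by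
      rw [Nat.cast_mul, Real.log_mul] <;> norm_cast <;> omega
  have pm : ∀ {x y : ℕ}, 1 ≤ x → 1 ≤ y → 1 ≤ x * y := fun hx hy => Nat.mul_pos hx hy
  have e1 := lg (pm hd hτ) hmain
  rw [lm hd hτ, lm hℓ (pm hℓ (pm ha hw)), lm hℓ (pm ha hw), lm ha hw] at e1
  have hb : 1 ≤ b := by omega
  rcases hcase with ⟨hb', l', S', R', hst, hlen, hR', hS'⟩ | ⟨hbw, hj⟩
  · have hσ' : 1 ≤ S'.card := hst.nonempty.card_pos.trans_le (card_le_card hst.subset)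
    have hΘ1 : 1 ≤ Θ := Nat.pos_of_ne_zero fun h0 => by
      rw [h0, Nat.zero_mul] at hS'
      have := pm ha hσ'
      omega
    have e2 := lg (pm ha hσ') hS'
    rw [lm ha hσ', lm hΘ1 hσ] at e2
    have e3 := lg ha (show a ≤ 32 * (g * ℓ) by nlinarith)
    rw [lm (by norm_num) (pm hg hℓ), lm hg hℓ] at e3
    refine ⟨l', S', R', hst, by omega, ?_⟩
    rw [potential, potential, hR']
    have e4 := mul_le_mul_of_nonneg_left e2 hr0
    have e5 := mul_le_mul_of_nonneg_left e3 (sub_nonneg.2 hr1)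
    push_cast at e5
    nlinarith
  · -- `j` is the largest number up to `L` for which the greedy cover loses only a constant factor
    obtain ⟨j, hj1, hjL, hjd, hjw⟩ : ∃ j, 1 ≤ j ∧ j ≤ L ∧ (j ≤ 1 ∨ j * d ≤ w) ∧
        (w ≤ 2 * (d * j) ∨ w * L ≤ k * j) := by
      by_cases hwd : w < d
      · exact ⟨1, le_rfl, hL, .inl le_rfl, .inl (by omega)⟩
      · have h1 : 1 ≤ w / d := Nat.div_pos (by omega) hd
        by_cases h2 : w / d ≤ L
        · refine ⟨w / d, h1, h2, .inr (Nat.div_mul_le_self w d), .inl ?_⟩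
          have := Nat.lt_mul_div_succ w hd
          nlinarith
        · refine ⟨L, hL, le_rfl, .inr ?_, .inr (Nat.mul_le_mul_right _ hwk)⟩
          exact (Nat.mul_le_mul_right _ (by omega)).trans (Nat.div_mul_le_self w d)
    obtain ⟨l', S', R', hst, hlen, hS', hR'⟩ := hj j hj1 hjd
    have hσ' : 1 ≤ S'.card := hst.nonempty.card_pos.trans_le (card_le_card hst.subset)
    have hτ' : 1 ≤ R'.card := hst.nonempty.card_pos
    refine ⟨l', S', R', hst, by omega, ?_⟩
    have e2 := lg hσ' hS'
    rw [lm (pm (by norm_num) hb) hj1, lm (by norm_num) hb] at e2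
    have e3 := lg (pm hj1 ha) hR'
    rw [lm hj1 ha, lm (by norm_num) hτ'] at e3
    have e4 := lg (pm hb hw) hbw.le
    rw [lm hb hw, lm (pm (pm (by norm_num) hg) hℓ) hσ, lm (pm (by norm_num) hg) hℓ,
      lm (by norm_num) hg] at e4
    have e5 : Real.log 32 = Real.log 2 + Real.log 16 := by
      rw [← Real.log_mul (by norm_num) (by norm_num)]; norm_num
    push_cast at e2 e3 e4
    have e6 : potential r S R + (Real.log d - Real.log 2 - 2 * Real.log ℓ -
        (1 - r) * (Real.log w - Real.log j) - r * (Real.log 32 + Real.log g + Real.log ℓ)) ≤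
        potential r S' R' := by
      rw [potential, potential, e5]
      have e7 := mul_le_mul_of_nonneg_left e2 hr0
      have e8 := mul_le_mul_of_nonneg_left e4 hr0
      nlinarith
    refine le_trans ?_ e6
    rcases hjw with hjw | hjw
    · have e7 := lg hw hjw
      rw [lm (by norm_num) (pm hd hj1), lm hd hj1] at e7
      push_cast at e7
      have e8 := mul_le_mul_of_nonneg_left
        (show Real.log w - Real.log j ≤ Real.log 2 + Real.log d by linarith) (sub_nonneg.2 hr1)
      linarith
    · have e7 := lg (pm hw hL) hjw
      rw [lm hw hL, lm (hw.trans hwk) hj1] at e7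
      have e8 := mul_le_mul_of_nonneg_left
        (show Real.log w - Real.log j ≤ Real.log k - Real.log L by linarith) (sub_nonneg.2 hr1)
      linarith

/-- A dense set `T` outside `F` allows a short set program to find a good set: otherwise the potential,
which is at most `log n` in absolute value, would grow forever. -/
theorem exists_isGood_of_min_degree {F T : Finset (Fin n)} {k g ℓ d Θ L J : ℕ} {r K : ℝ} (hk : 4 ≤ k)
    (hn : n < 2 ^ ℓ) (hℓ : 1 ≤ ℓ) (hg : 1 ≤ g) (hd : 1 ≤ d) (hL : 1 ≤ L) (hTF : Disjoint T F)
    (hT : T.Nonempty) (hTk : T.card ≤ k) (hTd : ∀ v ∈ T, d ≤ degIn G T v)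
    (hΘ : ∀ v ∉ F, degIn G univ v ≤ Θ) (hr0 : 0 ≤ r) (hr1 : r ≤ 1)
    (hK1 : K ≤ Real.log d - 2 * Real.log ℓ - (1 - r) * (Real.log 32 + Real.log g + Real.log ℓ) -
      r * Real.log Θ)
    (hK2 : K ≤ Real.log d - Real.log 2 - 2 * Real.log ℓ - (1 - r) * (Real.log 2 + Real.log d) -
      r * (Real.log 32 + Real.log g + Real.log ℓ))
    (hK3 : K ≤ Real.log d - Real.log 2 - 2 * Real.log ℓ - (1 - r) * (Real.log k - Real.log L) -
      r * (Real.log 32 + Real.log g + Real.log ℓ))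
    (hJ : 2 * Real.log n < J * K) :
    ∃ l X, Chain G F l ∧ l.length ≤ J * (L + 1) + 6 ∧ X ∈ l ∧ IsGood G F k g X := by
  classical
  by_contra hcon
  have hno : ∀ l X, Chain G F l → l.length ≤ J * (L + 1) + 6 → X ∈ l → ¬ IsGood G F k g X :=
    fun l X h1 h2 h3 h4 => hcon ⟨l, X, h1, h2, h3, h4⟩
  -- select `d` edges at each vertex of `T`
  have hNb : ∀ v : Fin n, ∃ N : Finset (Fin n), v ∈ T → N ⊆ T ∧ N.card = d ∧ ∀ u ∈ N, G.Adj v u := by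
    intro v
    by_cases hv : v ∈ T
    · obtain ⟨N, hN, hN'⟩ := exists_subset_card_eq (hTd v hv)
      exact ⟨N, fun _ => ⟨hN.trans (filter_subset _ _), hN', fun u hu => (mem_filter.1 (hN hu)).2⟩⟩
    · exact ⟨∅, fun h => absurd h hv⟩
  choose Nb hNb using hNb
  have key : ∀ i ≤ J, ∃ l S R, IsStage G F T l S R ∧ l.length ≤ i * (L + 1) + 4 ∧
      -Real.log n + i * K ≤ potential r S R := by
    intro i hi
    induction i with
    | zero =>
      refine ⟨[opSet G F univ ∅ ∅ 0 n n, F, ∅, univ], _, T, ⟨.cons .base (by simp) (by simp) (by simp)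
        (Nat.zero_le _) le_rfl le_rfl, List.mem_cons_self,
        disjoint_left.2 fun v hv => ((mem_opSet G).1 hv).1, fun v hv => ?_, subset_rfl, hT⟩,
        by simp, ?_⟩
      · exact (mem_opSet G).2 ⟨disjoint_left.1 hTF hv, .inl ⟨mem_univ _, Nat.zero_le _, v.2⟩⟩
      · set S := opSet G F univ ∅ ∅ 0 n n
        have h1 : 0 ≤ Real.log (T.card : ℝ) := Real.log_natCast_nonneg _
        have h2 : Real.log (S.card : ℝ) ≤ Real.log n := by
          rcases S.eq_empty_or_nonempty with h0 | h0
          · rw [h0]; simpa using Real.log_natCast_nonneg n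
          · refine Real.log_le_log (by exact_mod_cast h0.card_pos) ?_
            have := card_le_univ S
            rw [Fintype.card_fin] at this
            exact_mod_cast this
        have h3 : 0 ≤ Real.log (S.card : ℝ) := Real.log_natCast_nonneg _
        rw [potential]
        push_cast
        nlinarith
    | succ i ih =>
      obtain ⟨l, S, R, hst, hlen, hpot⟩ := ih (by omega)
      have hiJ : i * (L + 1) ≤ J * (L + 1) := Nat.mul_le_mul_right _ (by omega)
      obtain ⟨l', S', R', hst', hlen', hpot'⟩ := hst.exists_potential_le (Nb := Nb) hk hn hℓ hg hd hL hTF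
        hTk (fun v hv => (hNb v hv).1) (fun v hv => (hNb v hv).2.1) (fun v hv => (hNb v hv).2.2) hΘ
        (M := J * (L + 1) + 6) (by omega) hno hr0 hr1 hK1 hK2 hK3
      refine ⟨l', S', R', hst', ?_, ?_⟩
      · rw [Nat.succ_mul]; omega
      · push_cast
        linarith
  obtain ⟨l, S, R, hst, -, hpot⟩ := key J le_rfl
  have h1 : Real.log (R.card : ℝ) ≤ Real.log n := by
    refine Real.log_le_log (by exact_mod_cast hst.nonempty.card_pos) ?_
    have := card_le_univ R
    rw [Fintype.card_fin] at this
    exact_mod_cast this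
  have h2 : 0 ≤ Real.log (S.card : ℝ) := Real.log_natCast_nonneg _
  rw [potential] at hpot
  nlinarith

/-! ### The output of the search is dense -/

/-- A small set `F` has an extension to `k` vertices that contains many of the vertices with at least
`θ` neighbours in `F`. -/
theorem exists_extend {F : Finset (Fin n)} {k : ℕ} (θ : ℕ) (hF : F.card ≤ k) (hk : k ≤ n) :
    ∃ y₂ ≤ n, ∃ y₃ ≤ n, (Cmd.extend G F θ y₂ y₃).card = k ∧
      min (univ.filter fun v => θ ≤ degIn G F v).card (k - F.card) ≤
        ((Cmd.extend G F θ y₂ y₃).filter fun v => θ ≤ degIn G F v).card := by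
  classical
  have e2 : ∀ y₂, Cmd.extend G F θ y₂ 0 =
      univ.filter fun v : Fin n => v ∈ F ∨ (θ ≤ degIn G F v ∧ (v : ℕ) < y₂) := fun y₂ => by
    simp [Cmd.extend]
  have e3 : ∀ y₃, Cmd.extend G F θ n y₃ =
      univ.filter fun v : Fin n => (v ∈ F ∨ θ ≤ degIn G F v) ∨ (True ∧ (v : ℕ) < y₃) := fun y₃ => by
    ext v
    simp [Cmd.extend, or_assoc]
  by_cases hc : k ≤ (Cmd.extend G F θ n 0).card
  · obtain ⟨y₂, hy, h⟩ := Nat.exists_eq_of_succ_le (f := fun y => (Cmd.extend G F θ y 0).card)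
      (w := k) (b := n) (fun y => by
        simp only [e2]
        exact card_filter_lt_succ_le _ _ y) (by simpa [e2] using hF) hc
    refine ⟨y₂, hy, 0, Nat.zero_le _, h, ?_⟩
    refine (min_le_right _ _).trans ?_
    have h' : (Cmd.extend G F θ y₂ 0).card = k := h
    have hsub : Cmd.extend G F θ y₂ 0 ⊆
        F ∪ (Cmd.extend G F θ y₂ 0).filter fun v => θ ≤ degIn G F v := fun v hv => by
      rw [e2, mem_filter] at hv
      rw [mem_union, mem_filter, e2, mem_filter]
      tauto
    have := (card_le_card hsub).trans (card_union_le _ _)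
    omega
  · obtain ⟨y₃, hy, h⟩ := Nat.exists_eq_of_succ_le (f := fun y => (Cmd.extend G F θ n y).card)
      (w := k) (b := n) (fun y => by
        simp only [e3]
        exact card_filter_lt_succ_le _ _ y) (by omega) (by simpa [e3] using hk)
    refine ⟨n, le_rfl, y₃, hy, h, (min_le_left _ _).trans (card_le_card fun v hv => ?_)⟩
    rw [mem_filter] at hv ⊢
    rw [e3, mem_filter]
    exact ⟨⟨mem_univ _, .inl (.inr hv.2)⟩, hv.2⟩

/-- The search result beats every greedy set `F` and its extensions. -/
theorem Cmd.SearchOptimal.exists_greedySet {k N m g Θ y₁ : ℕ} {S : Finset (Fin n)}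
    (h : Cmd.SearchOptimal G k N m S) (hN : n < N) (hk : k ≤ n) (hg : g < N) (hΘ : Θ ≤ n)
    (hy₁ : y₁ ≤ n) (hcard : (Cmd.heavy G Θ y₁).card ≤ k) :
    ∃ F, Cmd.GreedySet G k N m g (Cmd.heavy G Θ y₁) F ∧ S.card = k ∧
      adjPairs G F ≤ adjPairs G S ∧ ∀ θ ≤ n,
        θ * min (univ.filter fun v => θ ≤ degIn G F v).card (k - F.card) ≤ adjPairs G S := by
  classical
  obtain ⟨F, hF, hopt⟩ := h g hg Θ (by omega) y₁ (by omega) hcard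
  have hFk : F.card ≤ k := by
    rcases hF.2.1 with h | h
    · rw [h]; exact hcard
    · exact h.1
  have hsub : ∀ θ y₂ y₃, F ⊆ Cmd.extend G F θ y₂ y₃ := fun θ y₂ y₃ v hv => by
    simp [Cmd.extend, hv]
  obtain ⟨y₂, hy₂, y₃, hy₃, he, -⟩ := exists_extend (G := G) 0 hFk hk
  obtain ⟨h1, h2⟩ := hopt 0 (by omega) y₂ (by omega) y₃ (by omega) he
  refine ⟨F, hF, h1, (adjPairs_mono (hsub _ _ _)).trans h2, fun θ hθ => ?_⟩
  obtain ⟨y₂, hy₂, y₃, hy₃, he, hmin⟩ := exists_extend (G := G) θ hFk hk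
  obtain ⟨-, h2⟩ := hopt θ (by omega) y₂ (by omega) y₃ (by omega) he
  refine ((Nat.mul_le_mul_left _ hmin).trans ?_).trans h2
  refine le_trans ?_ (sum_degIn_le_adjPairs (filter_subset (fun v => θ ≤ degIn G F v) _) (hsub θ y₂ y₃))
  rw [mul_comm, ← smul_eq_mul]
  exact card_nsmul_le_sum _ _ _ fun v hv => (mem_filter.1 hv).2

/-- A set of vertices outside `F` that can be added to `F`. -/
def IsAugmenting (G : SimpleGraph (Fin n)) (F : Finset (Fin n)) (k g : ℕ) (X : Finset (Fin n)) :
    Prop :=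
  Disjoint X F ∧ X.Nonempty ∧ F.card + X.card ≤ k ∧ g * X.card ≤ adjPairs G X

/-- The greedy sets start either with all vertices of degree more than `Θ`, or with `k / 4` vertices of
degree at least `Θ`. -/
theorem exists_heavy (G : SimpleGraph (Fin n)) (k Θ : ℕ) :
    ∃ Θ' ≤ n, ∃ y₁ ≤ n, (Cmd.heavy G Θ' y₁).card ≤ k / 4 ∧
      ((∀ v ∉ Cmd.heavy G Θ' y₁, degIn G univ v ≤ Θ) ∨
        Θ < n ∧ (Cmd.heavy G Θ' y₁).card = k / 4 ∧ ∀ v ∈ Cmd.heavy G Θ' y₁, Θ ≤ degIn G univ v) := by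
  classical
  by_cases hΘ : n ≤ Θ
  · refine ⟨0, Nat.zero_le _, 0, Nat.zero_le _, by simp [Cmd.heavy], .inl fun v _ => ?_⟩
    exact (degIn_le _ _).trans hΘ
  have hsub : ∀ y₁, Cmd.heavy G Θ y₁ =
      (univ.filter fun v => Θ ≤ degIn G univ v).filter fun v : Fin n => (v : ℕ) < y₁ := fun y₁ => by
    ext v; simp [Cmd.heavy]
  by_cases hc : k / 4 ≤ (univ.filter fun v => Θ ≤ degIn G univ v).card
  · obtain ⟨y, hy, h⟩ := exists_cut _ hc
    refine ⟨Θ, by omega, y, hy, by rw [hsub, h], .inr ⟨by omega, by rw [hsub, h], fun v hv => ?_⟩⟩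
    simp only [Cmd.heavy, mem_filter] at hv
    exact hv.2.1
  · refine ⟨Θ, by omega, n, le_rfl, ?_, .inl fun v hv => ?_⟩
    · rw [hsub]
      exact (card_filter_le _ _).trans (by omega)
    · simp only [Cmd.heavy, mem_filter, mem_univ, true_and, v.2, and_true] at hv
      omega

/-- If every small set `F` that misses half of the edges of `T` has an augmenting set, then the search
result `S` is dense: a greedy set is stable, so it is large, or it starts with many vertices of large
degree, or its neighbours contain many vertices of `T`. -/
theorem Cmd.SearchOptimal.dense {k m g ℓ Θ : ℕ} {S T : Finset (Fin n)}
    (h : Cmd.SearchOptimal G k (n + m + 5) m S) (hk1 : 1 ≤ k) (hk : k ≤ n) (hn : n < 2 ^ ℓ)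
    (hℓ : 1 ≤ ℓ) (hg : g ≤ n) (hT : T.card = k)
    (hΘ : n ≤ Θ ∨ (4 ≤ k ∧ 4 * n * ℓ * g ≤ Θ * k))
    (haug : ∀ F, 2 * F.card < k → (∀ v ∉ F, degIn G univ v ≤ Θ) → 0 < adjPairs G T →
      adjPairs G T ≤ 2 * adjPairs G (T \ F) →
      ∃ l X, Chain G F l ∧ l.length ≤ m + 3 ∧ X ∈ l ∧ IsAugmenting G F k g X) :
    S.card = k ∧ (g * k ≤ 4 * adjPairs G S ∨ adjPairs G T ≤ 8 * ℓ * adjPairs G S) := by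
  classical
  obtain ⟨Θ', hΘ', y₁, hy₁, hF₀, hcase⟩ := exists_heavy G k Θ
  obtain ⟨F, ⟨hF₀F, hacc, hstab⟩, hSk, hFS, hext⟩ := h.exists_greedySet (by omega) hk
    (by omega : g < n + m + 5) hΘ' hy₁ (by omega)
  refine ⟨hSk, ?_⟩
  set F₀ := Cmd.heavy G Θ' y₁ with hF₀def
  by_cases hFk : k ≤ 2 * F.card
  · left
    rcases hacc with hacc | ⟨-, hacc⟩
    · rw [hacc] at hFk; omega
    · have h1 : g * (4 * F₀.card) ≤ g * k := Nat.mul_le_mul_left _ (by omega)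
      have h2 : g * (2 * k) ≤ g * (4 * F.card) := Nat.mul_le_mul_left _ (by omega)
      nlinarith
  rw [not_le] at hFk
  have hcut : ∀ w ≤ k, w ≤ 2 * min w (k - F.card) := fun w hw => by omega
  have hgacc : g * F.card ≤ adjPairs G F + g * F₀.card := by
    rcases hacc with hacc | ⟨-, hacc⟩
    · rw [hacc]; omega
    · exact hacc
  by_cases hT4 : adjPairs G T ≤ 4 * ∑ v ∈ T, degIn G F v
  · -- half of the edges of `T` meet `F`
    right
    obtain ⟨i, -, hi⟩ := exists_threshold T (degIn G F) hℓ fun v _ => (degIn_le F v).trans_lt hn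
    set A := T.filter fun v => 2 ^ i ≤ degIn G F v with hA
    have hAk : A.card ≤ k := hT ▸ card_le_card (filter_subset _ _)
    rcases A.eq_empty_or_nonempty with hA0 | ⟨v, hv⟩
    · rw [hA0] at hi
      simp only [card_empty, mul_zero, Nat.le_zero] at hi
      omega
    have h2i : 2 ^ i ≤ n := (mem_filter.1 hv).2.trans (degIn_le _ _)
    have h1 := hext (2 ^ i) h2i
    have h2 : A.card ≤ (univ.filter fun v => 2 ^ i ≤ degIn G F v).card :=
      card_le_card (filter_subset_filter _ (subset_univ _))
    have h3 : A.card ≤ 2 * min (univ.filter fun v => 2 ^ i ≤ degIn G F v).card (k - F.card) := by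
      omega
    have h4 : 2 ^ i * A.card ≤ 2 * adjPairs G S := by
      calc 2 ^ i * A.card ≤ 2 ^ i * (2 * min _ (k - F.card)) := Nat.mul_le_mul_left _ h3
        _ = 2 * (2 ^ i * min _ (k - F.card)) := by ring
        _ ≤ _ := Nat.mul_le_mul_left _ h1
    calc adjPairs G T ≤ 4 * (ℓ * (2 ^ i * A.card)) := hT4.trans (Nat.mul_le_mul_left _ hi)
      _ ≤ 4 * (ℓ * (2 * adjPairs G S)) := by gcongr
      _ = _ := by ring
  have hTF := adjPairs_le_sdiff (G := G) T F
  rcases hcase with hdeg | ⟨hΘn, hF₀k, hdeg⟩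
  · -- otherwise there is an augmenting set
    exfalso
    obtain ⟨l, X, hl, hlen, hX, hXF, ⟨v, hv⟩, hXk, hXg⟩ := haug F hFk
      (fun v hv => hdeg v fun h => hv (hF₀F h)) (by omega) (by omega)
    have hsub := hstab.subset hl hlen hX ⟨?_, ?_⟩
    · exact disjoint_left.1 hXF hv (hsub hv)
    · rw [card_union_of_disjoint hXF.symm]; exact hXk
    · rw [card_union_of_disjoint hXF.symm, mul_add]
      have := adjPairs_union (G := G) hXF.symm
      omega
  · -- the greedy set starts with many vertices of large degree
    left
    obtain ⟨hk4, hΘk⟩ := hΘ.resolve_left (by omega)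
    have hsum : Θ * (k / 4) ≤ ∑ v, degIn G F v := by
      calc Θ * (k / 4) ≤ ∑ u ∈ F₀, degIn G univ u := by
            rw [mul_comm, ← hF₀k, ← smul_eq_mul]
            exact card_nsmul_le_sum _ _ _ hdeg
        _ = ∑ v, degIn G F₀ v := sum_degIn_comm _ _
        _ ≤ _ := sum_le_sum fun v _ => degIn_mono hF₀F v
    obtain ⟨i, -, hi⟩ := exists_threshold univ (degIn G F) hℓ fun v _ => (degIn_le F v).trans_lt hn
    set A := univ.filter fun v => 2 ^ i ≤ degIn G F v with hA
    have hAn : A.card ≤ n := by simpa using card_le_univ A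
    have hi' := hsum.trans hi
    have hn1 : 1 ≤ n := by omega
    rcases A.eq_empty_or_nonempty with hA0 | ⟨v, hv⟩
    · rw [hA0] at hi'
      simp only [card_empty, mul_zero, Nat.le_zero, mul_eq_zero] at hi'
      rcases hi' with h0 | h0
      · subst h0
        have : 4 * n * ℓ * g = 0 := by omega
        have hg0 : g = 0 := by
          by_contra hg0
          have : 0 < 4 * n * ℓ * g := by positivity
          omega
        simp [hg0]
      · omega
    have h2i : 2 ^ i ≤ n := (mem_filter.1 hv).2.trans (degIn_le _ _)
    have h1 := hext (2 ^ i) h2i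
    have h3 : k * A.card ≤ 2 * n * min A.card (k - F.card) := by
      rcases le_total A.card (k - F.card) with hle | hle
      · rw [min_eq_left hle]
        exact Nat.mul_le_mul_right _ (by omega)
      · rw [min_eq_right hle]
        calc k * A.card ≤ (2 * (k - F.card)) * n := Nat.mul_le_mul (by omega) hAn
          _ = _ := by ring
    have h4 : Θ * (k / 4) * k ≤ 2 * n * ℓ * adjPairs G S := by
      calc Θ * (k / 4) * k ≤ ℓ * (2 ^ i * A.card) * k := Nat.mul_le_mul_right _ hi'
        _ = ℓ * 2 ^ i * (k * A.card) := by ring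
        _ ≤ ℓ * 2 ^ i * (2 * n * min A.card (k - F.card)) := Nat.mul_le_mul_left _ h3
        _ = 2 * n * ℓ * (2 ^ i * min A.card (k - F.card)) := by ring
        _ ≤ _ := Nat.mul_le_mul_left _ h1
    have h5 : k ≤ 8 * (k / 4) := by omega
    have h6 : 4 * n * ℓ * (g * k) ≤ 4 * n * ℓ * (4 * adjPairs G S) := by
      calc 4 * n * ℓ * (g * k) = 4 * n * ℓ * g * k := by ring
        _ ≤ Θ * k * (8 * (k / 4)) := Nat.mul_le_mul hΘk h5
        _ = 8 * (Θ * (k / 4) * k) := by ring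
        _ ≤ 8 * (2 * n * ℓ * adjPairs G S) := Nat.mul_le_mul_left _ h4
        _ = _ := by ring
    exact Nat.le_of_mul_le_mul_left h6 (by positivity)

/-- The search result contains an edge if `T` does, and is nearly as dense as `T` if `T` has bounded
average degree. -/
theorem Cmd.SearchOptimal.weakly_dense {k m ℓ : ℕ} {S T : Finset (Fin n)}
    (h : Cmd.SearchOptimal G k (n + m + 5) m S) (hm : 2 ≤ m) (hk1 : 1 ≤ k) (hk : k ≤ n)
    (hn : n < 2 ^ ℓ) (hℓ : 1 ≤ ℓ) (hT : T.card = k) :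
    S.card = k ∧ (k ≤ 4 * adjPairs G S ∨ adjPairs G T ≤ 8 * ℓ * adjPairs G S) := by
  classical
  have := h.dense (g := 1) (Θ := n) hk1 hk hn hℓ (by omega) hT (.inl le_rfl)
    fun F hF _ hpos hhalf => by
      have hpos' : 0 < adjPairs G (T \ F) := by omega
      obtain ⟨v, hv, hdv⟩ : ∃ v ∈ T \ F, degIn G (T \ F) v ≠ 0 :=
        exists_ne_zero_of_sum_ne_zero (f := degIn G (T \ F)) hpos'.ne'
      obtain ⟨u, hu⟩ := card_pos.1 (Nat.pos_of_ne_zero hdv)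
      obtain ⟨hu, huv⟩ := mem_filter.1 hu
      have hvF := (mem_sdiff.1 hv).2
      have huF := (mem_sdiff.1 hu).2
      have hX2 : ({v, u} : Finset (Fin n)).card = 2 := card_pair huv.ne
      have hXF : Disjoint {v, u} F := by simp [hvF, huF]
      obtain ⟨l, h1, h2, -, h4⟩ := (Chain.base (G := G) (F := F)).exists_mem_append hXF
      have hk2 : 2 ≤ (T \ F).card := hX2 ▸ card_le_card (insert_subset hv (by simpa using hu))
      have hk3 : (T \ F).card ≤ k := hT ▸ card_le_card sdiff_subset
      refine ⟨l, {v, u}, h1, by rw [h4, hX2]; simpa using hm, h2, hXF, ⟨v, by simp⟩, by omega, ?_⟩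
      rw [one_mul, card_eq_sum_ones]
      refine sum_le_sum fun w hw => card_pos.2 ?_
      rcases mem_insert.1 hw with rfl | hw
      · exact ⟨u, by simp [huv]⟩
      · rw [mem_singleton] at hw
        subst hw
        exact ⟨v, by simp [huv.symm]⟩
  simpa using this

/-- The search result is dense if the numbers `g` and `d` fit together. -/
theorem Cmd.SearchOptimal.strongly_dense {k m g ℓ d Θ L J : ℕ} {r K : ℝ} {S T : Finset (Fin n)}
    (h : Cmd.SearchOptimal G k (n + m + 5) m S) (hm : J * (L + 1) + 3 ≤ m) (hk4 : 4 ≤ k) (hk : k ≤ n)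
    (hn : n < 2 ^ ℓ) (hℓ : 1 ≤ ℓ) (hg : 1 ≤ g) (hgn : g ≤ n) (hd : 1 ≤ d) (hL : 1 ≤ L)
    (hT : T.card = k) (hTd : 4 * k * (d - 1) < adjPairs G T) (hΘ : 4 * n * ℓ * g ≤ Θ * k)
    (hr0 : 0 ≤ r) (hr1 : r ≤ 1)
    (hK1 : K ≤ Real.log d - 2 * Real.log ℓ - (1 - r) * (Real.log 32 + Real.log g + Real.log ℓ) -
      r * Real.log Θ)
    (hK2 : K ≤ Real.log d - Real.log 2 - 2 * Real.log ℓ - (1 - r) * (Real.log 2 + Real.log d) -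
      r * (Real.log 32 + Real.log g + Real.log ℓ))
    (hK3 : K ≤ Real.log d - Real.log 2 - 2 * Real.log ℓ - (1 - r) * (Real.log k - Real.log L) -
      r * (Real.log 32 + Real.log g + Real.log ℓ))
    (hJ : 2 * Real.log n < J * K) :
    S.card = k ∧ (g * k ≤ 4 * adjPairs G S ∨ adjPairs G T ≤ 8 * ℓ * adjPairs G S) := by
  refine h.dense (by omega) hk hn hℓ hgn hT (.inr ⟨hk4, hΘ⟩) fun F hF hdeg _ hhalf => ?_
  have hTk : (T \ F).card ≤ k := hT ▸ card_le_card sdiff_subset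
  obtain ⟨T', hT', hne, hdT'⟩ := exists_min_degree (G := G) (d := d - 1) (Q := T \ F) (by
    have : 2 * (d - 1) * (T \ F).card ≤ 2 * (d - 1) * k := Nat.mul_le_mul_left _ hTk
    nlinarith)
  obtain ⟨l, X, h1, h2, h3, h4, h5, h6, h7⟩ := exists_isGood_of_min_degree (G := G) (F := F) (T := T')
    (d := d) hk4 hn hℓ hg hd hL (disjoint_sdiff_self_left.mono_left hT') hne
    ((card_le_card hT').trans hTk) (fun v hv => by have := hdT' v hv; omega) hdeg hr0 hr1 hK1 hK2 hK3 hJ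
  exact ⟨l, X, h1, by omega, h3, h4, h5, by omega, h7⟩

end Combinatorics

/-! ### Choice of the parameters -/

section Numerics

open Finset

/-- The exponents: a set program of length `n ^ μ` suffices for the approximation ratio `n ^ δ`, with a
power of `n` to spare in each of the three cases of the chain argument. -/
theorem exists_rates {ε β μ : ℝ} (hε₁ : ε < 1) (hβ₀ : 0 < β) (hβ₁ : β < 1) (hε₀ : 0 < ε)
    (hμ : β * ε / (1 - β + β * ε) < μ) :
    ∃ r δ κ : ℝ, 0 ≤ r ∧ r ≤ 1 ∧ 0 ≤ δ ∧ δ ≤ β * (1 - β) * (1 - ε) ∧ 0 < κ ∧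
      κ ≤ δ - r * (1 - β) ∧ κ ≤ r * δ ∧ κ ≤ δ - (1 - r) * (β - μ) := by
  have hβε : 0 < β * ε := mul_pos hβ₀ hε₀
  rw [div_lt_iff₀ (by linarith)] at hμ
  set D := μ * (1 - β + β * ε) - β * ε with hD
  have hD0 : 0 < D := by linarith
  have hb : 0 < β * (1 - ε) := mul_pos hβ₀ (by linarith)
  set ξ := min (D / 2) (β * (1 - ε) / 2) with hξ
  have hξ0 : 0 < ξ := lt_min (by linarith) (by linarith)
  have hξ1 : ξ ≤ D / 2 := min_le_left _ _
  have hξ2 : ξ ≤ β * (1 - ε) / 2 := min_le_right _ _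
  have hr : 0 < β * (1 - ε) - ξ := by linarith
  have hδ : 0 < (1 - β) * (β * (1 - ε) - ξ / 2) := mul_pos (by linarith) (by linarith)
  have hμ0 : 0 < μ := by
    by_contra h
    have : μ * (1 - β + β * ε) ≤ 0 := mul_nonpos_of_nonpos_of_nonneg (by linarith) (by linarith)
    linarith
  have h3 : 0 < (1 - β) * (β * (1 - ε) - ξ / 2) - (1 - (β * (1 - ε) - ξ)) * (β - μ) := by
    have e : (1 - β) * (β * (1 - ε) - ξ / 2) - (1 - (β * (1 - ε) - ξ)) * (β - μ) =
        D - ξ * ((1 - β) / 2 + β) + ξ * μ := by rw [hD]; ring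
    rw [e]
    nlinarith [mul_pos hξ0 hμ0, mul_pos hξ0 (show 0 < 1 - ((1 - β) / 2 + β) by linarith)]
  refine ⟨β * (1 - ε) - ξ, (1 - β) * (β * (1 - ε) - ξ / 2),
    min ((1 - β) * (ξ / 2)) (min ((β * (1 - ε) - ξ) * ((1 - β) * (β * (1 - ε) - ξ / 2)))
      ((1 - β) * (β * (1 - ε) - ξ / 2) - (1 - (β * (1 - ε) - ξ)) * (β - μ))),
    hr.le, by nlinarith, hδ.le, ?_, ?_, ?_, ?_, ?_⟩
  · nlinarith [mul_pos hξ0 (show 0 < 1 - β by linarith)]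
  · exact lt_min (mul_pos (by linarith) (by linarith)) (lt_min (mul_pos hr hδ) h3)
  · refine (min_le_left _ _).trans (le_of_eq ?_)
    ring
  · exact (min_le_right _ _).trans (min_le_left _ _)
  · exact (min_le_right _ _).trans (min_le_right _ _)

/-- The three numerical conditions of the chain argument follow from the relations between the
exponents, up to terms of lower order. All variables are logarithms. -/
theorem rates_spec {r δ κ β μ X ld lg lΘ lk lL lℓ l2 p : ℝ} (hr0 : 0 ≤ r) (hr1 : r ≤ 1)
    (hX : 0 ≤ X) (h2 : 0 ≤ l2) (hℓ : 0 ≤ lℓ) (hp : 0 ≤ p) (hg : 0 ≤ lg)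
    (h1 : κ ≤ δ - r * (1 - β)) (h2' : κ ≤ r * δ) (h3 : κ ≤ δ - (1 - r) * (β - μ))
    (hgd : lg ≤ ld + 2 * l2 - δ * X) (hk : lk ≤ β * X + l2) (hk' : β * X - l2 ≤ lk)
    (hΘ : lΘ ≤ 3 * l2 + X + lℓ + lg - lk) (hL : μ * X - p * l2 ≤ lL)
    (herr : 3 * lℓ + (10 + p) * l2 ≤ κ / 2 * X) :
    κ / 2 * X ≤ ld - 2 * lℓ - (1 - r) * (5 * l2 + lg + lℓ) - r * lΘ ∧
    κ / 2 * X ≤ ld - l2 - 2 * lℓ - (1 - r) * (l2 + ld) - r * (5 * l2 + lg + lℓ) ∧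
    κ / 2 * X ≤ ld - l2 - 2 * lℓ - (1 - r) * (lk - lL) - r * (5 * l2 + lg + lℓ) := by
  have hs : 0 ≤ 1 - r := by linarith
  have hpl : 0 ≤ p * l2 := mul_nonneg hp h2
  refine ⟨?_, ?_, ?_⟩
  · have e1 := mul_le_mul_of_nonneg_left (hΘ.trans (sub_le_sub_left hk' _)) hr0
    have e2 := mul_le_mul_of_nonneg_right h1 hX
    have e3 := mul_nonneg hr0 h2
    nlinarith
  · have e1 := mul_le_mul_of_nonneg_left hgd hr0
    have e2 := mul_le_mul_of_nonneg_right h2' hX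
    have e3 := mul_nonneg hs h2
    have e4 := mul_nonneg hs hℓ
    nlinarith
  · have e1 := mul_le_mul_of_nonneg_left (sub_le_sub hk hL) hs
    have e2 := mul_le_mul_of_nonneg_right h3 hX
    have e3 := mul_nonneg hs hg
    have e4 := mul_nonneg hs hℓ
    have e5 := mul_nonneg hs h2
    have e6 := mul_nonneg hr0 hpl
    nlinarith

theorem half_le_log {n : ℕ} (hn : 2 ≤ n) : 1 / 2 ≤ Real.log n := by
  have h1 := Real.log_two_gt_d9
  have h2 : Real.log 2 ≤ Real.log n := Real.log_le_log (by norm_num) (by exact_mod_cast hn)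
  linarith

theorem natLog_add_one_le {n : ℕ} (hn : 2 ≤ n) : ((Nat.log 2 n + 1 : ℕ) : ℝ) ≤ 4 * Real.log n := by
  have h1 := Real.log_two_gt_d9
  have h2 := half_le_log hn
  have h3 : (Nat.log 2 n : ℝ) * Real.log 2 ≤ Real.log n := by
    rw [← Real.log_pow]
    refine Real.log_le_log (by positivity) ?_
    exact_mod_cast Nat.pow_log_le_self 2 (by omega)
  have h4 : (0 : ℝ) ≤ Nat.log 2 n := Nat.cast_nonneg _
  push_cast
  nlinarith

/-- For large `n` the terms of lower order are negligible. -/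
theorem exists_threshold_size {κ β C : ℝ} (hκ : 0 < κ) (hβ : 0 < β) :
    ∃ n₀ : ℕ, ∀ n : ℕ, n₀ ≤ n → 3 * Real.log ((Nat.log 2 n + 1 : ℕ) : ℝ) + C ≤ κ * Real.log n ∧
      5 ≤ (n : ℝ) ^ β := by
  have h1 : ∀ᶠ x : ℝ in Filter.atTop, 3 * Real.log (4 * x) + C ≤ κ * x := by
    have hlog := (Real.isLittleO_log_id_atTop.comp_tendsto
      (Filter.tendsto_id.const_mul_atTop (show (0 : ℝ) < 4 by norm_num))).def
        (show 0 < κ / 24 by linarith)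
    filter_upwards [hlog, Filter.eventually_ge_atTop (1 : ℝ),
      Filter.eventually_ge_atTop (2 * C / κ)] with x hx hx1 hxC
    simp only [Function.comp_apply, id, Real.norm_eq_abs] at hx
    rw [abs_of_nonneg (show 0 ≤ 4 * x by linarith)] at hx
    rw [div_le_iff₀ hκ] at hxC
    have := le_abs_self (Real.log (4 * x))
    nlinarith
  have h2 := (Real.tendsto_log_atTop.comp tendsto_natCast_atTop_atTop).eventually h1
  have h3 := ((tendsto_rpow_atTop hβ).comp
    (tendsto_natCast_atTop_atTop (R := ℝ))).eventually (Filter.eventually_ge_atTop 5)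
  obtain ⟨n₀, hn₀⟩ := Filter.eventually_atTop.1
    ((h2.and h3).and (Filter.eventually_ge_atTop 2))
  refine ⟨n₀, fun n hn => ?_⟩
  obtain ⟨⟨h4, h5⟩, h6⟩ := hn₀ n hn
  refine ⟨le_trans ?_ h4, h5⟩
  have := Real.log_le_log (by positivity) (natLog_add_one_le h6)
  simp only [Function.comp_apply]
  linarith

/-- The number of steps in terms of the length `m` of the set programs. -/
theorem exists_time_bound (C E c : ℕ) (hc : 1 ≤ c) :
    ∃ A : ℝ, 0 ≤ A ∧ ∀ (n L : ℕ) (γ : ℝ), 2 ≤ n → 0 ≤ γ → L ≤ n → (L : ℝ) ≤ (n : ℝ) ^ γ →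
      ((C * ((n + c * L + 5) ^ (6 * (c * L) + 1) + 1) ^ E : ℕ) : ℝ) ≤
        (2 : ℝ) ^ (A * Real.log n * (n : ℝ) ^ γ) := by
  refine ⟨4 * C + 4 * E + 14 * E * c * (2 * c + 13), by positivity, fun n L γ hn hγ hLn hL => ?_⟩
  have hX := half_le_log hn
  set X := Real.log n with hXdef
  set Z := (n : ℝ) ^ γ with hZ
  have hn1 : (1 : ℝ) ≤ n := by exact_mod_cast (by omega : 1 ≤ n)
  have hZ1 : 1 ≤ Z := Real.one_le_rpow hn1 hγ
  have h2 := Real.log_two_gt_d9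
  have h2' := Real.log_two_lt_d9
  set N := n + c * L + 5 with hN
  have hN1 : 1 ≤ N := by omega
  have hc1 : (1 : ℝ) ≤ c := by exact_mod_cast hc
  have hlogN : Real.log N ≤ (2 * c + 13) * X := by
    have h : (N : ℝ) ≤ (c + 6) * n := by
      have h1 : N ≤ (c + 6) * n := by
        have : c * L ≤ c * n := Nat.mul_le_mul_left _ hLn
        have : (c + 6) * n = c * n + 6 * n := by ring
        omega
      exact_mod_cast h1
    have h1 := Real.log_le_log (by exact_mod_cast hN1) h
    rw [Real.log_mul (by positivity) (by positivity)] at h1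
    have h3 := Real.log_le_sub_one_of_pos (show (0 : ℝ) < c + 6 by positivity)
    nlinarith
  have hlogN0 : 0 ≤ Real.log N := Real.log_natCast_nonneg _
  have hbound : ((C * (N ^ (6 * (c * L) + 1) + 1) ^ E : ℕ) : ℝ) ≤
      ((C + 1 : ℕ) : ℝ) * (2 * (N : ℝ) ^ (6 * (c * L) + 1)) ^ E := by
    push_cast
    have h1 : (1 : ℝ) ≤ (N : ℝ) ^ (6 * (c * L) + 1) := one_le_pow₀ (by exact_mod_cast hN1)
    gcongr
    · linarith
    · linarith
  refine hbound.trans ?_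
  have hNpos : (0 : ℝ) < N := by exact_mod_cast hN1
  rw [Real.le_rpow_iff_log_le (by positivity) (by norm_num),
    Real.log_mul (by positivity) (by positivity), Real.log_pow,
    Real.log_mul (by norm_num) (by positivity), Real.log_pow]
  have hC : Real.log ((C + 1 : ℕ) : ℝ) ≤ C := by
    have := Real.log_le_sub_one_of_pos (show (0 : ℝ) < ((C + 1 : ℕ) : ℝ) by positivity)
    push_cast at this ⊢
    linarith
  have hm : ((6 * (c * L) + 1 : ℕ) : ℝ) ≤ 7 * c * Z := by
    push_cast
    nlinarith
  have h4 : ((6 * (c * L) + 1 : ℕ) : ℝ) * Real.log N ≤ 7 * c * Z * ((2 * c + 13) * X) :=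
    mul_le_mul hm hlogN hlogN0 (by positivity)
  have hXZ : 1 ≤ 2 * (X * Z) := by nlinarith
  have h5 : (E : ℝ) * (Real.log 2 + ((6 * (c * L) + 1 : ℕ) : ℝ) * Real.log N) ≤
      E * (2 * (X * Z) + 7 * c * Z * ((2 * c + 13) * X)) := by
    refine mul_le_mul_of_nonneg_left ?_ (Nat.cast_nonneg _)
    linarith
  have h6 : (C : ℝ) ≤ C * (2 * (X * Z)) := le_mul_of_one_le_right (Nat.cast_nonneg _) hXZ
  have h7 : (C * (2 * (X * Z)) : ℝ) + E * (2 * (X * Z) + 7 * c * Z * ((2 * c + 13) * X)) =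
      (4 * C + 4 * E + 14 * E * c * (2 * c + 13)) * X * Z * (1 / 2) := by ring
  have h8 : (4 * C + 4 * E + 14 * E * c * (2 * c + 13)) * X * Z * (1 / 2) ≤
      (4 * C + 4 * E + 14 * E * c * (2 * c + 13)) * X * Z * Real.log 2 :=
    mul_le_mul_of_nonneg_left (by linarith) (by positivity)
  linarith

end Numerics

/-! ### The approximation ratio and the running time -/

section Main

open Finset

variable {n : ℕ} {G : SimpleGraph (Fin n)}

theorem avgDegree_eq (S : Finset (Fin n)) : avgDegree G S = adjPairs G S / S.card := by
  simp [avgDegree, adjPairs, degIn]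

theorem adjPairs_le_mul (T : Finset (Fin n)) : adjPairs G T ≤ n * T.card := by
  rw [mul_comm, ← smul_eq_mul]
  exact sum_le_card_nsmul _ _ _ fun v _ => degIn_le T v

theorem size_bounds {β : ℝ} (hβ₀ : 0 < β) (hβ₁ : β < 1) {n k : ℕ} (hn : 2 ≤ n)
    (hk : |(k : ℝ) - (n : ℝ) ^ β| < 1) : 1 ≤ k ∧ k ≤ n := by
  have hn1 : (1 : ℝ) < n := by exact_mod_cast hn
  have h1 : 1 < (n : ℝ) ^ β := Real.one_lt_rpow hn1 hβ₀
  have h2 : (n : ℝ) ^ β < n := by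
    simpa using Real.rpow_lt_rpow_of_exponent_lt hn1 hβ₁
  rw [abs_lt] at hk
  constructor
  · have : (0 : ℝ) < k := by linarith
    exact_mod_cast this
  · have : (k : ℝ) < n + 1 := by linarith
    exact Nat.lt_succ_iff.1 (by exact_mod_cast this)

/-- If the greedy phase aims at an average degree `g` that is smaller, by the factor `n ^ δ`, than the
one of `T`, then the search result has average degree of order `g`, or nearly the one of `T`. -/
theorem Cmd.SearchOptimal.dense_of_rates {r δ κ β : ℝ} {p q J k e g : ℕ} {S T : Finset (Fin n)}
    (hS : Cmd.SearchOptimal G k (n + (2 * J + 3) * 2 ^ (p * e) + 5) ((2 * J + 3) * 2 ^ (p * e)) S)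
    (hn : 2 ≤ n) (hk : |(k : ℝ) - (n : ℝ) ^ β| < 1) (hkn : k ≤ n) (hT : T.card = k) (hq : 1 ≤ q)
    (hne : n < 2 ^ (q * (e + 1))) (hr0 : 0 ≤ r) (hr1 : r ≤ 1) (hκ : 0 < κ) (hJ : 4 / κ < J)
    (hκ1 : κ ≤ δ - r * (1 - β)) (hκ2 : κ ≤ r * δ) (hκ3 : κ ≤ δ - (1 - r) * (β - p / q))
    (herr : 3 * Real.log ((Nat.log 2 n + 1 : ℕ) : ℝ) + (10 + p) * Real.log 2 ≤ κ / 2 * Real.log n)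
    (hβ5 : 5 ≤ (n : ℝ) ^ β) (hg0 : 1 ≤ g) (hgn : g ≤ n)
    (hgT : (g : ℝ) * (n : ℝ) ^ δ * k ≤ adjPairs G T) :
    g * k ≤ 4 * adjPairs G S ∨ adjPairs G T ≤ 8 * (Nat.log 2 n + 1) * adjPairs G S := by
  set L := 2 ^ (p * e) with hL
  have hL1 : 1 ≤ L := Nat.one_le_two_pow
  set ℓ := Nat.log 2 n + 1 with hℓ
  have hℓ1 : 1 ≤ ℓ := by omega
  have hnℓ : n < 2 ^ ℓ := Nat.lt_pow_succ_log_self (by omega) n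
  have hX := half_le_log hn
  set X := Real.log n with hXdef
  have hn0 : (0 : ℝ) < n := by exact_mod_cast (by omega : 0 < n)
  have hJL : J * (L + 1) + 3 ≤ (2 * J + 3) * L := by
    have := Nat.mul_le_mul_left J hL1
    linarith
  have hJX : 2 * X < J * (κ / 2 * X) := by
    rw [div_lt_iff₀ hκ] at hJ
    nlinarith
  rw [abs_lt] at hk
  have hk4 : 4 ≤ k := by
    have : (3 : ℝ) < k := by linarith
    have : 3 < k := by exact_mod_cast this
    omega
  have hk1 : 1 ≤ k := by omega
  have hkpos : (0 : ℝ) < k := by exact_mod_cast hk1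
  have hgpos : (0 : ℝ) < g := by exact_mod_cast hg0
  have hTpos : 0 < adjPairs G T := by
    have : (0 : ℝ) < adjPairs G T := lt_of_lt_of_le (by positivity) hgT
    exact_mod_cast this
  set d := (adjPairs G T - 1) / (4 * k) + 1 with hd
  have hd1 : 1 ≤ d := Nat.le_add_left _ _
  have hTd : 4 * k * (d - 1) < adjPairs G T := by
    have := Nat.mul_div_le (adjPairs G T - 1) (4 * k)
    rw [hd, Nat.add_sub_cancel]
    omega
  have hTd' : (adjPairs G T : ℝ) ≤ 4 * k * d := by
    have h1 : adjPairs G T - 1 < 4 * k * d :=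
      Nat.lt_mul_div_succ (adjPairs G T - 1) (show 0 < 4 * k by omega)
    have h2 : adjPairs G T ≤ 4 * k * d := by omega
    exact_mod_cast h2
  set Θ := 4 * n * ℓ * g / k + 1 with hΘ
  have hΘ1 : 4 * n * ℓ * g ≤ Θ * k := by
    have := Nat.lt_mul_div_succ (4 * n * ℓ * g) hk1
    rw [mul_comm Θ]
    exact this.le
  have hΘ2 : Θ * k ≤ 8 * (n * (ℓ * g)) := by
    have h1 := Nat.div_mul_le_self (4 * n * ℓ * g) k
    have h2 : 1 ≤ ℓ * g := Nat.mul_pos hℓ1 hg0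
    rw [hΘ, Nat.add_mul, one_mul]
    nlinarith
  have hnβ : Real.log ((n : ℝ) ^ β) = β * X := Real.log_rpow (by linarith) β
  have hlk : Real.log k ≤ β * X + Real.log 2 := by
    rw [← hnβ, ← Real.log_mul (by linarith) (by norm_num)]
    exact Real.log_le_log hkpos (by linarith)
  have hlk' : β * X - Real.log 2 ≤ Real.log k := by
    rw [← hnβ, ← Real.log_div (by linarith) (by norm_num)]
    exact Real.log_le_log (by linarith) (by linarith)
  have hdpos : (0 : ℝ) < d := by exact_mod_cast hd1
  have hℓpos : (0 : ℝ) < ℓ := by exact_mod_cast hℓ1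
  have hl4 : Real.log 4 = 2 * Real.log 2 := by
    rw [show (4 : ℝ) = 2 ^ 2 by norm_num, Real.log_pow]; norm_num
  have hl8 : Real.log 8 = 3 * Real.log 2 := by
    rw [show (8 : ℝ) = 2 ^ 3 by norm_num, Real.log_pow]; norm_num
  have hl32 : Real.log 32 = 5 * Real.log 2 := by
    rw [show (32 : ℝ) = 2 ^ 5 by norm_num, Real.log_pow]; norm_num
  have hlg : Real.log g ≤ Real.log d + 2 * Real.log 2 - δ * X := by
    have h1 : (g : ℝ) * (n : ℝ) ^ δ ≤ d * 4 := by
      have : (g : ℝ) * (n : ℝ) ^ δ * k ≤ d * 4 * k := by linarith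
      exact le_of_mul_le_mul_right this hkpos
    have h2 := Real.log_le_log (by positivity) h1
    rw [Real.log_mul (by positivity) (by positivity), Real.log_rpow (by linarith),
      Real.log_mul (by positivity) (by norm_num), hl4] at h2
    linarith
  have hlΘ : Real.log Θ ≤ 3 * Real.log 2 + X + Real.log ℓ + Real.log g - Real.log k := by
    have h1 : (Θ : ℝ) * k ≤ 8 * (n * (ℓ * g)) := by exact_mod_cast hΘ2
    have hΘpos : (0 : ℝ) < Θ := by
      have : 0 < Θ := Nat.succ_pos _
      exact_mod_cast this
    have h2 := Real.log_le_log (by positivity) h1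
    rw [Real.log_mul (by positivity) (by positivity), Real.log_mul (by norm_num) (by positivity),
      Real.log_mul (by positivity) (by positivity), Real.log_mul (by positivity) (by positivity),
      hl8] at h2
    linarith
  have hlL : (p : ℝ) / q * X - p * Real.log 2 ≤ Real.log L := by
    have hqpos : (0 : ℝ) < q := by exact_mod_cast hq
    have h1 : X ≤ (q * (e + 1) : ℕ) * Real.log 2 := by
      rw [← Real.log_pow]
      exact Real.log_le_log (by linarith) (by exact_mod_cast hne.le)
    have h2 : Real.log L = (p * e : ℕ) * Real.log 2 := by
      rw [← Real.log_pow, hL]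
      norm_num
    have h3 : (p : ℝ) / q * X ≤ (p : ℝ) / q * ((q * (e + 1) : ℕ) * Real.log 2) :=
      mul_le_mul_of_nonneg_left h1 (by positivity)
    have h4 : (p : ℝ) / q * ((q * (e + 1) : ℕ) * Real.log 2) = p * (e + 1) * Real.log 2 := by
      push_cast
      field_simp
    rw [h2]
    push_cast
    linarith
  obtain ⟨hK1, hK2, hK3⟩ := rates_spec hr0 hr1 (by linarith : 0 ≤ X) (Real.log_nonneg (by norm_num))
    (Real.log_natCast_nonneg ℓ) (Nat.cast_nonneg p) (Real.log_natCast_nonneg g) hκ1 hκ2 hκ3 hlg hlk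
    hlk' hlΘ hlL herr
  rw [← hl32] at hK1 hK2 hK3
  exact (hS.strongly_dense hJL hk4 hkn hnℓ hℓ1 hg0 hgn hd1 hL1 hT hTd hΘ1 hr0 hr1 hK1 hK2 hK3 hJX).2

/-- The result of the search over long enough set programs has the desired density. The greedy phase
aims at the average degree `g`, the average degree of the optimum divided by `n ^ δ`. -/
theorem exists_ratio {ε β : ℝ} {p q : ℕ} (hε₀ : 0 < ε) (hε₁ : ε < 1) (hβ₀ : 0 < β) (hβ₁ : β < 1)
    (hq : 1 ≤ q) (hμ : β * ε / (1 - β + β * ε) < (p : ℝ) / q) :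
    ∃ c : ℕ, 1 ≤ c ∧ ∃ A : ℝ, 0 ≤ A ∧ ∀ (n k e : ℕ) (G : SimpleGraph (Fin n)) (S : Finset (Fin n)),
      2 ≤ n → |(k : ℝ) - (n : ℝ) ^ β| < 1 → n < 2 ^ (q * (e + 1)) →
      Cmd.SearchOptimal G k (n + c * 2 ^ (p * e) + 5) (c * 2 ^ (p * e)) S →
      IsDkSApprox G k (A * Real.log n * (n : ℝ) ^ (β * (1 - β) * (1 - ε))) S := by
  obtain ⟨r, δ, κ, hr0, hr1, hδ0, hδ, hκ, hκ1, hκ2, hκ3⟩ := exists_rates hε₁ hβ₀ hβ₁ hε₀ hμ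
  obtain ⟨J, hJ⟩ := exists_nat_gt (4 / κ)
  obtain ⟨n₀, hn₀⟩ := exists_threshold_size (κ := κ / 2) (C := (10 + p) * Real.log 2)
    (by linarith) hβ₀
  refine ⟨2 * J + 3, by omega, 40 + 8 * n₀, by positivity, fun n k e G S hn hk hne hS => ?_⟩
  obtain ⟨hk1, hkn⟩ := size_bounds hβ₀ hβ₁ hn hk
  set L := 2 ^ (p * e) with hL
  have hL1 : 1 ≤ L := Nat.one_le_two_pow
  set m := (2 * J + 3) * L with hm
  set ℓ := Nat.log 2 n + 1 with hℓ
  have hℓ1 : 1 ≤ ℓ := by omega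
  have hnℓ : n < 2 ^ ℓ := Nat.lt_pow_succ_log_self (by omega) n
  have hm2 : 2 ≤ m := by rw [hm]; nlinarith
  have hweak := fun T (hT : T.card = k) => hS.weakly_dense (T := T) hm2 hk1 hkn hnℓ hℓ1 hT
  have hSk : S.card = k := by
    obtain ⟨T, -, hT⟩ := exists_subset_card_eq (s := (univ : Finset (Fin n))) (n := k) (by simpa)
    exact (hweak T hT).1
  refine ⟨hSk, fun T hT => ?_⟩
  have hX := half_le_log hn
  set X := Real.log n with hXdef
  set Z := (n : ℝ) ^ (β * (1 - β) * (1 - ε)) with hZ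
  have hn1 : (1 : ℝ) ≤ n := by exact_mod_cast (by omega : 1 ≤ n)
  have hnδ1 : 1 ≤ (n : ℝ) ^ δ := Real.one_le_rpow hn1 hδ0
  have hnδZ : (n : ℝ) ^ δ ≤ Z := Real.rpow_le_rpow_of_exponent_le hn1 hδ
  have hZ1 : 1 ≤ Z := hnδ1.trans hnδZ
  have hkpos : (0 : ℝ) < k := by exact_mod_cast hk1
  have hℓX : (ℓ : ℝ) ≤ 4 * X := natLog_add_one_le hn
  suffices hmain : (adjPairs G T : ℝ) ≤ (40 + 8 * n₀) * X * Z * (adjPairs G S : ℝ) by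
    rw [avgDegree_eq, avgDegree_eq, hSk, hT, ← mul_div_assoc]
    exact div_le_div_of_nonneg_right hmain hkpos.le
  -- the two possible lower bounds for the density of `S`
  have hXZ : 1 ≤ 2 * (X * Z) := by nlinarith
  have hsmall : adjPairs G T ≤ 8 * ℓ * adjPairs G S → (adjPairs G T : ℝ) ≤ (40 + 8 * n₀) * X * Z * (adjPairs G S : ℝ) := by
    intro h
    have h1 : (adjPairs G T : ℝ) ≤ 8 * ℓ * (adjPairs G S : ℝ) := by exact_mod_cast h
    have h2 : 8 * (ℓ : ℝ) ≤ (40 + 8 * n₀) * X * Z := by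
      have h3 : X ≤ X * Z := le_mul_of_one_le_right (by linarith) hZ1
      have h4 : 0 ≤ (n₀ : ℝ) * (X * Z) := by positivity
      nlinarith
    exact h1.trans (mul_le_mul_of_nonneg_right h2 (Nat.cast_nonneg _))
  have hlarge : (adjPairs G T : ℝ) ≤ 8 * (n : ℝ) ^ δ * (adjPairs G S : ℝ) → (adjPairs G T : ℝ) ≤ (40 + 8 * n₀) * X * Z * (adjPairs G S : ℝ) := by
    intro h
    refine h.trans (mul_le_mul_of_nonneg_right ?_ (Nat.cast_nonneg _))
    have h3 : Z ≤ 2 * X * Z := le_mul_of_one_le_left (by linarith) (by linarith)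
    have h4 : 0 ≤ (n₀ : ℝ) * (X * Z) := by positivity
    nlinarith
  rcases lt_or_ge n n₀ with hlt | hge
  · rcases (hweak T hT).2 with h | h
    · have h1 : (adjPairs G T : ℝ) ≤ n * k := by
        have := adjPairs_le_mul (G := G) T
        rw [hT] at this
        exact_mod_cast this
      have h2 : (k : ℝ) ≤ 4 * (adjPairs G S : ℝ) := by exact_mod_cast h
      have h3 : (n : ℝ) ≤ n₀ := by exact_mod_cast hlt.le
      calc (adjPairs G T : ℝ) ≤ n₀ * (4 * (adjPairs G S : ℝ)) := h1.trans (mul_le_mul h3 h2 hkpos.le (Nat.cast_nonneg _))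
        _ = 4 * n₀ * 1 * (adjPairs G S : ℝ) := by ring
        _ ≤ 4 * n₀ * (2 * (X * Z)) * (adjPairs G S : ℝ) := by gcongr
        _ = 8 * n₀ * X * Z * (adjPairs G S : ℝ) := by ring
        _ ≤ _ := by gcongr; linarith
    · exact hsmall h
  obtain ⟨herr, hβ5⟩ := hn₀ n hge
  set g := ⌊(adjPairs G T : ℝ) / k / (n : ℝ) ^ δ⌋₊ with hg
  rcases Nat.eq_zero_or_pos g with hg0 | hg0
  · -- the optimum has average degree less than `n ^ δ`
    rcases (hweak T hT).2 with h | h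
    · have h1 : (adjPairs G T : ℝ) / k / (n : ℝ) ^ δ < 1 := Nat.floor_eq_zero.1 hg0
      rw [div_lt_one (by linarith), div_lt_iff₀ hkpos] at h1
      have h2 : (k : ℝ) ≤ 4 * (adjPairs G S : ℝ) := by exact_mod_cast h
      refine hlarge (h1.le.trans ?_)
      nlinarith
    · exact hsmall h
  -- the parameters of the greedy phase
  have hgle : (g : ℝ) ≤ (adjPairs G T : ℝ) / k / (n : ℝ) ^ δ := Nat.floor_le (by positivity)
  have hgT : (g : ℝ) * (n : ℝ) ^ δ * k ≤ (adjPairs G T : ℝ) := by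
    rwa [le_div_iff₀ (by linarith), le_div_iff₀ hkpos] at hgle
  have hgpos : (1 : ℝ) ≤ g := by exact_mod_cast hg0
  have hgn : g ≤ n := by
    have h1 : (adjPairs G T : ℝ) ≤ n * k := by
      have := adjPairs_le_mul (G := G) T
      rw [hT] at this
      exact_mod_cast this
    have h2 : (g : ℝ) * k ≤ n * k := by
      refine le_trans ?_ (hgT.trans h1)
      rw [mul_right_comm]
      exact le_mul_of_one_le_right (by positivity) hnδ1
    exact_mod_cast le_of_mul_le_mul_right h2 hkpos
  rcases hS.dense_of_rates hn hk hkn hT hq hne hr0 hr1 hκ hJ hκ1 hκ2 hκ3 herr hβ5 hg0 hgn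
    hgT with h | h
  · refine hlarge ?_
    have h1 : (adjPairs G T : ℝ) / k / (n : ℝ) ^ δ < g + 1 := Nat.lt_floor_add_one _
    rw [div_lt_iff₀ (by linarith), div_lt_iff₀ hkpos] at h1
    have h2 : (g : ℝ) * k ≤ 4 * (adjPairs G S : ℝ) := by exact_mod_cast h
    have h3 : (g + 1) * (n : ℝ) ^ δ * k ≤ 2 * g * (n : ℝ) ^ δ * k := by
      gcongr
      linarith
    calc (adjPairs G T : ℝ) ≤ 2 * g * (n : ℝ) ^ δ * k := h1.le.trans h3
      _ = 2 * (n : ℝ) ^ δ * (g * k) := by ring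
      _ ≤ 2 * (n : ℝ) ^ δ * (4 * (adjPairs G S : ℝ)) := by gcongr
      _ = _ := by ring
  · exact hsmall h

end Main

theorem theorem5p2 (ε β : ℝ) (hε₀ : 0 < ε) (hε₁ : ε < 1 / 2) (hβ₀ : 0 < β) (hβ₁ : β < 1)
    (c : ℝ) (hc : 0 < c) :
    ∃ P : RAMProg, ∃ A B : ℝ, ∀ (n k : ℕ), 2 ≤ n → |(k : ℝ) - (n : ℝ) ^ β| < 1 →
      ∀ G : SimpleGraph (Fin n),
        (∀ ω : ℕ → Bool, ∃ (s : RAMState) (t : ℕ), RAMExec ω P (dksInput G k) s t ∧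
          (t : ℝ) ≤ (2 : ℝ) ^
            (A * Real.log n ^ B * (n : ℝ) ^ (2 * β * ε / (2 * β * ε + (1 - β))))) ∧
        ENNReal.ofReal (1 - (n : ℝ) ^ (-c)) ≤
          fairCoins {ω : ℕ → Bool | ∃ (s : RAMState) (t : ℕ), RAMExec ω P (dksInput G k) s t ∧
            IsDkSApprox G k
              (A * Real.log n ^ B * (n : ℝ) ^ (β * (1 - β) * (1 - ε))) (dksOutput n s)} := by
  have hβε : 0 < β * ε := mul_pos hβ₀ hε₀
  set γ := 2 * β * ε / (2 * β * ε + (1 - β)) with hγ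
  have hγ1 : γ < 1 := by
    rw [hγ, div_lt_one (by linarith)]
    linarith
  have hlt : β * ε / (1 - β + β * ε) < γ := by
    rw [hγ, div_lt_div_iff₀ (by linarith) (by linarith)]
    nlinarith
  have hpos : 0 < β * ε / (1 - β + β * ε) := div_pos hβε (by linarith)
  -- a rational exponent for the length of the set programs
  obtain ⟨x, hx1, hx2⟩ := exists_rat_btwn hlt
  have hx0 : 0 < x := by exact_mod_cast hpos.trans hx1
  set p := x.num.toNat with hp
  set q := x.den with hq
  have hq1 : 1 ≤ q := x.pos
  have hxpq : (x : ℝ) = (p : ℝ) / q := by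
    have h1 : ((p : ℤ) : ℝ) = (x.num : ℝ) := by
      rw [hp, Int.toNat_of_nonneg (Rat.num_nonneg.2 hx0.le)]
    rw [Rat.cast_def, ← h1, Int.cast_natCast]
  rw [hxpq] at hx1 hx2
  have hqpos : (0 : ℝ) < q := by exact_mod_cast hq1
  obtain ⟨c₁, hc₁, A₁, hA₁, hratio⟩ := exists_ratio hε₀ (by linarith) hβ₀ hβ₁ hq1 hx1
  obtain ⟨P, C, E, hP⟩ := Cmd.exists_search_program (p := p) hq1 hc₁
  obtain ⟨A₂, hA₂, htime⟩ := exists_time_bound C E c₁ hc₁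
  refine ⟨P, A₁ + A₂, 1, fun n k hn hk G => ?_⟩
  obtain ⟨hk1, hkn⟩ := size_bounds hβ₀ hβ₁ hn hk
  obtain ⟨e, he1, he2, hrun⟩ := hP n k G (by omega) hkn
  obtain ⟨s, t, hexec, ht, hS⟩ := hrun _ _ rfl rfl
  have hn1 : (1 : ℝ) ≤ n := by exact_mod_cast (by omega : 1 ≤ n)
  have hX := half_le_log hn
  rw [Real.rpow_one]
  have hA : ∀ z : ℝ, 0 ≤ z → ∀ A, A ≤ A₁ + A₂ → A * Real.log n * z ≤ (A₁ + A₂) * Real.log n * z :=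
    fun z hz A hA => mul_le_mul_of_nonneg_right (mul_le_mul_of_nonneg_right hA (by linarith)) hz
  refine ⟨fun ω => ⟨s, t, hexec ω, ?_⟩, ?_⟩
  · have hpq : p ≤ q := by
      have : (p : ℝ) / q < 1 := hx2.trans hγ1
      rw [div_lt_one hqpos] at this
      exact_mod_cast this.le
    have hL1 : 2 ^ (p * e) ≤ n :=
      (Nat.pow_le_pow_right (by omega) (Nat.mul_le_mul_right e hpq)).trans he1
    have hL2 : ((2 ^ (p * e) : ℕ) : ℝ) ≤ (n : ℝ) ^ γ := by
      have h1 : ((2 ^ (p * e) : ℕ) : ℝ) = ((2 ^ (q * e) : ℕ) : ℝ) ^ ((p : ℝ) / q) := by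
        push_cast
        rw [← Real.rpow_natCast, ← Real.rpow_natCast, ← Real.rpow_mul (by norm_num)]
        congr 1
        push_cast
        field_simp
      rw [h1]
      have h2 : ((2 ^ (q * e) : ℕ) : ℝ) ≤ n := by exact_mod_cast he1
      refine (Real.rpow_le_rpow (by positivity) h2 (by positivity)).trans ?_
      exact Real.rpow_le_rpow_of_exponent_le hn1 hx2.le
    have h1 := htime n (2 ^ (p * e)) γ hn (hpos.trans hlt).le hL1 hL2
    have h2 : (t : ℝ) ≤ ((C * ((n + c₁ * 2 ^ (p * e) + 5) ^ (6 * (c₁ * 2 ^ (p * e)) + 1) + 1) ^ E :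
        ℕ) : ℝ) := by exact_mod_cast ht
    refine (h2.trans h1).trans (Real.rpow_le_rpow_of_exponent_le (by norm_num) ?_)
    exact hA _ (by positivity) _ (by linarith)
  · obtain ⟨hcard, happ⟩ := hratio n k e G _ hn hk he2 hS
    have huniv : {ω : ℕ → Bool | ∃ (s : RAMState) (t : ℕ), RAMExec ω P (dksInput G k) s t ∧
        IsDkSApprox G k ((A₁ + A₂) * Real.log n * (n : ℝ) ^ (β * (1 - β) * (1 - ε)))
          (dksOutput n s)} = Set.univ := by
      refine Set.eq_univ_of_forall fun ω => ⟨s, t, hexec ω, hcard, fun T hT => ?_⟩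
      refine (happ T hT).trans (mul_le_mul_of_nonneg_right (hA _ (by positivity) _ (by linarith)) ?_)
      rw [avgDegree_eq]
      positivity
    have : IsProbabilityMeasure fairCoins := by
      unfold fairCoins
      infer_instance
    rw [huniv, measure_univ]
    refine ENNReal.ofReal_le_one.2 ?_
    have : 0 ≤ (n : ℝ) ^ (-c) := by positivity
    linarith
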